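/- Let $g,\sigma>0$ and $[\![\gamma]\!]\in\mathbb R$ with $|[\![\gamma]\!]|/\sigma<1$. For positive $\rho\in H^1(0,\pi)$ put $$E(\rho)=\frac g3\int_0^\pi\rho^3\sin\theta\,d\theta+\sigma\int_0^\pi\sqrt{\rho^2+\rho'^2}\,d\theta-[\![\gamma]\!]\,(\rho(0)+\rho(\pi)).$$ Let $\rho_0\in C^\infty([0,\pi])$ be positive and a critical point of $E$ under the volume constraint $\int_0^\pi\rho^2=\int_0^\pi\rho_0^2$ (in particular, any smooth positive minimizer), that is, $\frac{d}{dt}\big|_{t=0}E(\rho_0+t\xi)=0$ for every $\xi\in D:=\{\xi\in H^1(0,\pi):\int_0^\pi\xi\rho_0\,d\theta=0\}$. For $\xi\in D$ let $E''(\rho_0)(\xi,\xi)$ be the second derivative at $t=0$ of $t\mapsto E(\rho_t)$, where $\rho_t=\lambda(t)(\rho_0+t\xi)$ and $\lambda(t)>0$ is chosen so that $\int_0^\pi\rho_t^2=\int_0^\pi\rho_0^2$; let $E''(\rho_0)(\xi,\eta)=\frac12\big(E''(\rho_0)(\xi+\eta,\xi+\eta)-E''(\rho_0)(\xi,\xi)-E''(\rho_0)(\eta,\eta)\big)$.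 Put $$\xi_s=\cos\theta+\frac{\rho_0'}{\rho_0}\sin\theta .$$ 1. $\xi_s$ is the horizontal shifting function of $\rho_0$: for all small $c$ the curve $\{(\rho_0(\theta)\cos\theta+c,\ \rho_0(\theta)\sin\theta):\theta\in[0,\pi]\}$ has a positive polar profile $\rho_{0,c}$ on $[0,\pi]$ about the origin, and $\frac{d}{dc}\big|_{c=0}\rho_{0,c}(\theta)=\xi_s(\theta)$ for every $\theta\in[0,\pi]$. 2. The second variation exists for every $\xi\in D$, and $$E''(\rho_0)(\xi,\xi)=g\int_0^\pi\rho_0\xi^2\sin\theta\,d\theta+\sigma\int_0^\pi\Big(-\frac{\rho_0^2+2\rho_0'^2-\rho_0''\rho_0}{(\rho_0^2+\rho_0'^2)^{3/2}}\xi^2+\frac{\xi^2+\xi'^2}{(\rho_0^2+\rho_0'^2)^{1/2}}-\frac{(\xi\rho_0+\rho_0'\xi')^2}{(\rho_0^2+\rho_0'^2)^{3/2}}\Big)d\theta .$$ Moreover $\xi_s\in D$, and for every $\xi\in D$, $E''(\rho_0)(\xi,\xi)=0$ if and only if $\xi=C\xi_s$ on $[0,\pi]$ for some constant $C$. Thus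 $$\ker E''(\rho_0)=\{\xi\in D:E''(\rho_0)(\xi,\xi)=0\}=\{\xi\in D:E''(\rho_0)(\xi,\eta)=0\ \ \forall\eta\in D\}=\operatorname{span}\{\xi_s\}.$$ -/

import Mathlib

open Set Filter Topology MeasureTheory

namespace SessileDrop

noncomputable section

/-- `H¹(0,π)` in one space dimension, through its continuous representatives: `ξ` is absolutely
continuous on `[0,π]` and its (almost everywhere defined) derivative is square integrable. Only the
values of `ξ` on `[0,π]` matter. -/
structure IsH1 (ξ : ℝ → ℝ) : Prop where
  absCont : AbsolutelyContinuousOnInterval ξ 0 Real.pi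
  memLp_deriv : MemLp (deriv ξ) 2 (volume.restrict (Ioo 0 Real.pi))

/-- The volume functional `∫₀^π ρ²` (twice the area of the droplet with profile `ρ`). -/
def volumeFunctional (ρ : ℝ → ℝ) : ℝ := ∫ θ in (0 : ℝ)..Real.pi, ρ θ ^ 2

/-- The energy of the sessile drop `{(r, θ) : 0 < r < ρ(θ), 0 < θ < π}`: gravity `g`, surface
tension `σ`, and `γ` the jump of the solid-vapor and solid-fluid surface energies. -/
def energy (g σ γ : ℝ) (ρ : ℝ → ℝ) : ℝ :=
  g / 3 * (∫ θ in (0 : ℝ)..Real.pi, ρ θ ^ 3 * Real.sin θ)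
    + σ * (∫ θ in (0 : ℝ)..Real.pi, Real.sqrt (ρ θ ^ 2 + deriv ρ θ ^ 2))
    - γ * (ρ 0 + ρ Real.pi)

/-- The admissible perturbations `D`: functions in `H¹` that preserve the volume to first order. -/
structure IsAdmissible (ρ₀ ξ : ℝ → ℝ) : Prop where
  isH1 : IsH1 ξ
  orthogonal : ∫ θ in (0 : ℝ)..Real.pi, ξ θ * ρ₀ θ = 0

/-- `ρ₀` is an equilibrium profile: smooth on `[0,π]`, positive, and a critical point of the energy
under the volume constraint, that is, `E'(ρ₀)(ξ) = 0` for every admissible perturbation `ξ`. -/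
structure IsEquilibrium (g σ γ : ℝ) (ρ₀ : ℝ → ℝ) : Prop where
  smooth : ContDiffOn ℝ (⊤ : ℕ∞) ρ₀ (Icc 0 Real.pi)
  pos : ∀ θ ∈ Icc 0 Real.pi, 0 < ρ₀ θ
  stationary : ∀ ξ : ℝ → ℝ, IsAdmissible ρ₀ ξ →
    HasDerivAt (fun t : ℝ => energy g σ γ (fun θ => ρ₀ θ + t * ξ θ)) 0 0

/-- The volume-preserving curve `t ↦ ρ₀ + t ξ + O(t²)` through `ρ₀`: the profile `ρ₀ + t ξ`, rescaled
to the volume of `ρ₀`. For admissible `ξ` its velocity at `t = 0` is `ξ`. -/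
def volumePreservingCurve (ρ₀ ξ : ℝ → ℝ) (t : ℝ) : ℝ → ℝ := fun θ =>
  Real.sqrt (volumeFunctional ρ₀ / volumeFunctional (fun φ => ρ₀ φ + t * ξ φ))
    * (ρ₀ θ + t * ξ θ)

/-- The energy along the volume-preserving curve in the direction `ξ`. -/
def energyAlong (g σ γ : ℝ) (ρ₀ ξ : ℝ → ℝ) (t : ℝ) : ℝ :=
  energy g σ γ (volumePreservingCurve ρ₀ ξ t)

/-- The second variation `E''(ρ₀)(ξ, ξ)` of the energy under the volume constraint: the second
derivative at `t = 0` of the energy along the volume-preserving curve in the direction `ξ`. -/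
def secondVariation (g σ γ : ℝ) (ρ₀ ξ : ℝ → ℝ) : ℝ :=
  deriv (deriv (energyAlong g σ γ ρ₀ ξ)) 0

/-- The symmetric bilinear form `E''(ρ₀)(ξ, η)`, from the quadratic form by polarization. -/
def secondVariationBilin (g σ γ : ℝ) (ρ₀ ξ η : ℝ → ℝ) : ℝ :=
  (secondVariation g σ γ ρ₀ (fun θ => ξ θ + η θ)
    - secondVariation g σ γ ρ₀ ξ - secondVariation g σ γ ρ₀ η) / 2

/-- The explicit quadratic form `F₀(ξ)` that represents the second variation. -/
def secondVariationFormula (g σ : ℝ) (ρ₀ ξ : ℝ → ℝ) : ℝ :=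
  g * (∫ θ in (0 : ℝ)..Real.pi, ρ₀ θ * ξ θ ^ 2 * Real.sin θ)
    + σ * (∫ θ in (0 : ℝ)..Real.pi,
        (-((ρ₀ θ ^ 2 + 2 * deriv ρ₀ θ ^ 2 - deriv (deriv ρ₀) θ * ρ₀ θ)
              / Real.sqrt (ρ₀ θ ^ 2 + deriv ρ₀ θ ^ 2) ^ 3) * ξ θ ^ 2
          + (ξ θ ^ 2 + deriv ξ θ ^ 2) / Real.sqrt (ρ₀ θ ^ 2 + deriv ρ₀ θ ^ 2)
          - (ξ θ * ρ₀ θ + deriv ρ₀ θ * deriv ξ θ) ^ 2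
              / Real.sqrt (ρ₀ θ ^ 2 + deriv ρ₀ θ ^ 2) ^ 3))

/-- The free surface with polar profile `ρ`, as a curve in the upper half plane. -/
def freeSurface (ρ : ℝ → ℝ) : Set (ℝ × ℝ) :=
  (fun θ : ℝ => (ρ θ * Real.cos θ, ρ θ * Real.sin θ)) '' Icc 0 Real.pi

/-- `ρ` is the positive polar profile, about the unchanged pole, of the free surface of `ρ₀` moved
horizontally by `c`. -/
def IsHorizontalShift (ρ₀ : ℝ → ℝ) (c : ℝ) (ρ : ℝ → ℝ) : Prop :=
  (∀ θ ∈ Icc 0 Real.pi, 0 < ρ θ) ∧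
    freeSurface ρ = (fun p : ℝ × ℝ => (p.1 + c, p.2)) '' freeSurface ρ₀

/-- The function `ξ_s = cos θ + (ρ₀' / ρ₀) sin θ`. At the two end points the second term vanishes,
whatever the value of `deriv ρ₀` there. -/
def xiS (ρ₀ : ℝ → ℝ) (θ : ℝ) : ℝ :=
  Real.cos θ + deriv ρ₀ θ / ρ₀ θ * Real.sin θ

end

end SessileDrop

namespace SessileDrop

noncomputable section

/-! Write `x = r cos θ`, `y = r sin θ`, `W = √(r² + r'²)`. Constrained criticality gives the
capillary equation `σ κ = μ - g y` and Young's law at `θ = 0`; testing with the profile itself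
identifies the multiplier `μ` with the scaling derivative of the energy divided by the volume
(`IsEquilibrium.exists_isCapillaryProfile`). In terms of `u = ξ / r` the second variation loses its
mixed term and becomes `Q(u) = ∫ a u'² + b u²` with `a = σ r⁴ / W³` and `b = r² (2 g y - μ)`, while
the constraint reads `∫ r² u = 0`.

Translation invariance supplies a solution `z = y' / r²` of the Jacobi equation `(a z')' = b z`,
with flux `a z' = -y (μ - g y)`. The flux vanishes at both ends, so `z` satisfies the natural
boundary conditions and is `Q`-orthogonal to everything. The pressure excess `μ - g y` is positive:
the first integral of the capillary equation and a Gronwall argument exclude the opposite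
(`excessPressure_pos`). Hence `z` is strictly decreasing and vanishes only at the apex `c`, where
`y' = 0`.

On each side of `c` the solution `z` has no zero, and Jacobi's completion of the square
(`half_jacobi`) shows that `Q ≥ 0` on functions vanishing at `c`, with equality only for multiples
of `z` on each side.

A general `u` need not vanish at `c`. This is repaired by a second explicit field `η`, the response
to a change of pressure, which solves `(a η')' = b η + r²` with natural boundary conditions. Then
`Q(u, η) = -∫ r² u = 0` for admissible `u`, and `Q(η) = -N` with `N = ∫ r² η`. Since `η(c) > 0`, one
can subtract a multiple of `η` to get `w = u + t η` with `w(c) = 0`, and `Q(u) = Q(w) + t² N`. The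
decisive inequality `N > 0` (`integral_pressureField_pos`) comes from comparing the area integral `∫
y x'` with its weighted version, the weight being increasing in height.

If `Q(u) = 0`, then `t = 0` and `u` equals `C₁ z` on the left of `c` and `C₂ z` on the right. As `r²
z = y'`, the volume constraint is `(C₁ - C₂) y(c) = 0`, so `u` is a single multiple of `z`, that is,
`ξ` is a multiple of `ξ_s = r z`.

The geometric meaning of `ξ_s` is independent of criticality: the point of the shifted curve on the
ray `θ` comes from an angle `φ` with `r(φ) sin (φ - θ) = c sin θ`, where `c` now denotes the shift,
and this relation is differentiated at `c = 0`. -/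

/-- Lebesgue measure on the range `(0, π]` of polar angles. -/
abbrev arcMeasure : Measure ℝ := volume.restrict (Ioc 0 Real.pi)

/-! ### Calculus and integrability on `[0,π]`. -/

/-- `f` has derivative `f'` on the closed interval `[0,π]`, one-sided at the end points. -/
def HasDerivOn (f f' : ℝ → ℝ) : Prop :=
  ∀ θ ∈ Icc 0 Real.pi, HasDerivWithinAt f (f' θ) (Icc 0 Real.pi) θ

lemma uIcc_zero_pi : uIcc 0 Real.pi = Icc 0 Real.pi := uIcc_of_le Real.pi_pos.le

lemma ae_arc_mem_Ioo : ∀ᵐ θ ∂arcMeasure, θ ∈ Ioo 0 Real.pi := by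
  rw [arcMeasure, ← restrict_Ioo_eq_restrict_Ioc]
  exact ae_restrict_mem measurableSet_Ioo

lemma integral_arc_congr {f g : ℝ → ℝ} (h : ∀ᵐ θ ∂arcMeasure, f θ = g θ) :
    ∫ θ in (0 : ℝ)..Real.pi, f θ = ∫ θ in (0 : ℝ)..Real.pi, g θ := by
  rw [intervalIntegral.integral_of_le Real.pi_pos.le,
    intervalIntegral.integral_of_le Real.pi_pos.le]
  exact integral_congr_ae h

lemma intervalIntegrable_arc_iff {f : ℝ → ℝ} :
    IntervalIntegrable f volume 0 Real.pi ↔ Integrable f arcMeasure := by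
  rw [intervalIntegrable_iff_integrableOn_Ioc_of_le Real.pi_pos.le]; rfl

lemma aestronglyMeasurable_arc {f : ℝ → ℝ} (hf : ContinuousOn f (Icc 0 Real.pi)) :
    AEStronglyMeasurable f arcMeasure :=
  (hf.mono Ioc_subset_Icc_self).aestronglyMeasurable measurableSet_Ioc

lemma memLp_arc {f : ℝ → ℝ} (hf : ContinuousOn f (Icc 0 Real.pi)) (s : ENNReal) :
    MemLp f s arcMeasure := by
  obtain ⟨C, hC⟩ := isCompact_Icc.exists_bound_of_continuousOn hf
  refine MemLp.of_bound (aestronglyMeasurable_arc hf) C ?_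
  filter_upwards [ae_arc_mem_Ioo] with θ hθ using hC θ (Ioo_subset_Icc_self hθ)

lemma memLp_arc_mul {f h : ℝ → ℝ} (hf : ContinuousOn f (Icc 0 Real.pi))
    (hh : MemLp h 2 arcMeasure) : MemLp (fun θ => f θ * h θ) 2 arcMeasure :=
  hh.mul' (memLp_arc hf ⊤)

lemma integrable_arc_mul {f h : ℝ → ℝ} (hf : ContinuousOn f (Icc 0 Real.pi))
    (hh : Integrable h arcMeasure) : Integrable (fun θ => f θ * h θ) arcMeasure := by
  rw [← memLp_one_iff_integrable] at hh ⊢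
  exact hh.mul' (memLp_arc hf ⊤)

lemma integrable_arc {f : ℝ → ℝ} (hf : ContinuousOn f (Icc 0 Real.pi)) :
    Integrable f arcMeasure :=
  memLp_one_iff_integrable.1 (memLp_arc hf 1)

lemma HasDerivOn.continuousOn {f f' : ℝ → ℝ} (h : HasDerivOn f f') :
    ContinuousOn f (Icc 0 Real.pi) := fun θ hθ => (h θ hθ).continuousWithinAt

lemma HasDerivOn.hasDerivAt {f f' : ℝ → ℝ} (h : HasDerivOn f f') {θ : ℝ}
    (hθ : θ ∈ Ioo 0 Real.pi) : HasDerivAt f (f' θ) θ :=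
  (h θ (Ioo_subset_Icc_self hθ)).hasDerivAt (Icc_mem_nhds hθ.1 hθ.2)

lemma HasDerivOn.deriv_eq {f f' : ℝ → ℝ} (h : HasDerivOn f f') {θ : ℝ}
    (hθ : θ ∈ Ioo 0 Real.pi) : deriv f θ = f' θ := (h.hasDerivAt hθ).deriv

lemma HasDerivOn.congr {f f' k k' : ℝ → ℝ} (h : HasDerivOn f f')
    (hk : ∀ θ ∈ Icc 0 Real.pi, k θ = f θ) (hk' : ∀ θ ∈ Icc 0 Real.pi, k' θ = f' θ) :
    HasDerivOn k k' := fun θ hθ => by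
  rw [hk' θ hθ]; exact (h θ hθ).congr hk (hk θ hθ)

/-- A function with continuous derivative on a compact interval is absolutely continuous. -/
lemma absCont_of_hasDerivWithinAt {f f' : ℝ → ℝ} {a b : ℝ}
    (h : ∀ θ ∈ uIcc a b, HasDerivWithinAt f (f' θ) (uIcc a b) θ)
    (hf' : ContinuousOn f' (uIcc a b)) : AbsolutelyContinuousOnInterval f a b := by
  obtain ⟨C, hC⟩ := isCompact_uIcc.exists_bound_of_continuousOn hf'
  have hL : LipschitzOnWith C.toNNReal f (uIcc a b) := by
    refine (convex_uIcc _ _).lipschitzOnWith_of_nnnorm_hasDerivWithin_le h fun x hx => ?_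
    rw [← NNReal.coe_le_coe, coe_nnnorm]
    exact (hC x hx).trans (Real.le_coe_toNNReal C)
  exact hL.absolutelyContinuousOnInterval

lemma HasDerivOn.absCont {f f' : ℝ → ℝ} (h : HasDerivOn f f')
    (hf' : ContinuousOn f' (Icc 0 Real.pi)) : AbsolutelyContinuousOnInterval f 0 Real.pi := by
  rw [← uIcc_zero_pi] at hf'
  refine absCont_of_hasDerivWithinAt ?_ hf'
  rw [uIcc_zero_pi]
  exact h

lemma HasDerivOn.isH1 {f f' : ℝ → ℝ} (h : HasDerivOn f f')
    (hf' : ContinuousOn f' (Icc 0 Real.pi)) : IsH1 f := by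
  refine ⟨h.absCont hf', ?_⟩
  rw [restrict_Ioo_eq_restrict_Ioc]
  refine (memLp_congr_ae ?_).2 (memLp_arc hf' 2)
  filter_upwards [ae_arc_mem_Ioo] with θ hθ using h.deriv_eq hθ

lemma HasDerivOn.integral_eq {f f' : ℝ → ℝ} (h : HasDerivOn f f')
    (hf' : ContinuousOn f' (Icc 0 Real.pi)) :
    ∫ θ in (0 : ℝ)..Real.pi, f' θ = f Real.pi - f 0 :=
  intervalIntegral.integral_eq_sub_of_hasDerivAt_of_le Real.pi_pos.le h.continuousOn
    (fun _ hθ => h.hasDerivAt hθ) (intervalIntegrable_arc_iff.2 (integrable_arc hf'))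

/-- A function with vanishing derivative on `[0,π]` is constant there. -/
lemma HasDerivOn.eq_of_deriv_zero {f : ℝ → ℝ} (h : HasDerivOn f (fun _ => 0)) {θ : ℝ}
    (hθ : θ ∈ Icc 0 Real.pi) : f θ = f 0 := by
  refine (convex_Icc (0 : ℝ) Real.pi).is_const_of_fderivWithin_eq_zero (𝕜 := ℝ)
    (fun x hx => (h x hx).differentiableWithinAt) (fun x hx => ?_) hθ
    (left_mem_Icc.2 Real.pi_pos.le)
  ext
  rw [fderivWithin_derivWithin,
    (h x hx).derivWithin ((uniqueDiffOn_Icc Real.pi_pos) x hx)]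
  simp

/-- A primitive of a continuous function on `[0,π]`, based at an arbitrary point. -/
lemma hasDerivOn_integral {f : ℝ → ℝ} (hf : ContinuousOn f (Icc 0 Real.pi)) {a : ℝ}
    (ha : a ∈ Icc 0 Real.pi) : HasDerivOn (fun θ => ∫ φ in a..θ, f φ) f := by
  intro θ hθ
  have : Fact (θ ∈ Icc 0 Real.pi) := ⟨hθ⟩
  refine intervalIntegral.integral_hasDerivWithinAt_right (t := Icc 0 Real.pi) ?_ ?_ (hf θ hθ)
  · exact (hf.mono (uIcc_subset_Icc ha hθ)).intervalIntegrable
  · exact hf.stronglyMeasurableAtFilter_nhdsWithin measurableSet_Icc θ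

/-! ### `H¹` functions on the interval. -/

namespace IsH1

variable {ξ η : ℝ → ℝ}

lemma continuousOn (h : IsH1 ξ) : ContinuousOn ξ (Icc 0 Real.pi) :=
  uIcc_zero_pi ▸ h.absCont.continuousOn

lemma memLp_arc_deriv (h : IsH1 ξ) : MemLp (deriv ξ) 2 arcMeasure := by
  have := h.memLp_deriv
  rwa [restrict_Ioo_eq_restrict_Ioc] at this

lemma ae_differentiableAt (h : IsH1 ξ) : ∀ᵐ θ ∂arcMeasure, DifferentiableAt ℝ ξ θ := by
  rw [ae_restrict_iff' measurableSet_Ioc]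
  filter_upwards [h.absCont.ae_differentiableAt] with θ hθ hm
  exact hθ (uIcc_zero_pi ▸ Ioc_subset_Icc_self hm)

lemma congr (h : IsH1 ξ) (he : ∀ θ ∈ Icc 0 Real.pi, η θ = ξ θ) : IsH1 η := by
  constructor
  · refine Tendsto.congr' ?_ h.absCont
    refine eventually_inf_principal.2 (Eventually.of_forall fun E hE => ?_)
    refine Finset.sum_congr rfl fun i hi => ?_
    have := hE.1 i hi
    rw [uIcc_zero_pi] at this
    rw [he _ this.1, he _ this.2]
  · refine (memLp_congr_ae ?_).2 h.memLp_deriv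
    filter_upwards [ae_restrict_mem measurableSet_Ioo] with θ hθ
    refine EventuallyEq.deriv_eq ?_
    filter_upwards [Ioo_mem_nhds hθ.1 hθ.2] with φ hφ using he φ (Ioo_subset_Icc_self hφ)

lemma mul (h : IsH1 ξ) (k : IsH1 η) : IsH1 (fun θ => ξ θ * η θ) := by
  refine ⟨h.absCont.fun_mul k.absCont, ?_⟩
  rw [restrict_Ioo_eq_restrict_Ioc]
  refine (memLp_congr_ae (g := fun θ => η θ * deriv ξ θ + ξ θ * deriv η θ) ?_).2 ?_
  · filter_upwards [h.ae_differentiableAt, k.ae_differentiableAt] with θ h1 h2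
    rw [(h1.hasDerivAt.fun_mul h2.hasDerivAt).deriv]; ring
  · exact (memLp_arc_mul k.continuousOn h.memLp_arc_deriv).add
      (memLp_arc_mul h.continuousOn k.memLp_arc_deriv)

lemma const_mul (h : IsH1 ξ) (c : ℝ) : IsH1 (fun θ => c * ξ θ) := by
  refine ⟨h.absCont.const_mul c, ?_⟩
  refine (memLp_congr_ae ?_).2 (h.memLp_deriv.const_mul c)
  exact Eventually.of_forall fun θ => deriv_const_mul_field c

lemma add (h : IsH1 ξ) (k : IsH1 η) : IsH1 (fun θ => ξ θ + η θ) := by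
  refine ⟨h.absCont.fun_add k.absCont, ?_⟩
  rw [restrict_Ioo_eq_restrict_Ioc]
  refine (memLp_congr_ae (g := fun θ => deriv ξ θ + deriv η θ) ?_).2
    (h.memLp_arc_deriv.add k.memLp_arc_deriv)
  filter_upwards [h.ae_differentiableAt, k.ae_differentiableAt] with θ h1 h2
  exact (h1.hasDerivAt.fun_add h2.hasDerivAt).deriv

lemma mono_absCont (h : IsH1 ξ) {a b : ℝ} (ha : a ∈ Icc 0 Real.pi) (hb : b ∈ Icc 0 Real.pi) :
    AbsolutelyContinuousOnInterval ξ a b :=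
  h.absCont.mono (by rw [uIcc_zero_pi]; exact uIcc_subset_Icc ha hb)

/-- Integration by parts of an `H¹` function against a `C¹` function. -/
lemma integral_by_parts (h : IsH1 ξ) {f f' : ℝ → ℝ} (hf : HasDerivOn f f')
    (hf' : ContinuousOn f' (Icc 0 Real.pi)) :
    ∫ θ in (0 : ℝ)..Real.pi, (f' θ * ξ θ + f θ * deriv ξ θ) = f Real.pi * ξ Real.pi - f 0 * ξ 0 := by
  rw [← (hf.isH1 hf').absCont.integral_deriv_mul_eq_sub h.absCont]
  refine integral_arc_congr ?_
  filter_upwards [ae_arc_mem_Ioo] with θ hθ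
  rw [hf.deriv_eq hθ]

end IsH1

/-! ### Length of a perturbed profile and its two derivatives in the parameter. -/

/-- The length element `√(r² + p²)` of a polar curve with radius `r` and derivative `p`. -/
def arcSpeed (r p : ℝ → ℝ) (θ : ℝ) : ℝ := Real.sqrt (r θ ^ 2 + p θ ^ 2)

lemma hasDerivAt_sqrt_line {a b x y t : ℝ} (h : 0 < a + t * x) :
    HasDerivAt (fun t => Real.sqrt ((a + t * x) ^ 2 + (b + t * y) ^ 2))
      (((a + t * x) * x + (b + t * y) * y)
        / Real.sqrt ((a + t * x) ^ 2 + (b + t * y) ^ 2)) t := by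
  have hpos : 0 < (a + t * x) ^ 2 + (b + t * y) ^ 2 := by positivity
  have h1 : HasDerivAt (fun t => a + t * x) x t := by
    simpa using ((hasDerivAt_id t).mul_const x).const_add a
  have h2 : HasDerivAt (fun t => b + t * y) y t := by
    simpa using ((hasDerivAt_id t).mul_const y).const_add b
  convert! ((h1.pow 2).add (h2.pow 2)).sqrt hpos.ne' using 1
  simp only [Nat.cast_ofNat, Nat.add_one_sub_one, pow_one, Pi.add_apply, Pi.pow_apply]
  have := (Real.sqrt_pos.2 hpos).ne'
  field_simp

/-- Lagrange's identity `|v|² |w|² - (v·w)² = (v × w)²`. The cross product of `(a + t x, b + t y)`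
with `(x, y)` does not depend on `t`, so a lower bound on the root alone yields a dominating
function uniform in `t`. -/
lemma hasDerivAt_sqrt_line_deriv {a b x y t : ℝ} (h : 0 < a + t * x) :
    HasDerivAt (fun t => ((a + t * x) * x + (b + t * y) * y)
        / Real.sqrt ((a + t * x) ^ 2 + (b + t * y) ^ 2))
      ((a * y - b * x) ^ 2 / Real.sqrt ((a + t * x) ^ 2 + (b + t * y) ^ 2) ^ 3) t := by
  have hpos : 0 < (a + t * x) ^ 2 + (b + t * y) ^ 2 := by positivity
  have h1 : HasDerivAt (fun t => (a + t * x) * x + (b + t * y) * y) (x * x + y * y) t := by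
    have h1 : HasDerivAt (fun t => a + t * x) x t := by
      simpa using ((hasDerivAt_id t).mul_const x).const_add a
    have h2 : HasDerivAt (fun t => b + t * y) y t := by
      simpa using ((hasDerivAt_id t).mul_const y).const_add b
    exact (h1.mul_const x).add (h2.mul_const y)
  have hs := (Real.sqrt_pos.2 hpos).ne'
  convert! h1.div (hasDerivAt_sqrt_line (b := b) (y := y) h) hs using 1
  have hsq := Real.sq_sqrt hpos.le
  set S := Real.sqrt ((a + t * x) ^ 2 + (b + t * y) ^ 2)
  field_simp
  rw [hsq]; ring

/-- Supplies the `t`-independent integrable bound `|X| + |Y|` for differentiating the length under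
the integral. -/
lemma abs_add_div_sqrt_le (a b x y : ℝ) :
    |(a * x + b * y) / Real.sqrt (a ^ 2 + b ^ 2)| ≤ |x| + |y| := by
  have ha : |a| ≤ Real.sqrt (a ^ 2 + b ^ 2) := Real.abs_le_sqrt (by nlinarith)
  have hb : |b| ≤ Real.sqrt (a ^ 2 + b ^ 2) := Real.abs_le_sqrt (by nlinarith)
  rw [abs_div, abs_of_nonneg (Real.sqrt_nonneg _)]
  refine div_le_of_le_mul₀ (Real.sqrt_nonneg _) (by positivity) ?_
  calc |a * x + b * y| ≤ |a| * |x| + |b| * |y| := by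
        rw [← abs_mul, ← abs_mul]; exact abs_add_le _ _
    _ ≤ Real.sqrt (a ^ 2 + b ^ 2) * |x| + Real.sqrt (a ^ 2 + b ^ 2) * |y| := by gcongr
    _ = _ := by ring

section Length

variable {r p X Y : ℝ → ℝ}

lemma exists_pos_lower_bound (hr : ContinuousOn r (Icc 0 Real.pi))
    (hpos : ∀ θ ∈ Icc 0 Real.pi, 0 < r θ) : ∃ m > 0, ∀ θ ∈ Icc 0 Real.pi, m ≤ r θ := by
  obtain ⟨θ₀, h0, hmin⟩ := isCompact_Icc.exists_isMinOn (nonempty_Icc.2 Real.pi_pos.le) hr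
  exact ⟨r θ₀, hpos _ h0, fun θ hθ => hmin hθ⟩

/-- A small perturbation of a positive profile stays uniformly positive. -/
lemma exists_perturbation_bound (hr : ContinuousOn r (Icc 0 Real.pi))
    (hpos : ∀ θ ∈ Icc 0 Real.pi, 0 < r θ) (hX : ContinuousOn X (Icc 0 Real.pi)) :
    ∃ δ > 0, ∃ m > 0, ∀ t ∈ Metric.ball (0 : ℝ) δ, ∀ θ ∈ Icc 0 Real.pi, m ≤ r θ + t * X θ := by
  obtain ⟨m, hm, hmr⟩ := exists_pos_lower_bound hr hpos
  obtain ⟨M, hM⟩ := isCompact_Icc.exists_bound_of_continuousOn hX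
  have hM0 : 0 ≤ M := (norm_nonneg _).trans (hM 0 (left_mem_Icc.2 Real.pi_pos.le))
  -- With `m ≤ r` and `|X| ≤ M`, this radius gives `|t X| ≤ m / 2`; the `+ 1` covers `M = 0`.
  refine ⟨m / (2 * (M + 1)), by positivity, m / 2, by positivity, fun t ht θ hθ => ?_⟩
  rw [mem_ball_zero_iff, Real.norm_eq_abs, lt_div_iff₀ (by positivity)] at ht
  have h1 := hmr θ hθ
  have h2 : |t * X θ| ≤ |t| * M := by
    rw [abs_mul]; exact mul_le_mul_of_nonneg_left (hM θ hθ) (abs_nonneg t)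
  have h3 := neg_abs_le (t * X θ)
  nlinarith [abs_nonneg t]

lemma memLp_arc_line {f h : ℝ → ℝ} (hf : MemLp f 2 arcMeasure) (hh : MemLp h 2 arcMeasure)
    (t : ℝ) : MemLp (fun θ => f θ + t * h θ) 2 arcMeasure :=
  hf.add (hh.const_mul t)

lemma aestronglyMeasurable_sqrt_sq_add_sq {f h : ℝ → ℝ}
    (hf : AEStronglyMeasurable f arcMeasure) (hh : AEStronglyMeasurable h arcMeasure) :
    AEStronglyMeasurable (fun θ => Real.sqrt (f θ ^ 2 + h θ ^ 2)) arcMeasure :=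
  ((hf.aemeasurable.pow_const 2).add (hh.aemeasurable.pow_const 2)).sqrt.aestronglyMeasurable

lemma integrable_sqrt_sq_add_sq {f h : ℝ → ℝ}
    (hf : MemLp f 2 arcMeasure) (hh : MemLp h 2 arcMeasure) :
    Integrable (fun θ => Real.sqrt (f θ ^ 2 + h θ ^ 2)) arcMeasure := by
  have h1 := (hf.integrable one_le_two).norm.add (hh.integrable one_le_two).norm
  refine h1.mono' (aestronglyMeasurable_sqrt_sq_add_sq hf.1 hh.1) (Eventually.of_forall fun θ => ?_)
  rw [Real.norm_of_nonneg (Real.sqrt_nonneg _)]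
  simp only [Pi.add_apply, Real.norm_eq_abs]
  refine Real.sqrt_le_iff.2 ⟨by positivity, ?_⟩
  nlinarith [sq_abs (f θ), sq_abs (h θ), mul_nonneg (abs_nonneg (f θ)) (abs_nonneg (h θ))]

/-- The length of `r + tX` (with derivative `p + tY`) is differentiable in `t`. -/
lemma hasDerivAt_length (hr : ContinuousOn r (Icc 0 Real.pi))
    (hp : ContinuousOn p (Icc 0 Real.pi)) (hX : ContinuousOn X (Icc 0 Real.pi))
    (hY : MemLp Y 2 arcMeasure) {δ m : ℝ} (hm : 0 < m)
    (hδ : ∀ t ∈ Metric.ball (0 : ℝ) δ, ∀ θ ∈ Icc 0 Real.pi, m ≤ r θ + t * X θ) {t : ℝ}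
    (ht : t ∈ Metric.ball (0 : ℝ) δ) :
    HasDerivAt (fun t => ∫ θ in (0 : ℝ)..Real.pi,
        Real.sqrt ((r θ + t * X θ) ^ 2 + (p θ + t * Y θ) ^ 2))
      (∫ θ in (0 : ℝ)..Real.pi, ((r θ + t * X θ) * X θ + (p θ + t * Y θ) * Y θ)
        / Real.sqrt ((r θ + t * X θ) ^ 2 + (p θ + t * Y θ) ^ 2)) t := by
  have hrX := fun t => memLp_arc_line (memLp_arc hr 2) (memLp_arc hX 2) t
  have hpY := fun t => memLp_arc_line (memLp_arc hp 2) hY t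
  have hu : uIoc 0 Real.pi = Ioc 0 Real.pi := uIoc_of_le Real.pi_pos.le
  refine (intervalIntegral.hasDerivAt_integral_of_dominated_loc_of_deriv_le
    (F' := fun t θ => ((r θ + t * X θ) * X θ + (p θ + t * Y θ) * Y θ)
        / Real.sqrt ((r θ + t * X θ) ^ 2 + (p θ + t * Y θ) ^ 2))
    (bound := fun θ => |X θ| + |Y θ|)
    (Metric.isOpen_ball.mem_nhds ht) ?_ ?_ ?_ ?_ ?_ ?_).2
  · rw [hu]
    exact Eventually.of_forall fun t => aestronglyMeasurable_sqrt_sq_add_sq (hrX t).1 (hpY t).1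
  · exact intervalIntegrable_arc_iff.2 (integrable_sqrt_sq_add_sq (hrX t) (hpY t))
  · rw [hu]
    exact ((((hrX t).1.aemeasurable.mul (aestronglyMeasurable_arc hX).aemeasurable).add
      ((hpY t).1.aemeasurable.mul hY.1.aemeasurable)).div
      (aestronglyMeasurable_sqrt_sq_add_sq (hrX t).1
        (hpY t).1).aemeasurable).aestronglyMeasurable
  · exact Eventually.of_forall fun θ _ t _ => abs_add_div_sqrt_le _ _ _ _
  · exact intervalIntegrable_arc_iff.2
      ((integrable_arc hX).norm.add (hY.integrable one_le_two).norm)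
  · refine Eventually.of_forall fun θ hθ t ht => hasDerivAt_sqrt_line ?_
    exact hm.trans_le (hδ t ht θ (Ioc_subset_Icc_self (hu ▸ hθ)))

/-- The first derivative of the length of `r + tX` is again differentiable in `t`. -/
lemma hasDerivAt_length_deriv (hr : ContinuousOn r (Icc 0 Real.pi))
    (hp : ContinuousOn p (Icc 0 Real.pi)) (hX : ContinuousOn X (Icc 0 Real.pi))
    (hY : MemLp Y 2 arcMeasure) {δ m : ℝ} (hm : 0 < m)
    (hδ : ∀ t ∈ Metric.ball (0 : ℝ) δ, ∀ θ ∈ Icc 0 Real.pi, m ≤ r θ + t * X θ) {t : ℝ}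
    (ht : t ∈ Metric.ball (0 : ℝ) δ) :
    HasDerivAt (fun t => ∫ θ in (0 : ℝ)..Real.pi,
        ((r θ + t * X θ) * X θ + (p θ + t * Y θ) * Y θ)
        / Real.sqrt ((r θ + t * X θ) ^ 2 + (p θ + t * Y θ) ^ 2))
      (∫ θ in (0 : ℝ)..Real.pi, (r θ * Y θ - p θ * X θ) ^ 2
        / Real.sqrt ((r θ + t * X θ) ^ 2 + (p θ + t * Y θ) ^ 2) ^ 3) t := by
  have hrX := fun t => memLp_arc_line (memLp_arc hr 2) (memLp_arc hX 2) t
  have hpY := fun t => memLp_arc_line (memLp_arc hp 2) hY t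
  have hu : uIoc 0 Real.pi = Ioc 0 Real.pi := uIoc_of_le Real.pi_pos.le
  have hmeas : ∀ t, AEStronglyMeasurable (fun θ =>
      ((r θ + t * X θ) * X θ + (p θ + t * Y θ) * Y θ)
        / Real.sqrt ((r θ + t * X θ) ^ 2 + (p θ + t * Y θ) ^ 2)) arcMeasure := fun t =>
    ((((hrX t).1.aemeasurable.mul (aestronglyMeasurable_arc hX).aemeasurable).add
      ((hpY t).1.aemeasurable.mul hY.1.aemeasurable)).div
      (aestronglyMeasurable_sqrt_sq_add_sq (hrX t).1
        (hpY t).1).aemeasurable).aestronglyMeasurable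
  have hcross : MemLp (fun θ => r θ * Y θ - p θ * X θ) 2 arcMeasure :=
    (memLp_arc_mul hr hY).sub (memLp_arc_mul hp (memLp_arc hX 2))
  refine (intervalIntegral.hasDerivAt_integral_of_dominated_loc_of_deriv_le
    (F' := fun t θ => (r θ * Y θ - p θ * X θ) ^ 2
        / Real.sqrt ((r θ + t * X θ) ^ 2 + (p θ + t * Y θ) ^ 2) ^ 3)
    (bound := fun θ => (r θ * Y θ - p θ * X θ) ^ 2 / m ^ 3)
    (Metric.isOpen_ball.mem_nhds ht) ?_ ?_ ?_ ?_ ?_ ?_).2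
  · rw [hu]
    exact Eventually.of_forall hmeas
  · refine intervalIntegrable_arc_iff.2 (Integrable.mono'
      ((integrable_arc hX).norm.add (hY.integrable one_le_two).norm) (hmeas t) ?_)
    exact Eventually.of_forall fun θ => abs_add_div_sqrt_le _ _ _ _
  · rw [hu]
    exact ((hcross.1.aemeasurable.pow_const 2).div
      ((aestronglyMeasurable_sqrt_sq_add_sq (hrX t).1
        (hpY t).1).aemeasurable.pow_const 3)).aestronglyMeasurable
  · refine Eventually.of_forall fun θ hθ t ht => ?_
    have h1 := hδ t ht θ (Ioc_subset_Icc_self (hu ▸ hθ))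
    have h2 : m ≤ Real.sqrt ((r θ + t * X θ) ^ 2 + (p θ + t * Y θ) ^ 2) :=
      h1.trans (Real.le_sqrt_of_sq_le (by nlinarith [sq_nonneg (p θ + t * Y θ)]))
    rw [Real.norm_of_nonneg (by positivity)]
    gcongr
  · exact intervalIntegrable_arc_iff.2 (hcross.integrable_sq.div_const _)
  · refine Eventually.of_forall fun θ hθ t ht => hasDerivAt_sqrt_line_deriv ?_
    exact hm.trans_le (hδ t ht θ (Ioc_subset_Icc_self (hu ▸ hθ)))

end Length

/-! ### Energy along lines and along the volume-preserving curve. -/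

/-- The length of the profile `r + tξ`, where `p` is the derivative of `r`. -/
def lineLength (r p ξ : ℝ → ℝ) (t : ℝ) : ℝ :=
  ∫ θ in (0 : ℝ)..Real.pi, Real.sqrt ((r θ + t * ξ θ) ^ 2 + (p θ + t * deriv ξ θ) ^ 2)

/-- The derivative of `lineLength` in `t`. -/
def lineLengthDeriv (r p ξ : ℝ → ℝ) (t : ℝ) : ℝ :=
  ∫ θ in (0 : ℝ)..Real.pi, ((r θ + t * ξ θ) * ξ θ + (p θ + t * deriv ξ θ) * deriv ξ θ)
        / Real.sqrt ((r θ + t * ξ θ) ^ 2 + (p θ + t * deriv ξ θ) ^ 2)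

/-- Three times the gravitational energy of the profile `r + tξ`. -/
def lineGravity (r ξ : ℝ → ℝ) (t : ℝ) : ℝ :=
  ∫ θ in (0 : ℝ)..Real.pi, (r θ + t * ξ θ) ^ 3 * Real.sin θ

section Line

variable {r p ξ : ℝ → ℝ}

lemma deriv_scaled_line (hr : HasDerivOn r p) (hξ : IsH1 ξ) (c t : ℝ) :
    ∀ᵐ θ ∂arcMeasure, deriv (fun φ => c * (r φ + t * ξ φ)) θ = c * (p θ + t * deriv ξ θ) := by
  filter_upwards [ae_arc_mem_Ioo, hξ.ae_differentiableAt] with θ hθ hd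
  exact (((hr.hasDerivAt hθ).fun_add (hd.hasDerivAt.const_mul t)).const_mul c).deriv

/-- Gravity is homogeneous of degree three in the profile, length and wetting energy of degree one.
The rescaling factor therefore separates from the linear perturbation. -/
lemma energy_scaled_line (hr : HasDerivOn r p) (hξ : IsH1 ξ) (g σ γ : ℝ) {c : ℝ} (hc : 0 ≤ c)
    (t : ℝ) : energy g σ γ (fun θ => c * (r θ + t * ξ θ))
      = g / 3 * (c ^ 3 * lineGravity r ξ t) + σ * (c * lineLength r p ξ t)
        - γ * (c * ((r 0 + r Real.pi) + t * (ξ 0 + ξ Real.pi))) := by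
  have h1 : ∫ θ in (0 : ℝ)..Real.pi, (c * (r θ + t * ξ θ)) ^ 3 * Real.sin θ
      = c ^ 3 * lineGravity r ξ t := by
    rw [lineGravity, ← intervalIntegral.integral_const_mul]
    congr 1; ext θ; ring
  have h2 : ∫ θ in (0 : ℝ)..Real.pi, Real.sqrt ((c * (r θ + t * ξ θ)) ^ 2
      + deriv (fun φ => c * (r φ + t * ξ φ)) θ ^ 2) = c * lineLength r p ξ t := by
    rw [lineLength, ← intervalIntegral.integral_const_mul]
    refine integral_arc_congr ?_
    filter_upwards [deriv_scaled_line hr hξ c t] with θ hθ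
    rw [hθ, show (c * (r θ + t * ξ θ)) ^ 2 + (c * (p θ + t * deriv ξ θ)) ^ 2
      = c ^ 2 * ((r θ + t * ξ θ) ^ 2 + (p θ + t * deriv ξ θ) ^ 2) by ring,
      Real.sqrt_mul (sq_nonneg c), Real.sqrt_sq hc]
  rw [energy, h1, h2]; ring

lemma energy_line (hr : HasDerivOn r p) (hξ : IsH1 ξ) (g σ γ t : ℝ) :
    energy g σ γ (fun θ => r θ + t * ξ θ)
      = g / 3 * lineGravity r ξ t + σ * lineLength r p ξ t
        - γ * ((r 0 + r Real.pi) + t * (ξ 0 + ξ Real.pi)) := by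
  simpa using energy_scaled_line hr hξ g σ γ zero_le_one t

lemma lineGravity_eq (hr : ContinuousOn r (Icc 0 Real.pi)) (hξ : ContinuousOn ξ (Icc 0 Real.pi))
    (t : ℝ) : lineGravity r ξ t = (∫ θ in (0 : ℝ)..Real.pi, r θ ^ 3 * Real.sin θ)
      + 3 * t * (∫ θ in (0 : ℝ)..Real.pi, r θ ^ 2 * ξ θ * Real.sin θ)
      + 3 * t ^ 2 * (∫ θ in (0 : ℝ)..Real.pi, r θ * ξ θ ^ 2 * Real.sin θ)
      + t ^ 3 * (∫ θ in (0 : ℝ)..Real.pi, ξ θ ^ 3 * Real.sin θ) := by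
  have hs : ContinuousOn Real.sin (Icc 0 Real.pi) := Real.continuous_sin.continuousOn
  simp only [← intervalIntegral.integral_const_mul]
  rw [← intervalIntegral.integral_add, ← intervalIntegral.integral_add,
    ← intervalIntegral.integral_add, lineGravity]
  · congr 1; ext θ; ring
  all_goals refine intervalIntegrable_arc_iff.2 (integrable_arc ?_); fun_prop

lemma hasDerivAt_lineGravity (hr : ContinuousOn r (Icc 0 Real.pi))
    (hξ : ContinuousOn ξ (Icc 0 Real.pi)) (t : ℝ) :
    HasDerivAt (lineGravity r ξ) (3 * (∫ θ in (0 : ℝ)..Real.pi, r θ ^ 2 * ξ θ * Real.sin θ)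
      + 6 * t * (∫ θ in (0 : ℝ)..Real.pi, r θ * ξ θ ^ 2 * Real.sin θ)
      + 3 * t ^ 2 * (∫ θ in (0 : ℝ)..Real.pi, ξ θ ^ 3 * Real.sin θ)) t := by
  rw [funext (lineGravity_eq hr hξ)]
  generalize (∫ θ in (0 : ℝ)..Real.pi, r θ ^ 3 * Real.sin θ) = a
  generalize (∫ θ in (0 : ℝ)..Real.pi, r θ ^ 2 * ξ θ * Real.sin θ) = b
  generalize (∫ θ in (0 : ℝ)..Real.pi, r θ * ξ θ ^ 2 * Real.sin θ) = c
  generalize (∫ θ in (0 : ℝ)..Real.pi, ξ θ ^ 3 * Real.sin θ) = d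
  have h := (((((hasDerivAt_id t).const_mul 3).mul_const b).const_add a).fun_add
    ((((hasDerivAt_id t).pow 2).const_mul 3).mul_const c)).fun_add
    (((hasDerivAt_id t).pow 3).mul_const d)
  convert! h using 1
  simp only [id_eq, Nat.cast_ofNat, Nat.add_one_sub_one, pow_one]
  ring

lemma exists_line_bound (hr : HasDerivOn r p) (hp : ContinuousOn p (Icc 0 Real.pi))
    (hpos : ∀ θ ∈ Icc 0 Real.pi, 0 < r θ) (hξ : IsH1 ξ) :
    ∃ δ > 0, ∀ t ∈ Metric.ball (0 : ℝ) δ,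
      HasDerivAt (lineLength r p ξ) (lineLengthDeriv r p ξ t) t ∧
      HasDerivAt (lineLengthDeriv r p ξ) (∫ θ in (0 : ℝ)..Real.pi,
        (r θ * deriv ξ θ - p θ * ξ θ) ^ 2
        / Real.sqrt ((r θ + t * ξ θ) ^ 2 + (p θ + t * deriv ξ θ) ^ 2) ^ 3) t := by
  obtain ⟨δ, hδ0, m, hm, hδ⟩ := exists_perturbation_bound hr.continuousOn hpos hξ.continuousOn
  exact ⟨δ, hδ0, fun t ht =>
    ⟨hasDerivAt_length hr.continuousOn hp hξ.continuousOn hξ.memLp_arc_deriv hm hδ ht,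
    hasDerivAt_length_deriv hr.continuousOn hp hξ.continuousOn hξ.memLp_arc_deriv hm hδ ht⟩⟩

/-- The first variation of the energy. -/
lemma hasDerivAt_energy_line (hr : HasDerivOn r p) (hp : ContinuousOn p (Icc 0 Real.pi))
    (hpos : ∀ θ ∈ Icc 0 Real.pi, 0 < r θ) (hξ : IsH1 ξ) (g σ γ : ℝ) :
    HasDerivAt (fun t : ℝ => energy g σ γ (fun θ => r θ + t * ξ θ))
      (g * (∫ θ in (0 : ℝ)..Real.pi, r θ ^ 2 * ξ θ * Real.sin θ)
        + σ * (∫ θ in (0 : ℝ)..Real.pi, (r θ * ξ θ + p θ * deriv ξ θ) / arcSpeed r p θ)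
        - γ * (ξ 0 + ξ Real.pi)) 0 := by
  obtain ⟨δ, hδ, h⟩ := exists_line_bound hr hp hpos hξ
  have hL := (h 0 (Metric.mem_ball_self hδ)).1
  rw [funext (energy_line hr hξ g σ γ)]
  have := (((hasDerivAt_lineGravity hr.continuousOn hξ.continuousOn 0).const_mul (g / 3)).fun_add
    (hL.const_mul σ)).fun_sub
    ((((hasDerivAt_id (0 : ℝ)).mul_const (ξ 0 + ξ Real.pi)).const_add
      (r 0 + r Real.pi)).const_mul γ)
  convert! this using 1
  simp [lineLengthDeriv, arcSpeed]; ring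

/-- Orthogonality removes the linear term, so the rescaling factor is even in `t` and does not
affect the velocity at `t = 0`. -/
lemma volumeFunctional_line (hr : ContinuousOn r (Icc 0 Real.pi))
    (hξ : ContinuousOn ξ (Icc 0 Real.pi)) (horth : ∫ θ in (0 : ℝ)..Real.pi, ξ θ * r θ = 0)
    (t : ℝ) : volumeFunctional (fun θ => r θ + t * ξ θ)
      = volumeFunctional r + t ^ 2 * ∫ θ in (0 : ℝ)..Real.pi, ξ θ ^ 2 := by
  have : volumeFunctional (fun θ => r θ + t * ξ θ) = volumeFunctional r
      + (2 * t) * (∫ θ in (0 : ℝ)..Real.pi, ξ θ * r θ)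
      + t ^ 2 * ∫ θ in (0 : ℝ)..Real.pi, ξ θ ^ 2 := by
    simp only [← intervalIntegral.integral_const_mul, volumeFunctional]
    rw [← intervalIntegral.integral_add, ← intervalIntegral.integral_add]
    · congr 1; ext θ; ring
    all_goals refine intervalIntegrable_arc_iff.2 (integrable_arc ?_); fun_prop
  rw [this, horth]; ring

lemma volumeFunctional_pos (hr : ContinuousOn r (Icc 0 Real.pi))
    (hpos : ∀ θ ∈ Icc 0 Real.pi, 0 < r θ) : 0 < volumeFunctional r := by
  refine intervalIntegral.intervalIntegral_pos_of_pos_on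
    (intervalIntegrable_arc_iff.2 (integrable_arc (by fun_prop))) (fun θ hθ => ?_) Real.pi_pos
  exact pow_pos (hpos θ (Ioo_subset_Icc_self hθ)) 2

/-- The derivative is kept in the form `t * (…)`: its own derivative at `0` is then the value of the
second factor at `0`, for which differentiability of that factor is enough. -/
lemma hasDerivAt_sqrt_div_quadratic {V N : ℝ} (hV : 0 < V) (hN : 0 ≤ N) (t : ℝ) :
    HasDerivAt (fun t => Real.sqrt (V / (V + t ^ 2 * N)))
      (t * -(V * N / ((V + t ^ 2 * N) ^ 2 * Real.sqrt (V / (V + t ^ 2 * N))))) t := by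
  have hden : 0 < V + t ^ 2 * N := by positivity
  have h1 : HasDerivAt (fun t => V + t ^ 2 * N) (2 * t * N) t := by
    simpa using (((hasDerivAt_id t).pow 2).mul_const N).const_add V
  have h2 := ((hasDerivAt_const t V).fun_div h1 hden.ne').sqrt (div_pos hV hden).ne'
  convert! h2 using 1
  have := (Real.sqrt_pos.2 (div_pos hV hden)).ne'
  field_simp; ring

lemma hasDerivAt_sqrt_div_quadratic_deriv {V N : ℝ} (hV : 0 < V) (hN : 0 ≤ N) :
    HasDerivAt (fun t => t * -(V * N / ((V + t ^ 2 * N) ^ 2 * Real.sqrt (V / (V + t ^ 2 * N)))))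
      (-(N / V)) 0 := by
  have hd : DifferentiableAt ℝ
      (fun t => -(V * N / ((V + t ^ 2 * N) ^ 2 * Real.sqrt (V / (V + t ^ 2 * N))))) 0 := by
    have h0 : (V + (0 : ℝ) ^ 2 * N) ^ 2 * Real.sqrt (V / (V + (0 : ℝ) ^ 2 * N)) ≠ 0 := by
      simp [hV.ne', div_self]
    exact ((differentiableAt_const _).fun_div ((by fun_prop : DifferentiableAt ℝ
      (fun t : ℝ => (V + t ^ 2 * N) ^ 2) 0).fun_mul
      (hasDerivAt_sqrt_div_quadratic hV hN 0).differentiableAt) h0).fun_neg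
  convert! (hasDerivAt_id (0 : ℝ)).fun_mul hd.hasDerivAt using 1
  simp [hV.ne', div_self]
  field_simp

/-- The energy along the volume-preserving curve is differentiable near `0`, and twice
differentiable at `0`. -/
lemma hasDerivAt_deriv_energyAlong (hr : HasDerivOn r p) (hp : ContinuousOn p (Icc 0 Real.pi))
    (hpos : ∀ θ ∈ Icc 0 Real.pi, 0 < r θ) (hξ : IsH1 ξ)
    (horth : ∫ θ in (0 : ℝ)..Real.pi, ξ θ * r θ = 0) (g σ γ : ℝ) :
    (∀ᶠ t in 𝓝 (0 : ℝ), DifferentiableAt ℝ (energyAlong g σ γ r ξ) t) ∧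
    HasDerivAt (deriv (energyAlong g σ γ r ξ))
      (2 * g * (∫ θ in (0 : ℝ)..Real.pi, r θ * ξ θ ^ 2 * Real.sin θ)
        + σ * (∫ θ in (0 : ℝ)..Real.pi,
          (r θ * deriv ξ θ - p θ * ξ θ) ^ 2 / arcSpeed r p θ ^ 3)
        - (g * (∫ θ in (0 : ℝ)..Real.pi, r θ ^ 3 * Real.sin θ)
            + σ * (∫ θ in (0 : ℝ)..Real.pi, arcSpeed r p θ) - γ * (r 0 + r Real.pi))
          * ((∫ θ in (0 : ℝ)..Real.pi, ξ θ ^ 2) / volumeFunctional r)) 0 := by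
  obtain ⟨δ, hδ, hlen⟩ := exists_line_bound hr hp hpos hξ
  have hV := volumeFunctional_pos hr.continuousOn hpos
  have hN : 0 ≤ ∫ θ in (0 : ℝ)..Real.pi, ξ θ ^ 2 :=
    intervalIntegral.integral_nonneg Real.pi_pos.le fun _ _ => sq_nonneg _
  set V := volumeFunctional r
  set N := ∫ θ in (0 : ℝ)..Real.pi, ξ θ ^ 2
  set l : ℝ → ℝ := fun t => Real.sqrt (V / (V + t ^ 2 * N)) with hl
  set l' : ℝ → ℝ := fun t => t * -(V * N / ((V + t ^ 2 * N) ^ 2 * l t)) with hl'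
  have hG : energyAlong g σ γ r ξ = fun t => g / 3 * (l t ^ 3 * lineGravity r ξ t)
      + σ * (l t * lineLength r p ξ t)
        - γ * (l t * ((r 0 + r Real.pi) + t * (ξ 0 + ξ Real.pi))) := by
    ext t
    rw [energyAlong]
    unfold volumePreservingCurve
    rw [volumeFunctional_line hr.continuousOn hξ.continuousOn horth,
      energy_scaled_line hr hξ g σ γ (Real.sqrt_nonneg _)]
  have hdl : ∀ t, HasDerivAt l (l' t) t := fun t => hasDerivAt_sqrt_div_quadratic hV hN t
  have hdl' : HasDerivAt l' (-(N / V)) 0 := hasDerivAt_sqrt_div_quadratic_deriv hV hN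
  have hl0 : l 0 = 1 := by simp [hl, hV.ne']
  have hl'0 : l' 0 = 0 := by simp [hl']
  have hA := hasDerivAt_lineGravity hr.continuousOn hξ.continuousOn
  set A' : ℝ → ℝ := fun t => 3 * (∫ θ in (0 : ℝ)..Real.pi, r θ ^ 2 * ξ θ * Real.sin θ)
      + 6 * t * (∫ θ in (0 : ℝ)..Real.pi, r θ * ξ θ ^ 2 * Real.sin θ)
      + 3 * t ^ 2 * (∫ θ in (0 : ℝ)..Real.pi, ξ θ ^ 3 * Real.sin θ) with hA'
  have hC : ∀ t, HasDerivAt (fun t : ℝ => (r 0 + r Real.pi) + t * (ξ 0 + ξ Real.pi))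
      (ξ 0 + ξ Real.pi) t := fun t => by
    simpa using ((hasDerivAt_id t).mul_const (ξ 0 + ξ Real.pi)).const_add (r 0 + r Real.pi)
  have hdA' : HasDerivAt A' (6 * (∫ θ in (0 : ℝ)..Real.pi, r θ * ξ θ ^ 2 * Real.sin θ)) 0 := by
    have := ((((hasDerivAt_id (0 : ℝ)).const_mul 6).mul_const
      (∫ θ in (0 : ℝ)..Real.pi, r θ * ξ θ ^ 2 * Real.sin θ)).const_add
      (3 * (∫ θ in (0 : ℝ)..Real.pi, r θ ^ 2 * ξ θ * Real.sin θ))).fun_add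
      ((((hasDerivAt_id (0 : ℝ)).pow 2).const_mul 3).mul_const
      (∫ θ in (0 : ℝ)..Real.pi, ξ θ ^ 3 * Real.sin θ))
    convert! this using 1
    simp
  have hdG : ∀ t ∈ Metric.ball (0 : ℝ) δ, HasDerivAt (energyAlong g σ γ r ξ)
      (g / 3 * ((3 * l t ^ 2 * l' t) * lineGravity r ξ t + l t ^ 3 * A' t)
        + σ * (l' t * lineLength r p ξ t + l t * lineLengthDeriv r p ξ t)
        - γ * (l' t * ((r 0 + r Real.pi) + t * (ξ 0 + ξ Real.pi))
          + l t * (ξ 0 + ξ Real.pi))) t := fun t ht => by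
    rw [hG]
    have h3 : HasDerivAt (fun t => l t ^ 3) (3 * l t ^ 2 * l' t) t := by
      simpa using (hdl t).fun_pow 3
    exact (((h3.fun_mul (hA t)).const_mul (g / 3)).fun_add
      (((hdl t).fun_mul (hlen t ht).1).const_mul σ)).fun_sub
      (((hdl t).fun_mul (hC t)).const_mul γ)
  have hball := Metric.ball_mem_nhds (0 : ℝ) hδ
  refine ⟨eventually_of_mem hball fun t ht => (hdG t ht).differentiableAt, ?_⟩
  refine HasDerivAt.congr_of_eventuallyEq ?_
    (eventually_of_mem hball fun t ht => (hdG t ht).deriv)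
  -- At `0` one has `l = 1`, `l' = 0`, `l'' = -N / V`. So the rescaling contributes only `l''` times
  -- the derivative of the energy under dilation, which later becomes `-μ ∫ ξ²`.
  have h2 : HasDerivAt (fun t => 3 * l t ^ 2 * l' t) (3 * -(N / V)) 0 := by
    have := (((hdl 0).fun_pow 2).const_mul 3).fun_mul hdl'
    convert! this using 1
    simp [hl0, hl'0]
  have h3 : HasDerivAt (fun t => l t ^ 3) 0 0 := by
    have := (hdl 0).fun_pow 3
    rw [hl'0] at this; simpa using this
  obtain ⟨hB, hB'⟩ := hlen 0 (Metric.mem_ball_self hδ)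
  have := ((((h2.fun_mul (hA 0)).fun_add (h3.fun_mul hdA')).const_mul (g / 3)).fun_add
    (((hdl'.fun_mul hB).fun_add ((hdl 0).fun_mul hB')).const_mul σ)).fun_sub
    (((hdl'.fun_mul (hC 0)).fun_add ((hdl 0).mul_const (ξ 0 + ξ Real.pi))).const_mul γ)
  convert! this using 1
  simp only [hl0, hl'0, lineGravity, lineLength, lineLengthDeriv, arcSpeed, zero_mul, add_zero]
  ring

end Line

/-! ### Smooth profiles, curvature and the integrated first variation. -/

/-- A positive polar profile `r` on `[0,π]` together with its first three derivatives. -/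
structure SmoothProfile (r p q s : ℝ → ℝ) : Prop where
  pos : ∀ θ ∈ Icc 0 Real.pi, 0 < r θ
  deriv₁ : HasDerivOn r p
  deriv₂ : HasDerivOn p q
  deriv₃ : HasDerivOn q s
  cont : ContinuousOn s (Icc 0 Real.pi)

lemma hasDerivOn_derivWithin {f : ℝ → ℝ} {n : WithTop ℕ∞}
    (hf : ContDiffOn ℝ (n + 1) f (Icc 0 Real.pi)) :
    HasDerivOn f (derivWithin f (Icc 0 Real.pi)) ∧
      ContDiffOn ℝ n (derivWithin f (Icc 0 Real.pi)) (Icc 0 Real.pi) := by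
  have hu := uniqueDiffOn_Icc Real.pi_pos
  exact ⟨fun θ hθ => ((hf.differentiableOn (by simp)) θ hθ).hasDerivWithinAt,
    hf.derivWithin hu le_rfl⟩

lemma IsEquilibrium.exists_smoothProfile {g σ γ : ℝ} {r : ℝ → ℝ} (h : IsEquilibrium g σ γ r) :
    ∃ p q s, SmoothProfile r p q s := by
  have h3 : ContDiffOn ℝ (0 + 1 + 1 + 1) r (Icc 0 Real.pi) :=
    h.smooth.of_le (by
      norm_num
      exact WithTop.coe_le_coe.2 (le_top : (3 : ℕ∞) ≤ ⊤))
  obtain ⟨d1, h2⟩ := hasDerivOn_derivWithin h3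
  obtain ⟨d2, h1⟩ := hasDerivOn_derivWithin h2
  obtain ⟨d3, h0⟩ := hasDerivOn_derivWithin h1
  exact ⟨_, _, _, h.pos, d1, d2, d3, h0.continuousOn⟩

/-- The curvature of the polar curve with radius `r`, where `p = r'` and `q = r''`. -/
def polarCurvature (r p q : ℝ → ℝ) (θ : ℝ) : ℝ :=
  (r θ ^ 2 + 2 * p θ ^ 2 - q θ * r θ) / arcSpeed r p θ ^ 3

lemma arcSpeed_sq (r p : ℝ → ℝ) (θ : ℝ) : arcSpeed r p θ ^ 2 = r θ ^ 2 + p θ ^ 2 :=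
  Real.sq_sqrt (by positivity)

namespace SmoothProfile

variable {r p q s : ℝ → ℝ} (h : SmoothProfile r p q s)
include h

lemma cont₀ : ContinuousOn r (Icc 0 Real.pi) := h.deriv₁.continuousOn
lemma cont₁ : ContinuousOn p (Icc 0 Real.pi) := h.deriv₂.continuousOn
lemma cont₂ : ContinuousOn q (Icc 0 Real.pi) := h.deriv₃.continuousOn

lemma speed_pos {θ : ℝ} (hθ : θ ∈ Icc 0 Real.pi) : 0 < arcSpeed r p θ :=
  Real.sqrt_pos.2 (add_pos_of_pos_of_nonneg (pow_pos (h.pos θ hθ) 2) (sq_nonneg _))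

lemma cont_speed : ContinuousOn (arcSpeed r p) (Icc 0 Real.pi) :=
  ((h.cont₀.pow 2).add (h.cont₁.pow 2)).sqrt

lemma deriv_speed : HasDerivOn (arcSpeed r p)
    (fun θ => (r θ * p θ + p θ * q θ) / arcSpeed r p θ) := fun θ hθ => by
  have h0 : r θ ^ 2 + p θ ^ 2 ≠ 0 := by
    rw [← arcSpeed_sq]; exact (pow_pos (h.speed_pos hθ) 2).ne'
  convert! (((h.deriv₁ θ hθ).fun_pow 2).fun_add ((h.deriv₂ θ hθ).fun_pow 2)).sqrt h0 using 1
  have := (h.speed_pos hθ).ne'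
  change _ = _ / (2 * arcSpeed r p θ)
  field_simp
  simp; ring

lemma deriv_div_speed : HasDerivOn (fun θ => p θ / arcSpeed r p θ)
    (fun θ => (q θ * r θ ^ 2 - r θ * p θ ^ 2) / arcSpeed r p θ ^ 3) := fun θ hθ => by
  have h0 := (h.speed_pos hθ).ne'
  convert! (h.deriv₂ θ hθ).fun_div (h.deriv_speed θ hθ) h0 using 1
  have h2 := arcSpeed_sq r p θ
  field_simp
  rw [h2]; ring

/-- This is what the third derivative of the profile is for: the curvature becomes an `H¹` function
and can serve as part of a test function in the Euler-Lagrange argument. -/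
lemma exists_deriv_curvature : ∃ k, HasDerivOn (polarCurvature r p q) k ∧
    ContinuousOn k (Icc 0 Real.pi) := by
  refine ⟨fun θ => ((2 * r θ * p θ + 2 * (2 * p θ * q θ) - (s θ * r θ + q θ * p θ))
    * arcSpeed r p θ ^ 3 - (r θ ^ 2 + 2 * p θ ^ 2 - q θ * r θ)
    * (3 * arcSpeed r p θ ^ 2 * ((r θ * p θ + p θ * q θ) / arcSpeed r p θ)))
    / (arcSpeed r p θ ^ 3) ^ 2, fun θ hθ => ?_, ?_⟩
  · have h0 := (pow_pos (h.speed_pos hθ) 3).ne'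
    convert! ((((h.deriv₁ θ hθ).fun_pow 2).fun_add (((h.deriv₂ θ hθ).fun_pow 2).const_mul 2)).fun_sub
      ((h.deriv₃ θ hθ).fun_mul (h.deriv₁ θ hθ))).fun_div ((h.deriv_speed θ hθ).fun_pow 3) h0 using 1
    simp
  · have hW := h.cont_speed
    have h0 := h.cont₀
    have h1 := h.cont₁
    have h2 := h.cont₂
    have h3 := h.cont
    refine ContinuousOn.div (ContinuousOn.sub (by fun_prop) (ContinuousOn.mul (by fun_prop)
      (ContinuousOn.mul (by fun_prop) (ContinuousOn.div (by fun_prop) hW ?_)))) (by fun_prop) ?_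
    · exact fun θ hθ => (h.speed_pos hθ).ne'
    · exact fun θ hθ => (pow_pos (pow_pos (h.speed_pos hθ) 3) 2).ne'

/-- The first variation after integration by parts. -/
lemma first_variation_eq {ξ : ℝ → ℝ} (hξ : IsH1 ξ) (g σ γ : ℝ) :
    g * (∫ θ in (0 : ℝ)..Real.pi, r θ ^ 2 * ξ θ * Real.sin θ)
        + σ * (∫ θ in (0 : ℝ)..Real.pi, (r θ * ξ θ + p θ * deriv ξ θ) / arcSpeed r p θ)
        - γ * (ξ 0 + ξ Real.pi)
      = (∫ θ in (0 : ℝ)..Real.pi,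
          (r θ * (g * r θ * Real.sin θ + σ * polarCurvature r p q θ)) * ξ θ)
        + (σ * (p Real.pi / arcSpeed r p Real.pi) - γ) * ξ Real.pi
        + (-σ * (p 0 / arcSpeed r p 0) - γ) * ξ 0 := by
  have h0 := h.cont₀
  have h1 := h.cont₁
  have h2 := h.cont₂
  have hX := hξ.continuousOn
  have hW := h.cont_speed
  have hWn : ∀ θ ∈ Icc 0 Real.pi, arcSpeed r p θ ≠ 0 := fun θ hθ => (h.speed_pos hθ).ne'
  have hWn3 : ∀ θ ∈ Icc 0 Real.pi, arcSpeed r p θ ^ 3 ≠ 0 := fun θ hθ =>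
    (pow_pos (h.speed_pos hθ) 3).ne'
  have hk : ContinuousOn (polarCurvature r p q) (Icc 0 Real.pi) :=
    ContinuousOn.div (by fun_prop) (by fun_prop) hWn3
  have hpW : ContinuousOn (fun θ => p θ / arcSpeed r p θ) (Icc 0 Real.pi) := h1.div hW hWn
  have hpW' : ContinuousOn (fun θ => (q θ * r θ ^ 2 - r θ * p θ ^ 2) / arcSpeed r p θ ^ 3)
      (Icc 0 Real.pi) := ContinuousOn.div (by fun_prop) (by fun_prop) hWn3
  have hparts := hξ.integral_by_parts h.deriv_div_speed hpW'
  have hs : ContinuousOn Real.sin (Icc 0 Real.pi) := Real.continuous_sin.continuousOn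
  have hint : IntervalIntegrable (fun θ => (q θ * r θ ^ 2 - r θ * p θ ^ 2) / arcSpeed r p θ ^ 3
      * ξ θ + p θ / arcSpeed r p θ * deriv ξ θ) volume 0 Real.pi :=
    intervalIntegrable_arc_iff.2 ((integrable_arc (hpW'.mul hX)).add
      ((memLp_arc_mul hpW hξ.memLp_arc_deriv).integrable one_le_two))
  -- Pointwise this is `r / W = r κ + (p / W)'`; the remaining integrand is the derivative of `(p /
  -- W) ξ`.
  have e1 : ∫ θ in (0 : ℝ)..Real.pi, (r θ * ξ θ + p θ * deriv ξ θ) / arcSpeed r p θ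
      = (∫ θ in (0 : ℝ)..Real.pi, r θ * polarCurvature r p q θ * ξ θ)
        + ∫ θ in (0 : ℝ)..Real.pi, ((q θ * r θ ^ 2 - r θ * p θ ^ 2) / arcSpeed r p θ ^ 3
      * ξ θ + p θ / arcSpeed r p θ * deriv ξ θ) := by
    rw [← intervalIntegral.integral_add (intervalIntegrable_arc_iff.2
      (integrable_arc ((h0.fun_mul hk).fun_mul hX))) hint]
    refine integral_arc_congr ?_
    filter_upwards [ae_arc_mem_Ioo] with θ hθ
    have hn := hWn θ (Ioo_subset_Icc_self hθ)
    have h2 := arcSpeed_sq r p θ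
    rw [polarCurvature]
    field_simp
    rw [h2]; ring
  rw [e1, hparts]
  have e2 : (∫ θ in (0 : ℝ)..Real.pi,
          (r θ * (g * r θ * Real.sin θ + σ * polarCurvature r p q θ)) * ξ θ)
      = g * (∫ θ in (0 : ℝ)..Real.pi, r θ ^ 2 * ξ θ * Real.sin θ)
        + σ * (∫ θ in (0 : ℝ)..Real.pi, r θ * polarCurvature r p q θ * ξ θ) := by
    rw [← intervalIntegral.integral_const_mul, ← intervalIntegral.integral_const_mul,
      ← intervalIntegral.integral_add]
    · congr 1; ext θ; ring
    all_goals refine intervalIntegrable_arc_iff.2 (integrable_arc ?_); fun_prop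
  rw [e2]; ring

end SmoothProfile

/-! ### Capillary equation, Young's law and the multiplier. -/

/-- The Euler-Lagrange equation of a profile, with Lagrange multiplier (pressure) `μ`, together
with Young's law at the contact point `θ = 0`. -/
structure IsCapillaryProfile (g σ γ μ : ℝ) (r p q s : ℝ → ℝ) : Prop
    extends SmoothProfile r p q s where
  laplace : ∀ θ ∈ Icc 0 Real.pi,
    σ * polarCurvature r p q θ = μ - g * (r θ * Real.sin θ)
  young : σ * (p 0 / arcSpeed r p 0) = -γ
  multiplier : μ * volumeFunctional r = g * (∫ θ in (0 : ℝ)..Real.pi, r θ ^ 3 * Real.sin θ)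
    + σ * (∫ θ in (0 : ℝ)..Real.pi, arcSpeed r p θ) - γ * (r 0 + r Real.pi)

lemma IsEquilibrium.exists_isCapillaryProfile {g σ γ : ℝ} {r p q s : ℝ → ℝ}
    (he : IsEquilibrium g σ γ r) (h : SmoothProfile r p q s) :
    ∃ μ, IsCapillaryProfile g σ γ μ r p q s := by
  obtain ⟨k', hk', hk'c⟩ := h.exists_deriv_curvature
  have hrc := h.cont₀
  have hrH : IsH1 r := h.deriv₁.isH1 h.cont₁
  have hV := volumeFunctional_pos hrc h.pos
  have hs : ContinuousOn Real.sin (Icc 0 Real.pi) := Real.continuous_sin.continuousOn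
  set K : ℝ → ℝ := fun θ => g * r θ * Real.sin θ + σ * polarCurvature r p q θ with hK
  have hKd : HasDerivOn K
      (fun θ => g * p θ * Real.sin θ + g * r θ * Real.cos θ + σ * k' θ) := fun θ hθ =>
    (((h.deriv₁ θ hθ).const_mul g).fun_mul (Real.hasDerivAt_sin θ).hasDerivWithinAt).fun_add
      ((hk' θ hθ).const_mul σ)
  have hKc := hKd.continuousOn
  have hKH : IsH1 K := hKd.isH1 (by
    have := h.cont₁
    fun_prop)
  set b₁ := σ * (p Real.pi / arcSpeed r p Real.pi) - γ
  set b₀ := -σ * (p 0 / arcSpeed r p 0) - γ with hb₀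
  set L : (ℝ → ℝ) → ℝ := fun ξ => (∫ θ in (0 : ℝ)..Real.pi, (r θ * K θ) * ξ θ)
    + b₁ * ξ Real.pi + b₀ * ξ 0 with hL
  have hfirst : ∀ ξ, IsH1 ξ → ∫ θ in (0 : ℝ)..Real.pi, ξ θ * r θ = 0 → L ξ = 0 := fun ξ hξ ho => by
    have h1 := hasDerivAt_energy_line h.deriv₁ h.cont₁ h.pos hξ g σ γ
    have h2 := h1.unique (he.stationary ξ ⟨hξ, ho⟩)
    rwa [h.first_variation_eq hξ] at h2
  have hLsub : ∀ ξ, IsH1 ξ → ∀ c, L (fun θ => ξ θ + c * r θ) = L ξ + c * L r := fun ξ hξ c => by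
    have hX := hξ.continuousOn
    have : ∫ θ in (0 : ℝ)..Real.pi, (r θ * K θ) * (ξ θ + c * r θ)
        = (∫ θ in (0 : ℝ)..Real.pi, (r θ * K θ) * ξ θ)
          + c * ∫ θ in (0 : ℝ)..Real.pi, (r θ * K θ) * r θ := by
      rw [← intervalIntegral.integral_const_mul, ← intervalIntegral.integral_add]
      · congr 1; ext θ; ring
      all_goals refine intervalIntegrable_arc_iff.2 (integrable_arc ?_); fun_prop
    simp only [hL, this]; ring
  set μ := L r / volumeFunctional r with hμ
  have hμV : μ * volumeFunctional r = L r := div_mul_cancel₀ _ hV.ne'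
  -- Any `ξ` becomes admissible after adding a multiple of `r`, because `∫ r² > 0`.
  have hall : ∀ ξ, IsH1 ξ → L ξ = μ * ∫ θ in (0 : ℝ)..Real.pi, ξ θ * r θ := fun ξ hξ => by
    have hX := hξ.continuousOn
    set c := -((∫ θ in (0 : ℝ)..Real.pi, ξ θ * r θ) / volumeFunctional r) with hc
    have h1 := hfirst (fun θ => ξ θ + c * r θ) (hξ.add (hrH.const_mul c)) (by
      have : ∫ θ in (0 : ℝ)..Real.pi, (ξ θ + c * r θ) * r θ
        = (∫ θ in (0 : ℝ)..Real.pi, ξ θ * r θ) + c * volumeFunctional r := by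
        rw [volumeFunctional, ← intervalIntegral.integral_const_mul,
          ← intervalIntegral.integral_add]
        · congr 1; ext θ; ring
        all_goals refine intervalIntegrable_arc_iff.2 (integrable_arc ?_); fun_prop
      rw [this, hc]; field_simp; ring)
    rw [hLsub ξ hξ] at h1
    rw [hμ]
    have : L ξ = -(c * L r) := by linarith
    rw [this, hc]; ring
  have hweak : ∀ ξ, IsH1 ξ → (∫ θ in (0 : ℝ)..Real.pi, (r θ * (K θ - μ)) * ξ θ)
      + b₁ * ξ Real.pi + b₀ * ξ 0 = 0 := fun ξ hξ => by
    have hX := hξ.continuousOn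
    have h1 := hall ξ hξ
    have : ∫ θ in (0 : ℝ)..Real.pi, (r θ * (K θ - μ)) * ξ θ
        = (∫ θ in (0 : ℝ)..Real.pi, (r θ * K θ) * ξ θ)
          - μ * ∫ θ in (0 : ℝ)..Real.pi, ξ θ * r θ := by
      rw [← intervalIntegral.integral_const_mul, ← intervalIntegral.integral_sub]
      · congr 1; ext θ; ring
      all_goals refine intervalIntegrable_arc_iff.2 (integrable_arc ?_); fun_prop
    rw [this]
    simp only [hL] at h1
    linarith
  have hlin : ∀ a b : ℝ, HasDerivOn (fun θ => a + b * θ) (fun _ => b) := fun a b θ _ => by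
    simpa using ((hasDerivWithinAt_id θ _).const_mul b).const_add a
  have hlinH : ∀ a b : ℝ, IsH1 (fun θ => a + b * θ) := fun a b =>
    (hlin a b).isH1 continuousOn_const
  have hKμH : IsH1 (fun θ => K θ + -μ) := hKH.add (by simpa using hlinH (-μ) 0)
  have hKIoo : ∀ θ ∈ Ioo 0 Real.pi, K θ = μ := fun θ hθ => by
    by_contra hne
    -- The factor `θ (π - θ)` kills both boundary terms and is positive inside, so the weak equation
    -- says that the integral of a nonnegative function, positive at `θ`, is zero.
    have h1 := hweak (fun θ => (K θ + -μ) * ((0 + 1 * θ) * (Real.pi + -1 * θ)))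
      (hKμH.mul ((hlinH 0 1).mul (hlinH Real.pi (-1))))
    have h2 : 0 < ∫ θ in (0 : ℝ)..Real.pi, (r θ * (K θ - μ))
        * ((K θ + -μ) * ((0 + 1 * θ) * (Real.pi + -1 * θ))) := by
      refine intervalIntegral.integral_pos Real.pi_pos (by fun_prop) (fun φ hφ => ?_)
        ⟨θ, Ioo_subset_Icc_self hθ, ?_⟩
      · have hr := h.pos φ (Ioc_subset_Icc_self hφ)
        rw [show (r φ * (K φ - μ)) * ((K φ + -μ) * ((0 + 1 * φ) * (Real.pi + -1 * φ)))
          = r φ * (K φ - μ) ^ 2 * (φ * (Real.pi - φ)) by ring]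
        exact mul_nonneg (mul_nonneg hr.le (sq_nonneg _))
          (mul_nonneg hφ.1.le (sub_nonneg.2 hφ.2))
      · have hr := h.pos θ (Ioo_subset_Icc_self hθ)
        rw [show (r θ * (K θ - μ)) * ((K θ + -μ) * ((0 + 1 * θ) * (Real.pi + -1 * θ)))
          = r θ * (K θ - μ) ^ 2 * (θ * (Real.pi - θ)) by ring]
        have := sq_pos_of_ne_zero (sub_ne_zero.2 hne)
        exact mul_pos (mul_pos hr this) (mul_pos hθ.1 (sub_pos.2 hθ.2))
    simp only [zero_add, one_mul, neg_mul, add_neg_cancel, mul_zero, zero_mul, add_zero] at h1 h2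
    exact h2.ne' h1
  have hKIcc : ∀ θ ∈ Icc 0 Real.pi, K θ = μ := by
    have : EqOn K (fun _ => μ) (Icc 0 Real.pi) :=
      EqOn.of_subset_closure hKIoo hKc continuousOn_const Ioo_subset_Icc_self
        (by rw [closure_Ioo Real.pi_pos.ne])
    exact this
  have hb0 : b₀ = 0 := by
    -- The bulk term is now zero, and the test function `π - θ` sees only the end point `0`.
    have h1 := hweak _ (hlinH Real.pi (-1))
    rw [integral_arc_congr (g := fun _ => 0)] at h1
    · simpa [Real.pi_ne_zero] using h1
    · filter_upwards [ae_arc_mem_Ioo] with θ hθ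
      simp [hKIoo θ hθ]
  refine ⟨μ, h, fun θ hθ => ?_, ?_, ?_⟩
  · have := hKIcc θ hθ
    simp only [hK] at this
    linarith
  · linarith
  · rw [hμV]
    -- Testing with `ξ = r` gives the dilation derivative of the energy, in which the length
    -- integrand `(r² + p²) / W` is `W` again.
    have h1 := h.first_variation_eq hrH g σ γ
    change _ = L r at h1
    rw [← h1]
    have e1 : ∫ θ in (0 : ℝ)..Real.pi, r θ ^ 2 * r θ * Real.sin θ
        = ∫ θ in (0 : ℝ)..Real.pi, r θ ^ 3 * Real.sin θ := rfl
    have e2 : ∫ θ in (0 : ℝ)..Real.pi, (r θ * r θ + p θ * deriv r θ) / arcSpeed r p θ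
        = ∫ θ in (0 : ℝ)..Real.pi, arcSpeed r p θ := by
      refine integral_arc_congr ?_
      filter_upwards [ae_arc_mem_Ioo] with θ hθ
      rw [h.deriv₁.deriv_eq hθ, div_eq_iff (h.speed_pos (Ioo_subset_Icc_self hθ)).ne', ← sq,
        ← sq, ← sq, arcSpeed_sq]
    rw [e1, e2]

/-! ### Cartesian coordinates of the free surface. -/

/-- The horizontal coordinate of the polar curve `r`. -/
def curveX (r : ℝ → ℝ) (θ : ℝ) : ℝ := r θ * Real.cos θ

/-- The height of the polar curve `r`. -/
def curveY (r : ℝ → ℝ) (θ : ℝ) : ℝ := r θ * Real.sin θ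

/-- The derivative of `curveX`, where `p` is the derivative of `r`. -/
def curveXDeriv (r p : ℝ → ℝ) (θ : ℝ) : ℝ := p θ * Real.cos θ - r θ * Real.sin θ

/-- The derivative of `curveY`, where `p` is the derivative of `r`. -/
def curveYDeriv (r p : ℝ → ℝ) (θ : ℝ) : ℝ := p θ * Real.sin θ + r θ * Real.cos θ

lemma curveXDeriv_sq_add_sq (r p : ℝ → ℝ) (θ : ℝ) :
    curveXDeriv r p θ ^ 2 + curveYDeriv r p θ ^ 2 = arcSpeed r p θ ^ 2 := by
  rw [arcSpeed_sq, curveXDeriv, curveYDeriv]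
  linear_combination (p θ ^ 2 + r θ ^ 2) * Real.sin_sq_add_cos_sq θ

lemma curveX_mul_sub (r p : ℝ → ℝ) (θ : ℝ) :
    curveX r θ * curveYDeriv r p θ - curveY r θ * curveXDeriv r p θ = r θ ^ 2 := by
  rw [curveX, curveY, curveXDeriv, curveYDeriv]
  linear_combination r θ ^ 2 * Real.sin_sq_add_cos_sq θ

@[simp] lemma curveY_zero (r : ℝ → ℝ) : curveY r 0 = 0 := by simp [curveY]

@[simp] lemma curveY_pi (r : ℝ → ℝ) : curveY r Real.pi = 0 := by simp [curveY]

namespace SmoothProfile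

variable {r p q s : ℝ → ℝ} (h : SmoothProfile r p q s)
include h

lemma deriv_curveX : HasDerivOn (curveX r) (curveXDeriv r p) := fun θ hθ => by
  convert! (h.deriv₁ θ hθ).fun_mul (Real.hasDerivAt_cos θ).hasDerivWithinAt using 1
  rw [curveXDeriv]; ring

lemma deriv_curveY : HasDerivOn (curveY r) (curveYDeriv r p) := fun θ hθ =>
  (h.deriv₁ θ hθ).fun_mul (Real.hasDerivAt_sin θ).hasDerivWithinAt

lemma deriv_curveXDeriv : HasDerivOn (curveXDeriv r p)
    (fun θ => q θ * Real.cos θ - 2 * p θ * Real.sin θ - r θ * Real.cos θ) := fun θ hθ => by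
  convert! ((h.deriv₂ θ hθ).fun_mul (Real.hasDerivAt_cos θ).hasDerivWithinAt).fun_sub
    (h.deriv_curveY θ hθ) using 1
  rw [curveYDeriv]; ring

lemma deriv_curveYDeriv : HasDerivOn (curveYDeriv r p)
    (fun θ => q θ * Real.sin θ + 2 * p θ * Real.cos θ - r θ * Real.sin θ) := fun θ hθ => by
  convert! ((h.deriv₂ θ hθ).fun_mul (Real.hasDerivAt_sin θ).hasDerivWithinAt).fun_add
    (h.deriv_curveX θ hθ) using 1
  rw [curveXDeriv]; ring

lemma cont_curveX : ContinuousOn (curveX r) (Icc 0 Real.pi) := h.deriv_curveX.continuousOn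
lemma cont_curveY : ContinuousOn (curveY r) (Icc 0 Real.pi) := h.deriv_curveY.continuousOn
lemma cont_curveXDeriv : ContinuousOn (curveXDeriv r p) (Icc 0 Real.pi) :=
  h.deriv_curveXDeriv.continuousOn
lemma cont_curveYDeriv : ContinuousOn (curveYDeriv r p) (Icc 0 Real.pi) :=
  h.deriv_curveYDeriv.continuousOn

lemma curveY_pos {θ : ℝ} (hθ : θ ∈ Ioo 0 Real.pi) : 0 < curveY r θ :=
  mul_pos (h.pos θ (Ioo_subset_Icc_self hθ)) (Real.sin_pos_of_mem_Ioo hθ)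

lemma curveY_nonneg {θ : ℝ} (hθ : θ ∈ Icc 0 Real.pi) : 0 ≤ curveY r θ :=
  mul_nonneg (h.pos θ hθ).le (Real.sin_nonneg_of_mem_Icc hθ)

/-- The second component of Frenet's equation for the unit tangent. -/
lemma deriv_unitTangentX : HasDerivOn (fun θ => curveXDeriv r p θ / arcSpeed r p θ)
    (fun θ => -(polarCurvature r p q θ * curveYDeriv r p θ)) := fun θ hθ => by
  have h0 := (h.speed_pos hθ).ne'
  refine ((h.deriv_curveXDeriv θ hθ).fun_div (h.deriv_speed θ hθ) h0).congr_deriv ?_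
  have h2 := arcSpeed_sq r p θ
  simp only [polarCurvature, curveXDeriv, curveYDeriv]
  field_simp
  rw [h2]; ring

/-- Where the curve is horizontal it runs to the left. -/
lemma curveXDeriv_eq_neg_speed {θ : ℝ} (hθ : θ ∈ Icc 0 Real.pi)
    (hy : curveYDeriv r p θ = 0) : curveXDeriv r p θ = -arcSpeed r p θ := by
  have h1 := curveXDeriv_sq_add_sq r p θ
  have h2 := curveX_mul_sub r p θ
  rw [hy] at h1 h2
  have h3 := pow_pos (h.pos θ hθ) 2
  -- With `y' = 0` the identity `x y' - y x' = r²` becomes `y x' = -r² < 0`.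
  have h4 : curveXDeriv r p θ < 0 := by
    by_contra hc
    nlinarith [mul_nonneg (h.curveY_nonneg hθ) (not_lt.1 hc)]
  have h5 := h.speed_pos hθ
  rcases sq_eq_sq_iff_eq_or_eq_neg.1 (show curveXDeriv r p θ ^ 2 = arcSpeed r p θ ^ 2 by linarith)
    with h6 | h6 <;> linarith

end SmoothProfile

/-! ### The second variation as a Jacobi form in `u = ξ / r`. -/

/-- The quadratic form `∫ a u'² + b u²` that expresses the second variation through `u = ξ / r`. -/
def jacobiForm (a b u : ℝ → ℝ) : ℝ :=
  ∫ θ in (0 : ℝ)..Real.pi, (a θ * deriv u θ ^ 2 + b θ * u θ ^ 2)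

/-- The leading coefficient of the Jacobi operator. -/
def jacobiLead (σ : ℝ) (r p : ℝ → ℝ) (θ : ℝ) : ℝ := σ * r θ ^ 4 / arcSpeed r p θ ^ 3

/-- The potential of the Jacobi operator. -/
def jacobiPotential (g μ : ℝ) (r : ℝ → ℝ) (θ : ℝ) : ℝ := r θ ^ 2 * (2 * g * curveY r θ - μ)

namespace SmoothProfile

variable {r p q s : ℝ → ℝ} (h : SmoothProfile r p q s)
include h

lemma cont_jacobiLead (σ : ℝ) : ContinuousOn (jacobiLead σ r p) (Icc 0 Real.pi) := by
  have h0 := h.cont₀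
  have h1 := h.cont_speed
  exact ContinuousOn.div (by fun_prop) (by fun_prop) fun θ hθ => (pow_pos (h.speed_pos hθ) 3).ne'

lemma cont_jacobiPotential (g μ : ℝ) :
    ContinuousOn (jacobiPotential g μ r) (Icc 0 Real.pi) := by
  have h0 := h.cont₀
  have h1 := h.cont_curveY
  unfold jacobiPotential
  fun_prop

lemma deriv_inv : HasDerivOn (fun θ => (r θ)⁻¹) (fun θ => -p θ / r θ ^ 2) := fun θ hθ =>
  (h.deriv₁ θ hθ).fun_inv (h.pos θ hθ).ne'

lemma isH1_div {ξ : ℝ → ℝ} (hξ : IsH1 ξ) : IsH1 (fun θ => ξ θ * (r θ)⁻¹) := by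
  refine hξ.mul (h.deriv_inv.isH1 ?_)
  exact h.cont₁.neg.div (h.cont₀.pow 2) fun θ hθ => (pow_pos (h.pos θ hθ) 2).ne'

/-- The cross term `r ξ' - p ξ` in the second derivative of the length is exactly `r² u'`. This is
why dividing by `r` diagonalizes the form. -/
lemma deriv_div_ae {ξ : ℝ → ℝ} (hξ : IsH1 ξ) : ∀ᵐ θ ∂arcMeasure,
    deriv (fun θ => ξ θ * (r θ)⁻¹) θ = (r θ * deriv ξ θ - p θ * ξ θ) / r θ ^ 2 := by
  filter_upwards [ae_arc_mem_Ioo, hξ.ae_differentiableAt] with θ hθ hd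
  rw [(hd.hasDerivAt.fun_mul (h.deriv_inv.hasDerivAt hθ)).deriv]
  have := (h.pos θ (Ioo_subset_Icc_self hθ)).ne'
  field_simp; ring

lemma integrable_cross_sq {ξ : ℝ → ℝ} (hξ : IsH1 ξ) :
    Integrable (fun θ => (r θ * deriv ξ θ - p θ * ξ θ) ^ 2 / arcSpeed r p θ ^ 3) arcMeasure := by
  have hcross : MemLp (fun θ => r θ * deriv ξ θ - p θ * ξ θ) 2 arcMeasure :=
    (memLp_arc_mul h.cont₀ hξ.memLp_arc_deriv).sub
      (memLp_arc_mul h.cont₁ (memLp_arc hξ.continuousOn 2))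
  have hW : ContinuousOn (fun θ => (arcSpeed r p θ ^ 3)⁻¹) (Icc 0 Real.pi) :=
    (h.cont_speed.pow 3).inv₀ fun θ hθ => (pow_pos (h.speed_pos hθ) 3).ne'
  refine (integrable_arc_mul hW hcross.integrable_sq).congr (Eventually.of_forall fun θ => ?_)
  simp only []
  ring

/-- The Jacobi form of `ξ / r` in terms of `ξ`. -/
lemma jacobiForm_div {ξ : ℝ → ℝ} (hξ : IsH1 ξ) (g σ μ : ℝ) :
    jacobiForm (jacobiLead σ r p) (jacobiPotential g μ r) (fun θ => ξ θ * (r θ)⁻¹)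
      = 2 * g * (∫ θ in (0 : ℝ)..Real.pi, r θ * ξ θ ^ 2 * Real.sin θ)
        + σ * (∫ θ in (0 : ℝ)..Real.pi,
          (r θ * deriv ξ θ - p θ * ξ θ) ^ 2 / arcSpeed r p θ ^ 3)
        - μ * (∫ θ in (0 : ℝ)..Real.pi, ξ θ ^ 2) := by
  have h0 := h.cont₀
  have hX := hξ.continuousOn
  have hs : ContinuousOn Real.sin (Icc 0 Real.pi) := Real.continuous_sin.continuousOn
  have i1 : IntervalIntegrable (fun θ => 2 * g * (r θ * ξ θ ^ 2 * Real.sin θ)) volume 0 Real.pi :=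
    intervalIntegrable_arc_iff.2 (integrable_arc (by fun_prop))
  have i2 : IntervalIntegrable (fun θ => σ * ((r θ * deriv ξ θ - p θ * ξ θ) ^ 2
    / arcSpeed r p θ ^ 3)) volume 0 Real.pi :=
    intervalIntegrable_arc_iff.2 ((h.integrable_cross_sq hξ).const_mul σ)
  have i3 : IntervalIntegrable (fun θ => μ * ξ θ ^ 2) volume 0 Real.pi :=
    intervalIntegrable_arc_iff.2 (integrable_arc (by fun_prop))
  rw [jacobiForm, ← intervalIntegral.integral_const_mul, ← intervalIntegral.integral_const_mul,
    ← intervalIntegral.integral_const_mul, ← intervalIntegral.integral_add i1 i2,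
    ← intervalIntegral.integral_sub (i1.add i2) i3]
  refine integral_arc_congr ?_
  filter_upwards [ae_arc_mem_Ioo, h.deriv_div_ae hξ] with θ hθ hd
  rw [hd, jacobiLead, jacobiPotential, curveY]
  have hI := Ioo_subset_Icc_self hθ
  have h1 := (h.pos θ hI).ne'
  have h2 := (h.speed_pos hI).ne'
  field_simp
  ring

end SmoothProfile

namespace IsCapillaryProfile

variable {g σ γ μ : ℝ} {r p q s : ℝ → ℝ} (h : IsCapillaryProfile g σ γ μ r p q s)
include h

/-- The explicit form of the second variation is the Jacobi form of `ξ / r`. -/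
lemma secondVariationFormula_eq {ξ : ℝ → ℝ} (hξ : IsH1 ξ) :
    secondVariationFormula g σ r ξ
      = jacobiForm (jacobiLead σ r p) (jacobiPotential g μ r) (fun θ => ξ θ * (r θ)⁻¹) := by
  have h0 := h.cont₀
  have hX := hξ.continuousOn
  have hs : ContinuousOn Real.sin (Icc 0 Real.pi) := Real.continuous_sin.continuousOn
  rw [h.jacobiForm_div hξ, secondVariationFormula]
  have i1 : IntervalIntegrable (fun θ => g * (r θ * ξ θ ^ 2 * Real.sin θ)) volume 0 Real.pi :=
    intervalIntegrable_arc_iff.2 (integrable_arc (by fun_prop))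
  have i2 : IntervalIntegrable (fun θ => σ * ((r θ * deriv ξ θ - p θ * ξ θ) ^ 2
    / arcSpeed r p θ ^ 3)) volume 0 Real.pi :=
    intervalIntegrable_arc_iff.2 ((h.integrable_cross_sq hξ).const_mul σ)
  have i3 : IntervalIntegrable (fun θ => μ * ξ θ ^ 2) volume 0 Real.pi :=
    intervalIntegrable_arc_iff.2 (integrable_arc (by fun_prop))
  have e : σ * (∫ θ in (0 : ℝ)..Real.pi,
        (-((r θ ^ 2 + 2 * deriv r θ ^ 2 - deriv (deriv r) θ * r θ)
              / Real.sqrt (r θ ^ 2 + deriv r θ ^ 2) ^ 3) * ξ θ ^ 2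
          + (ξ θ ^ 2 + deriv ξ θ ^ 2) / Real.sqrt (r θ ^ 2 + deriv r θ ^ 2)
          - (ξ θ * r θ + deriv r θ * deriv ξ θ) ^ 2
              / Real.sqrt (r θ ^ 2 + deriv r θ ^ 2) ^ 3))
      = ∫ θ in (0 : ℝ)..Real.pi, (g * (r θ * ξ θ ^ 2 * Real.sin θ)
        + σ * ((r θ * deriv ξ θ - p θ * ξ θ) ^ 2 / arcSpeed r p θ ^ 3) - μ * ξ θ ^ 2) := by
    rw [← intervalIntegral.integral_const_mul]
    refine integral_arc_congr ?_
    filter_upwards [ae_arc_mem_Ioo] with θ hθ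
    have hI := Ioo_subset_Icc_self hθ
    have e1 := h.deriv₁.deriv_eq hθ
    have e2 : deriv (deriv r) θ = q θ := by
      have : deriv r =ᶠ[𝓝 θ] p := by
        filter_upwards [Ioo_mem_nhds hθ.1 hθ.2] with φ hφ using h.deriv₁.deriv_eq hφ
      rw [this.deriv_eq, h.deriv₂.deriv_eq hθ]
    have e3 : Real.sqrt (r θ ^ 2 + deriv r θ ^ 2) = arcSpeed r p θ := by rw [e1, arcSpeed]
    have e4 := h.laplace θ hI
    rw [e3, e2, e1]
    rw [polarCurvature] at e4
    have h2 := (h.speed_pos hI).ne'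
    have h3 := arcSpeed_sq r p θ
    -- Lagrange's identity again. The leftover curvature term `-σ κ ξ²` equals `(g y - μ) ξ²` by the
    -- capillary equation, which doubles the gravity term.
    have e5 : (ξ θ ^ 2 + deriv ξ θ ^ 2) / arcSpeed r p θ
        - (ξ θ * r θ + p θ * deriv ξ θ) ^ 2 / arcSpeed r p θ ^ 3
        = (r θ * deriv ξ θ - p θ * ξ θ) ^ 2 / arcSpeed r p θ ^ 3 := by
      field_simp
      rw [h3]; ring
    linear_combination σ * e5 - ξ θ ^ 2 * e4
  rw [e, intervalIntegral.integral_sub (i1.add i2) i3, intervalIntegral.integral_add i1 i2]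
  simp only [intervalIntegral.integral_const_mul]
  ring

/-- The second variation exists and is given by the explicit form. -/
lemma hasDerivAt_deriv_energyAlong {ξ : ℝ → ℝ} (hξ : IsAdmissible r ξ) :
    (∀ᶠ t in 𝓝 (0 : ℝ), DifferentiableAt ℝ (energyAlong g σ γ r ξ) t) ∧
      HasDerivAt (deriv (energyAlong g σ γ r ξ)) (secondVariationFormula g σ r ξ) 0 := by
  have H := SessileDrop.hasDerivAt_deriv_energyAlong h.deriv₁ h.cont₁ h.pos hξ.isH1
    hξ.orthogonal g σ γ
  refine ⟨H.1, ?_⟩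
  convert! H.2 using 1
  rw [h.secondVariationFormula_eq hξ.isH1, h.jacobiForm_div hξ.isH1, ← h.multiplier]
  have := (volumeFunctional_pos h.cont₀ h.pos).ne'
  field_simp

lemma secondVariation_eq {ξ : ℝ → ℝ} (hξ : IsAdmissible r ξ) :
    secondVariation g σ γ r ξ
      = jacobiForm (jacobiLead σ r p) (jacobiPotential g μ r) (fun θ => ξ θ * (r θ)⁻¹) := by
  rw [secondVariation, (h.hasDerivAt_deriv_energyAlong hξ).2.deriv,
    h.secondVariationFormula_eq hξ.isH1]

end IsCapillaryProfile

/-! ### Positivity of the pressure and the horizontal Jacobi field. -/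

/-- The capillary pressure `μ - g y`, equal to `σ` times the curvature for a capillary profile. -/
def excessPressure (g μ : ℝ) (r : ℝ → ℝ) (θ : ℝ) : ℝ := μ - g * curveY r θ

/-- The horizontal Jacobi field `y' / r²`. -/
def shiftField (r p : ℝ → ℝ) (θ : ℝ) : ℝ := curveYDeriv r p θ / r θ ^ 2

/-- The derivative of `shiftField`. -/
def shiftFieldDeriv (r p q : ℝ → ℝ) (θ : ℝ) : ℝ :=
  -(Real.sin θ * (r θ ^ 2 + 2 * p θ ^ 2 - q θ * r θ)) / r θ ^ 3

namespace IsCapillaryProfile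

variable {g σ γ μ : ℝ} {r p q s : ℝ → ℝ} (h : IsCapillaryProfile g σ γ μ r p q s)
include h

lemma curvature_eq {θ : ℝ} (hθ : θ ∈ Icc 0 Real.pi) :
    σ * (r θ ^ 2 + 2 * p θ ^ 2 - q θ * r θ) = excessPressure g μ r θ * arcSpeed r p θ ^ 3 := by
  have h1 := h.laplace θ hθ
  rw [excessPressure, curveY, ← h1, polarCurvature, mul_assoc,
    div_mul_cancel₀ _ (pow_pos (h.speed_pos hθ) 3).ne']

lemma deriv_excessPressure : HasDerivOn (excessPressure g μ r)
    (fun θ => -(g * curveYDeriv r p θ)) := fun θ hθ => by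
  exact ((h.deriv_curveY θ hθ).const_mul g).const_sub μ

lemma cont_excessPressure : ContinuousOn (excessPressure g μ r) (Icc 0 Real.pi) :=
  h.deriv_excessPressure.continuousOn

/-- The first integral of the capillary equation: the horizontal component of the unit tangent is
a quadratic function of the height. -/
lemma unitTangentX_eq {θ : ℝ} (hθ : θ ∈ Icc 0 Real.pi) :
    σ * (curveXDeriv r p θ / arcSpeed r p θ)
      = g / 2 * curveY r θ ^ 2 - μ * curveY r θ - γ := by
  have hd : HasDerivOn (fun θ => σ * (curveXDeriv r p θ / arcSpeed r p θ)
      - (g / 2 * curveY r θ ^ 2 - μ * curveY r θ)) (fun _ => 0) := fun θ hθ => by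
    refine (((h.deriv_unitTangentX θ hθ).const_mul σ).fun_sub
      ((((h.deriv_curveY θ hθ).fun_pow 2).const_mul (g / 2)).fun_sub
        ((h.deriv_curveY θ hθ).const_mul μ))).congr_deriv ?_
    have h1 := h.laplace θ hθ
    rw [← curveY] at h1
    simp only [Nat.cast_ofNat, Nat.add_one_sub_one, pow_one]
    -- Frenet's equation turns the derivative of the tangent component into `-κ y'`, and `σ κ = μ -
    -- g y` is a function of the height alone. The constant is then fixed by Young's law at `θ = 0`.
    linear_combination -curveYDeriv r p θ * h1
  have h1 := hd.eq_of_deriv_zero hθ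
  have h2 := h.young
  have h3 : curveXDeriv r p 0 = p 0 := by simp [curveXDeriv]
  simp only [curveY_zero, h3] at h1
  linarith

/-- The capillary pressure is positive: the free surface is strictly convex. -/
lemma excessPressure_pos (hg : 0 < g) (hσ : 0 < σ) {θ : ℝ} (hθ : θ ∈ Icc 0 Real.pi) :
    0 < excessPressure g μ r θ := by
  obtain ⟨θm, hm, hmax⟩ := isCompact_Icc.exists_isMaxOn (nonempty_Icc.2 Real.pi_pos.le)
    h.cont_curveY
  have hmid : Real.pi / 2 ∈ Ioo 0 Real.pi := ⟨by linarith [Real.pi_pos], by linarith [Real.pi_pos]⟩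
  have hH : 0 < curveY r θm :=
    (h.curveY_pos hmid).trans_le (hmax (Ioo_subset_Icc_self hmid))
  have hmI : θm ∈ Ioo 0 Real.pi := by
    refine ⟨lt_of_le_of_ne hm.1 fun e => ?_, lt_of_le_of_ne hm.2 fun e => ?_⟩
    · rw [← e] at hH; simp at hH
    · rw [e] at hH; simp at hH
  have hy0 : curveYDeriv r p θm = 0 :=
    (hmax.isLocalMax (Icc_mem_nhds hmI.1 hmI.2)).hasDerivAt_eq_zero (h.deriv_curveY.hasDerivAt hmI)
  have hWm := (h.speed_pos hm).ne'
  have hPm := h.unitTangentX_eq hm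
  rw [h.curveXDeriv_eq_neg_speed hm hy0, neg_div, div_self hWm] at hPm
  set H := curveY r θm
  suffices hμ : g * H < μ by
    have h1 : curveY r θ ≤ H := hmax hθ
    rw [excessPressure]; nlinarith
  -- If `g H ≥ μ` at the maximal height `H`, the first integral degenerates quadratically at `H`:
  -- `y' ≤ C (H - y)`. By Gronwall a curve starting at height `0 < H` could then never reach `H`.
  by_contra! hμ
  obtain ⟨M, hM⟩ := isCompact_Icc.exists_bound_of_continuousOn h.cont_speed
  have hM0 : 0 ≤ M := (norm_nonneg _).trans (hM θm hm)
  set C := Real.sqrt (g / σ) * M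
  have hC : C ^ 2 = g / σ * M ^ 2 := by
    rw [mul_pow, Real.sq_sqrt (by positivity)]
  have hC0 : 0 ≤ C := by positivity
  have hbound : ∀ φ ∈ Icc 0 Real.pi, curveYDeriv r p φ ≤ C * (H - curveY r φ) := fun φ hφ => by
    have hle : 0 ≤ H - curveY r φ := sub_nonneg.2 (hmax hφ)
    refine abs_le_of_sq_le_sq' ?_ (mul_nonneg hC0 hle) |>.2
    have hW := h.speed_pos hφ
    have hWM : arcSpeed r p φ ≤ M := (le_abs_self _).trans (hM φ hφ)
    have h1 := h.unitTangentX_eq hφ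
    have h2 := curveXDeriv_sq_add_sq r p φ
    set c := curveXDeriv r p φ / arcSpeed r p φ with hc
    have hcx : curveXDeriv r p φ = c * arcSpeed r p φ := by rw [hc]; field_simp
    have hy2 : curveYDeriv r p φ ^ 2 = arcSpeed r p φ ^ 2 * ((1 - c) * (1 + c)) := by
      rw [hcx] at h2; linarith
    have hc2 : c ^ 2 ≤ 1 := by
      by_contra! hlt
      nlinarith [sq_nonneg (curveYDeriv r p φ), pow_pos hW 2]
    have hc1 : -1 ≤ c ∧ c ≤ 1 := abs_le.1 ((sq_le_one_iff_abs_le_one c).1 hc2)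
    -- Subtract the first integral at the highest point, where the tangent component is `-1`, and
    -- use `μ ≤ g H`.
    have h3 : σ * (1 + c) ≤ g / 2 * (H - curveY r φ) ^ 2 := by
      have : σ * (1 + c) = (H - curveY r φ) * (μ - g / 2 * (H + curveY r φ)) := by linarith
      rw [this]
      nlinarith
    have h4 : 1 + c ≤ g / σ / 2 * (H - curveY r φ) ^ 2 := by
      rw [show g / σ / 2 * (H - curveY r φ) ^ 2 = g / 2 * (H - curveY r φ) ^ 2 / σ by ring,
        le_div_iff₀ hσ]
      linarith
    have h5 : (1 - c) * (1 + c) ≤ 2 * (g / σ / 2 * (H - curveY r φ) ^ 2) :=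
      mul_le_mul (by linarith) h4 (by linarith) zero_le_two
    have h6 : arcSpeed r p φ ^ 2 ≤ M ^ 2 := by gcongr
    rw [hy2, mul_pow, hC]
    calc arcSpeed r p φ ^ 2 * ((1 - c) * (1 + c))
        ≤ M ^ 2 * (2 * (g / σ / 2 * (H - curveY r φ) ^ 2)) :=
          mul_le_mul h6 h5 (mul_nonneg (by linarith) (by linarith)) (sq_nonneg M)
      _ = _ := by ring
  -- Gronwall's integrating factor. The function is `H > 0` at angle `0` and zero at the maximum
  -- point, which contradicts monotonicity.
  have hmono : MonotoneOn (fun φ => (H - curveY r φ) * Real.exp (C * φ)) (Icc 0 Real.pi) := by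
    refine monotoneOn_of_hasDerivWithinAt_nonneg (f' := fun φ =>
      (C * (H - curveY r φ) - curveYDeriv r p φ) * Real.exp (C * φ)) (convex_Icc _ _) ?_ ?_ ?_
    · have := h.cont_curveY
      fun_prop
    · intro φ hφ
      rw [interior_Icc] at hφ
      have h1 := h.deriv_curveY.hasDerivAt hφ
      have h2 : HasDerivAt (fun φ => Real.exp (C * φ)) (Real.exp (C * φ) * C) φ := by
        simpa using ((hasDerivAt_id φ).const_mul C).exp
      exact (((h1.const_sub H).fun_mul h2).congr_deriv (by ring)).hasDerivWithinAt
    · intro φ hφ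
      exact mul_nonneg (sub_nonneg.2 (hbound φ (interior_subset hφ))) (Real.exp_pos _).le
  have hfin := hmono (left_mem_Icc.2 Real.pi_pos.le) hm hm.1
  simp only [curveY_zero, mul_zero, Real.exp_zero] at hfin
  rw [sub_self, zero_mul] at hfin
  linarith

lemma deriv_shiftField : HasDerivOn (shiftField r p) (shiftFieldDeriv r p q) := fun θ hθ => by
  have hr := (h.pos θ hθ).ne'
  refine ((h.deriv_curveYDeriv θ hθ).fun_div ((h.deriv₁ θ hθ).fun_pow 2)
    (pow_ne_zero 2 hr)).congr_deriv ?_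
  simp only [shiftFieldDeriv, curveYDeriv]
  field_simp
  simp
  ring

lemma cont_shiftFieldDeriv : ContinuousOn (shiftFieldDeriv r p q) (Icc 0 Real.pi) := by
  have h0 := h.cont₀
  have h1 := h.cont₁
  have h2 := h.cont₂
  have hs : ContinuousOn Real.sin (Icc 0 Real.pi) := Real.continuous_sin.continuousOn
  exact ContinuousOn.div (by fun_prop) (by fun_prop) fun θ hθ => (pow_pos (h.pos θ hθ) 3).ne'

/-- The curvature equation clears the second derivative from the flux. The factor `y` gives the
natural boundary conditions at both ends, and the sign gives monotonicity of the field. -/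
lemma lead_mul_shiftFieldDeriv {θ : ℝ} (hθ : θ ∈ Icc 0 Real.pi) :
    jacobiLead σ r p θ * shiftFieldDeriv r p q θ
      = -(curveY r θ * excessPressure g μ r θ) := by
  have h1 := h.curvature_eq hθ
  have hr := (h.pos θ hθ).ne'
  have hW := (h.speed_pos hθ).ne'
  rw [jacobiLead, shiftFieldDeriv, curveY]
  field_simp
  linear_combination -Real.sin θ * h1

lemma lead_pos (hσ : 0 < σ) {θ : ℝ} (hθ : θ ∈ Icc 0 Real.pi) : 0 < jacobiLead σ r p θ :=
  div_pos (mul_pos hσ (pow_pos (h.pos θ hθ) 4)) (pow_pos (h.speed_pos hθ) 3)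

lemma shiftFieldDeriv_neg (hg : 0 < g) (hσ : 0 < σ) {θ : ℝ} (hθ : θ ∈ Ioo 0 Real.pi) :
    shiftFieldDeriv r p q θ < 0 := by
  have hI := Ioo_subset_Icc_self hθ
  have h1 := h.lead_mul_shiftFieldDeriv hI
  have h2 := mul_pos (h.curveY_pos hθ) (h.excessPressure_pos hg hσ hI)
  have h3 := h.lead_pos hσ hI
  by_contra! hc
  nlinarith [mul_nonneg h3.le hc]

/-- `shiftField` solves the Jacobi equation. -/
lemma deriv_shiftFlux : HasDerivOn (fun θ => -(curveY r θ * excessPressure g μ r θ))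
    (fun θ => jacobiPotential g μ r θ * shiftField r p θ) := fun θ hθ => by
  refine ((h.deriv_curveY θ hθ).fun_mul (h.deriv_excessPressure θ hθ)).fun_neg.congr_deriv ?_
  have hr := (h.pos θ hθ).ne'
  simp only [jacobiPotential, shiftField, excessPressure]
  field_simp
  ring

/-- Makes the apex the only zero, so that Jacobi's argument applies on either side of it. -/
lemma shiftField_strictAntiOn (hg : 0 < g) (hσ : 0 < σ) :
    StrictAntiOn (shiftField r p) (Icc 0 Real.pi) := by
  refine strictAntiOn_of_deriv_neg (convex_Icc _ _) h.deriv_shiftField.continuousOn fun θ hθ => ?_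
  rw [interior_Icc] at hθ
  rw [h.deriv_shiftField.deriv_eq hθ]
  exact h.shiftFieldDeriv_neg hg hσ hθ

/-- The curve has a highest point. -/
lemma exists_apex : ∃ c ∈ Ioo 0 Real.pi, curveYDeriv r p c = 0 := by
  -- The end point values of `y'` are `r(0)` and `-r(π)`.
  have h0 : 0 < curveYDeriv r p 0 := by
    simpa [curveYDeriv] using h.pos 0 (left_mem_Icc.2 Real.pi_pos.le)
  have hπ : curveYDeriv r p Real.pi < 0 := by
    simpa [curveYDeriv] using h.pos Real.pi (right_mem_Icc.2 Real.pi_pos.le)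
  obtain ⟨c, hc, hc0⟩ := intermediate_value_Icc' Real.pi_pos.le h.cont_curveYDeriv
    (show (0 : ℝ) ∈ Icc _ _ from ⟨hπ.le, h0.le⟩)
  refine ⟨c, ⟨lt_of_le_of_ne hc.1 fun e => ?_, lt_of_le_of_ne hc.2 fun e => ?_⟩, hc0⟩
  · rw [← e] at hc0; exact h0.ne' hc0
  · rw [e] at hc0; exact hπ.ne hc0

end IsCapillaryProfile

/-! ### The pressure field and the sign of its volume. -/

/-- `μ ∫ x' / (μ - g y)²`, based at `c`. -/
def pressureShift (g μ : ℝ) (r p : ℝ → ℝ) (c θ : ℝ) : ℝ :=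
  ∫ φ in c..θ, μ * curveXDeriv r p φ / excessPressure g μ r φ ^ 2

/-- The Jacobi field of the family of capillary profiles with varying pressure, fixed contact angle
and fixed position of the apex `c`; it solves `-(a η')' + b η = -r²`. -/
def pressureField (g μ : ℝ) (r p : ℝ → ℝ) (c θ : ℝ) : ℝ :=
  (curveYDeriv r p θ * pressureShift g μ r p c θ
    - curveY r θ * curveXDeriv r p θ / excessPressure g μ r θ) / r θ ^ 2

/-- The derivative of `pressureField`. -/
def pressureFieldDeriv (g μ : ℝ) (r p q : ℝ → ℝ) (c θ : ℝ) : ℝ :=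
  (r θ ^ 2 + 2 * p θ ^ 2 - q θ * r θ) / r θ ^ 3
    * (curveY r θ * Real.cos θ / excessPressure g μ r θ
      - pressureShift g μ r p c θ * Real.sin θ)

namespace IsCapillaryProfile

variable {g σ γ μ : ℝ} {r p q s : ℝ → ℝ} (h : IsCapillaryProfile g σ γ μ r p q s)
include h

lemma deriv_pressureShift (hg : 0 < g) (hσ : 0 < σ) {c : ℝ} (hc : c ∈ Icc 0 Real.pi) :
    HasDerivOn (pressureShift g μ r p c)
      (fun θ => μ * curveXDeriv r p θ / excessPressure g μ r θ ^ 2) := by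
  have h1 := h.cont_curveXDeriv
  have h2 := h.cont_excessPressure
  exact hasDerivOn_integral (ContinuousOn.div (by fun_prop) (by fun_prop) fun θ hθ =>
    (pow_pos (h.excessPressure_pos hg hσ hθ) 2).ne') hc

lemma deriv_pressureField (hg : 0 < g) (hσ : 0 < σ) {c : ℝ} (hc : c ∈ Icc 0 Real.pi) :
    HasDerivOn (pressureField g μ r p c) (pressureFieldDeriv g μ r p q c) := fun θ hθ => by
  have hr := (h.pos θ hθ).ne'
  have hS := (h.excessPressure_pos hg hσ hθ).ne'
  refine ((((h.deriv_curveYDeriv θ hθ).fun_mul (h.deriv_pressureShift hg hσ hc θ hθ)).fun_sub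
    (((h.deriv_curveY θ hθ).fun_mul (h.deriv_curveXDeriv θ hθ)).fun_div
      (h.deriv_excessPressure θ hθ) hS)).fun_div ((h.deriv₁ θ hθ).fun_pow 2)
    (pow_ne_zero 2 hr)).congr_deriv ?_
  -- Eliminating `μ` in favour of the pressure `S` leaves an identity of rational functions with
  -- denominators `r` and `S` only.
  have hμ : μ = excessPressure g μ r θ + g * curveY r θ := by rw [excessPressure]; ring
  beta_reduce
  rw [pressureFieldDeriv]
  generalize pressureShift g μ r p c θ = J
  generalize excessPressure g μ r θ = S at *
  subst hμ
  simp only [curveYDeriv, curveXDeriv, curveY]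
  field_simp
  simp only [Nat.cast_ofNat, Nat.add_one_sub_one, pow_one]
  ring

lemma cont_pressureFieldDeriv (hg : 0 < g) (hσ : 0 < σ) {c : ℝ} (hc : c ∈ Icc 0 Real.pi) :
    ContinuousOn (pressureFieldDeriv g μ r p q c) (Icc 0 Real.pi) := by
  have h0 := h.cont₀
  have h1 := h.cont₁
  have h2 := h.cont₂
  have h3 := h.cont_curveY
  have h4 := h.cont_excessPressure
  have h5 := (h.deriv_pressureShift hg hσ hc).continuousOn
  have hs : ContinuousOn Real.sin (Icc 0 Real.pi) := Real.continuous_sin.continuousOn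
  have hcos : ContinuousOn Real.cos (Icc 0 Real.pi) := Real.continuous_cos.continuousOn
  refine ContinuousOn.mul (ContinuousOn.div (by fun_prop) (by fun_prop) fun θ hθ =>
    (pow_pos (h.pos θ hθ) 3).ne') (ContinuousOn.sub (ContinuousOn.div (by fun_prop) h4 fun θ hθ =>
    (h.excessPressure_pos hg hσ hθ).ne') (by fun_prop))

/-- The flux again carries the factor `y`, so natural boundary conditions hold at both ends for
every base point. -/
lemma lead_mul_pressureFieldDeriv (hg : 0 < g) (hσ : 0 < σ) {c : ℝ} {θ : ℝ}
    (hθ : θ ∈ Icc 0 Real.pi) : jacobiLead σ r p θ * pressureFieldDeriv g μ r p q c θ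
      = curveY r θ * (curveX r θ - excessPressure g μ r θ * pressureShift g μ r p c θ) := by
  have h1 := h.curvature_eq hθ
  have hr := (h.pos θ hθ).ne'
  have hW := (h.speed_pos hθ).ne'
  have hS := (h.excessPressure_pos hg hσ hθ).ne'
  rw [jacobiLead, pressureFieldDeriv, curveY, curveX]
  field_simp
  linear_combination (r θ * Real.cos θ - excessPressure g μ r θ * pressureShift g μ r p c θ) *
    Real.sin θ * h1

/-- The inhomogeneity arises as `x y' - y x' = r²`. The terms containing the primitive `J` reproduce
the homogeneous equation of the shift field. -/
lemma deriv_pressureFlux (hg : 0 < g) (hσ : 0 < σ) {c : ℝ} (hc : c ∈ Icc 0 Real.pi) :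
    HasDerivOn (fun θ => curveY r θ
        * (curveX r θ - excessPressure g μ r θ * pressureShift g μ r p c θ))
      (fun θ => jacobiPotential g μ r θ * pressureField g μ r p c θ + r θ ^ 2) := fun θ hθ => by
  have hr := (h.pos θ hθ).ne'
  have hS := (h.excessPressure_pos hg hσ hθ).ne'
  refine ((h.deriv_curveY θ hθ).fun_mul ((h.deriv_curveX θ hθ).fun_sub
    ((h.deriv_excessPressure θ hθ).fun_mul (h.deriv_pressureShift hg hσ hc θ hθ)))).congr_deriv ?_
  have hcr := curveX_mul_sub r p θ
  have hμ : μ = excessPressure g μ r θ + g * curveY r θ := by rw [excessPressure]; ring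
  have hη : jacobiPotential g μ r θ * pressureField g μ r p c θ = (2 * g * curveY r θ - μ)
      * (curveYDeriv r p θ * pressureShift g μ r p c θ
        - curveY r θ * curveXDeriv r p θ / excessPressure g μ r θ) := by
    rw [jacobiPotential, pressureField]
    field_simp
  beta_reduce
  rw [hη, ← hcr]
  generalize pressureShift g μ r p c θ = J
  generalize excessPressure g μ r θ = S at *
  subst hμ
  field_simp
  ring

/-- The flux of the pressure field and its derivative, in the form needed to integrate by parts. -/
lemma deriv_lead_mul_pressureFieldDeriv (hg : 0 < g) (hσ : 0 < σ) {c : ℝ}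
    (hc : c ∈ Icc 0 Real.pi) :
    HasDerivOn (fun θ => jacobiLead σ r p θ * pressureFieldDeriv g μ r p q c θ)
      (fun θ => jacobiPotential g μ r θ * pressureField g μ r p c θ + r θ ^ 2) :=
  (h.deriv_pressureFlux hg hσ hc).congr (fun _ hθ => h.lead_mul_pressureFieldDeriv hg hσ hθ)
    fun _ _ => rfl

lemma deriv_lead_mul_shiftFieldDeriv :
    HasDerivOn (fun θ => jacobiLead σ r p θ * shiftFieldDeriv r p q θ)
      (fun θ => jacobiPotential g μ r θ * shiftField r p θ) :=
  h.deriv_shiftFlux.congr (fun _ hθ => h.lead_mul_shiftFieldDeriv hθ) fun _ _ => rfl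

/-- At the apex `y' = 0` and `x' = -W`, which leaves `y W / (S r²)`. The positive value permits
correcting any function to vanish at the apex. -/
lemma pressureField_apex_pos (hg : 0 < g) (hσ : 0 < σ) {c : ℝ} (hc : c ∈ Ioo 0 Real.pi)
    (hy : curveYDeriv r p c = 0) : 0 < pressureField g μ r p c c := by
  have hI := Ioo_subset_Icc_self hc
  have h1 := h.speed_pos hI
  rw [pressureField, hy, h.curveXDeriv_eq_neg_speed hI hy, zero_mul, zero_sub, mul_neg, neg_div _ (curveY r c * _),
    neg_neg]
  exact div_pos (div_pos (mul_pos (h.curveY_pos hc) h1) (h.excessPressure_pos hg hσ hI))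
    (pow_pos (h.pos c hI) 2)

/-- Green's area formula: `x y` vanishes at both ends, and `x y' - y x' = r²`. -/
lemma integral_curveY_mul_curveXDeriv :
    ∫ θ in (0 : ℝ)..Real.pi, curveY r θ * curveXDeriv r p θ = -(volumeFunctional r / 2) := by
  have hx := h.cont_curveX
  have hy := h.cont_curveY
  have hx' := h.cont_curveXDeriv
  have hy' := h.cont_curveYDeriv
  have h0 := h.cont₀
  have h1 : HasDerivOn (fun θ => curveX r θ * curveY r θ)
      (fun θ => curveXDeriv r p θ * curveY r θ + curveX r θ * curveYDeriv r p θ) := fun θ hθ =>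
    (h.deriv_curveX θ hθ).fun_mul (h.deriv_curveY θ hθ)
  have h2 := h1.integral_eq (by fun_prop)
  simp only [curveY_zero, curveY_pi, mul_zero, sub_zero] at h2
  have h3 : ∫ θ in (0 : ℝ)..Real.pi,
      (curveXDeriv r p θ * curveY r θ + curveX r θ * curveYDeriv r p θ)
      = 2 * (∫ θ in (0 : ℝ)..Real.pi, curveY r θ * curveXDeriv r p θ) + volumeFunctional r := by
    rw [volumeFunctional, ← intervalIntegral.integral_const_mul, ← intervalIntegral.integral_add]
    · refine intervalIntegral.integral_congr fun θ _ => ?_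
      linear_combination curveX_mul_sub r p θ
    all_goals refine intervalIntegrable_arc_iff.2 (integrable_arc ?_); fun_prop
  linarith

lemma pressure_pos (hg : 0 < g) (hσ : 0 < σ) : 0 < μ := by
  simpa [excessPressure] using h.excessPressure_pos hg hσ (left_mem_Icc.2 Real.pi_pos.le)

/-- The unit tangent turns monotonically as the height grows. -/
lemma curveXDeriv_nonpos_of_height_le (hg : 0 < g) (hσ : 0 < σ) {θ φ : ℝ}
    (hθ : θ ∈ Icc 0 Real.pi) (hφ : φ ∈ Icc 0 Real.pi) (hle : curveY r θ ≤ curveY r φ)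
    (hx : curveXDeriv r p θ ≤ 0) : curveXDeriv r p φ ≤ 0 := by
  have h1 := h.unitTangentX_eq hθ
  have h2 := h.unitTangentX_eq hφ
  have h3 := h.excessPressure_pos hg hσ hθ
  have h4 := h.excessPressure_pos hg hσ hφ
  rw [excessPressure] at h3 h4
  have h5 : curveXDeriv r p θ / arcSpeed r p θ ≤ 0 :=
    div_nonpos_of_nonpos_of_nonneg hx (h.speed_pos hθ).le
  -- The first integrals at `φ` and `θ` differ by minus the height difference times the mean of the
  -- two positive pressures.
  have h6 : σ * (curveXDeriv r p φ / arcSpeed r p φ) ≤ 0 := by nlinarith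
  have h7 : curveXDeriv r p φ / arcSpeed r p φ ≤ 0 := by
    by_contra! hc; nlinarith [mul_pos hσ hc]
  by_contra! hc
  exact absurd (div_pos hc (h.speed_pos hφ)) (not_lt.2 h7)

/-- The volume decreases along the family of profiles with increasing pressure. -/
lemma integral_pressureField_pos (hg : 0 < g) (hσ : 0 < σ) {c : ℝ} (hc : c ∈ Ioo 0 Real.pi)
    (hyc : curveYDeriv r p c = 0) :
    0 < ∫ θ in (0 : ℝ)..Real.pi, r θ ^ 2 * pressureField g μ r p c θ := by
  have hcI := Ioo_subset_Icc_self hc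
  have hμ := h.pressure_pos hg hσ
  set S := excessPressure g μ r with hSdef
  have hSpos : ∀ θ ∈ Icc 0 Real.pi, 0 < S θ := fun θ hθ => h.excessPressure_pos hg hσ hθ
  set d : ℝ → ℝ := fun θ => 1 / S θ + μ / S θ ^ 2 with hd
  have hx := h.cont_curveX
  have hy := h.cont_curveY
  have hx' := h.cont_curveXDeriv
  have hy' := h.cont_curveYDeriv
  have hS : ContinuousOn S (Icc 0 Real.pi) := h.cont_excessPressure
  have hJd := h.deriv_pressureShift hg hσ hcI
  have hJ := hJd.continuousOn
  have hJ' : ContinuousOn (fun θ => μ * curveXDeriv r p θ / S θ ^ 2) (Icc 0 Real.pi) :=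
    ContinuousOn.div (by fun_prop) (by fun_prop) fun θ hθ => (pow_pos (hSpos θ hθ) 2).ne'
  have hdc : ContinuousOn d (Icc 0 Real.pi) :=
    (continuousOn_const.div hS fun θ hθ => (hSpos θ hθ).ne').add
      (continuousOn_const.div (hS.pow 2) fun θ hθ => (pow_pos (hSpos θ hθ) 2).ne')
  have hdmono : ∀ θ ∈ Icc 0 Real.pi, ∀ φ ∈ Icc 0 Real.pi, curveY r θ ≤ curveY r φ → d θ ≤ d φ := by
    intro θ hθ φ hφ hle
    have h1 : S φ ≤ S θ := by
      rw [hSdef, excessPressure, excessPressure]; nlinarith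
    have h2 := hSpos φ hφ
    have h3 := hSpos θ hθ
    simp only [hd]
    gcongr
  have hparts : ∫ θ in (0 : ℝ)..Real.pi, (curveYDeriv r p θ * pressureShift g μ r p c θ
      + curveY r θ * (μ * curveXDeriv r p θ / S θ ^ 2)) = 0 := by
    have h1 : HasDerivOn (fun θ => curveY r θ * pressureShift g μ r p c θ) (fun θ =>
      curveYDeriv r p θ * pressureShift g μ r p c θ
      + curveY r θ * (μ * curveXDeriv r p θ / S θ ^ 2)) := fun θ hθ =>
      (h.deriv_curveY θ hθ).fun_mul (hJd θ hθ)
    rw [h1.integral_eq (by fun_prop)]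
    simp
  -- Integrating `y' J` by parts removes the primitive `J` and leaves the area integrand `y x'` with
  -- the weight `d`, an increasing function of height.
  have heq : ∫ θ in (0 : ℝ)..Real.pi, r θ ^ 2 * pressureField g μ r p c θ
      = -∫ θ in (0 : ℝ)..Real.pi, curveY r θ * curveXDeriv r p θ * d θ := by
    refine (sub_zero _).symm.trans ?_
    refine (congrArg (_ - ·) hparts.symm).trans ?_
    rw [← intervalIntegral.integral_sub, ← intervalIntegral.integral_neg]
    · refine integral_arc_congr ?_
      filter_upwards [ae_arc_mem_Ioo] with θ hθ
      have hI := Ioo_subset_Icc_self hθ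
      have hr := (h.pos θ hI).ne'
      have hS0 := (hSpos θ hI).ne'
      simp only [hd]
      rw [pressureField, ← hSdef]
      field_simp
      ring
    · refine intervalIntegrable_arc_iff.2 (integrable_arc ?_)
      have := (h.deriv_pressureField hg hσ hcI).continuousOn
      have h0 := h.cont₀
      fun_prop
    · refine intervalIntegrable_arc_iff.2 (integrable_arc ?_)
      fun_prop
  -- Chebyshev-type comparison: `x'` is nonnegative below a threshold height and nonpositive above
  -- it, whereas `d` grows with height. The threshold is a zero of `x'` before the apex if `x'(0) ≥
  -- 0`; otherwise it is the height zero itself.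
  obtain ⟨θ₀, hθ₀, hcmp⟩ : ∃ θ₀ ∈ Icc 0 Real.pi, ∀ θ ∈ Icc 0 Real.pi,
      curveXDeriv r p θ * (d θ - d θ₀) ≤ 0 := by
    have key : ∀ θ₀ ∈ Icc 0 Real.pi, curveXDeriv r p θ₀ ≤ 0 →
        (curveXDeriv r p θ₀ = 0 ∨ θ₀ = 0) → ∀ θ ∈ Icc 0 Real.pi,
        curveXDeriv r p θ * (d θ - d θ₀) ≤ 0 := by
      intro θ₀ hθ₀ hneg hor θ hθ
      rcases le_total (curveY r θ₀) (curveY r θ) with hle | hle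
      · exact mul_nonpos_of_nonpos_of_nonneg
          (h.curveXDeriv_nonpos_of_height_le hg hσ hθ₀ hθ hle hneg)
          (sub_nonneg.2 (hdmono _ hθ₀ _ hθ hle))
      · rcases hor with h0 | h0
        · rcases le_or_gt 0 (curveXDeriv r p θ) with h1 | h1
          · exact mul_nonpos_of_nonneg_of_nonpos h1 (sub_nonpos.2 (hdmono _ hθ _ hθ₀ hle))
          · have hT1 := h.unitTangentX_eq hθ
            have hT2 := h.unitTangentX_eq hθ₀
            rw [h0, zero_div, mul_zero] at hT2
            have h3 := hSpos θ hθ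
            have h4 := hSpos θ₀ hθ₀
            rw [hSdef, excessPressure] at h3 h4
            have h5 := mul_neg_of_pos_of_neg hσ (div_neg_of_neg_of_pos h1 (h.speed_pos hθ))
            exfalso
            nlinarith
        · subst h0
          have h1 : curveY r θ = curveY r 0 :=
            le_antisymm hle (by rw [curveY_zero]; exact h.curveY_nonneg hθ)
          have h2 : d θ = d 0 := le_antisymm (hdmono _ hθ _ hθ₀ h1.le) (hdmono _ hθ₀ _ hθ h1.ge)
          rw [h2]; simp
    rcases le_or_gt 0 (curveXDeriv r p 0) with h0 | h0
    · have hneg : curveXDeriv r p c ≤ 0 := by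
        rw [h.curveXDeriv_eq_neg_speed hcI hyc]
        exact neg_nonpos.2 (h.speed_pos hcI).le
      obtain ⟨θ₀, hm, hz⟩ := intermediate_value_Icc' hcI.1
        (hx'.mono (Icc_subset_Icc_right hcI.2)) (show (0 : ℝ) ∈ Icc _ _ from ⟨hneg, h0⟩)
      have hm' : θ₀ ∈ Icc 0 Real.pi := ⟨hm.1, hm.2.trans hcI.2⟩
      exact ⟨θ₀, hm', key θ₀ hm' hz.le (Or.inl hz)⟩
    · have hm' : (0 : ℝ) ∈ Icc 0 Real.pi := left_mem_Icc.2 Real.pi_pos.le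
      exact ⟨0, hm', key 0 hm' h0.le (Or.inr rfl)⟩
  -- Replacing `d` by its threshold value bounds the weighted integral by `d θ₀` times the area
  -- integral, which is `-V / 2`.
  have hle : ∫ θ in (0 : ℝ)..Real.pi, curveY r θ * curveXDeriv r p θ * d θ
      ≤ ∫ θ in (0 : ℝ)..Real.pi, d θ₀ * (curveY r θ * curveXDeriv r p θ) := by
    refine intervalIntegral.integral_mono_on Real.pi_pos.le ?_ ?_ fun θ hθ => ?_
    · exact intervalIntegrable_arc_iff.2 (integrable_arc (by fun_prop))
    · exact intervalIntegrable_arc_iff.2 (integrable_arc (by fun_prop))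
    · nlinarith [mul_nonneg (h.curveY_nonneg hθ) (neg_nonneg.2 (hcmp θ hθ))]
  rw [intervalIntegral.integral_const_mul, h.integral_curveY_mul_curveXDeriv] at hle
  have hd0 : 0 < d θ₀ := by
    have := hSpos θ₀ hθ₀
    simp only [hd]; positivity
  have hV := volumeFunctional_pos h.cont₀ h.pos
  rw [heq]
  nlinarith

end IsCapillaryProfile

/-! ### Completing the square in the Jacobi form up to a zero of the solution. -/

lemma ae_mem_Ioo_of_mem_uIoc {e s : ℝ} (he : e ∈ Icc 0 Real.pi) (hs : s ∈ Icc 0 Real.pi) :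
    ∀ᵐ θ : ℝ, θ ∈ uIoc e s → θ ∈ Ioo 0 Real.pi := by
  have h0 : ∀ᵐ θ : ℝ, θ ≠ 0 := by simp [ae_iff, measure_singleton]
  have hπ : ∀ᵐ θ : ℝ, θ ≠ Real.pi := by simp [ae_iff, measure_singleton]
  filter_upwards [h0, hπ] with θ h1 h2 hm
  have hm' := uIcc_subset_Icc he hs (uIoc_subset_uIcc hm)
  exact ⟨lt_of_le_of_ne hm'.1 h1.symm, lt_of_le_of_ne hm'.2 h2⟩

lemma intervalIntegrable_of_arc {f : ℝ → ℝ} (hf : Integrable f arcMeasure) {e s : ℝ}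
    (he : e ∈ Icc 0 Real.pi) (hs : s ∈ Icc 0 Real.pi) : IntervalIntegrable f volume e s :=
  (intervalIntegrable_arc_iff.2 hf).mono_set (by rw [uIcc_zero_pi]; exact uIcc_subset_Icc he hs)

/-- The factor `d` carries the orientation of the interval, so the later estimates serve both sides
of the apex at once. -/
lemma sub_mul_integral_nonneg {f : ℝ → ℝ} {e s d : ℝ} (hd : 0 ≤ d * (s - e))
    (hf : ∀ θ ∈ uIcc e s, 0 ≤ f θ) : 0 ≤ d * ∫ θ in e..s, f θ := by
  rcases lt_trichotomy e s with h | h | h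
  · rw [uIcc_of_le h.le] at hf
    have : 0 ≤ d := nonneg_of_mul_nonneg_left hd (sub_pos.2 h)
    exact mul_nonneg this (intervalIntegral.integral_nonneg h.le hf)
  · subst h; simp
  · rw [uIcc_of_ge h.le] at hf
    rw [intervalIntegral.integral_symm, mul_neg, ← neg_mul]
    have : 0 ≤ -d := by
      by_contra! hc
      nlinarith
    exact mul_nonneg this (intervalIntegral.integral_nonneg h.le hf)

/-- The one-dimensional Hölder estimate for `H¹` functions, at a zero. -/
lemma IsH1.sq_le_of_eq_zero {w : ℝ → ℝ} (hw : IsH1 w) {c s : ℝ} (hc : c ∈ Icc 0 Real.pi)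
    (hs : s ∈ Icc 0 Real.pi) (hwc : w c = 0) :
    w s ^ 2 ≤ (s - c) * ∫ θ in c..s, deriv w θ ^ 2 := by
  rcases eq_or_ne s c with rfl | hne
  · simp [hwc]
  have hl : s - c ≠ 0 := sub_ne_zero.2 hne
  have i2 : IntervalIntegrable (fun θ => deriv w θ ^ 2) volume c s :=
    intervalIntegrable_of_arc hw.memLp_arc_deriv.integrable_sq hc hs
  have i1 : IntervalIntegrable (deriv w) volume c s :=
    intervalIntegrable_of_arc (hw.memLp_arc_deriv.integrable one_le_two) hc hs
  have hD : ∫ θ in c..s, deriv w θ = w s := by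
    rw [(hw.mono_absCont hc hs).integral_deriv_eq_sub, hwc, sub_zero]
  -- The mean slope: integrating `(w' - k)² ≥ 0` is Cauchy-Schwarz for `w'` against constants, valid
  -- in either orientation.
  set k := w s / (s - c) with hk
  have h1 : ∫ θ in c..s, (deriv w θ - k) ^ 2
      = (∫ θ in c..s, deriv w θ ^ 2) - 2 * k * w s + k ^ 2 * (s - c) := by
    have : ∀ θ, (deriv w θ - k) ^ 2 = deriv w θ ^ 2 - 2 * k * deriv w θ + k ^ 2 := fun θ => by ring
    simp only [this]
    rw [intervalIntegral.integral_add (i2.sub (i1.const_mul _)) intervalIntegrable_const,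
      intervalIntegral.integral_sub i2 (i1.const_mul _), intervalIntegral.integral_const_mul, hD]
    simp; ring
  have h2 : 0 ≤ (s - c) * ∫ θ in c..s, (deriv w θ - k) ^ 2 :=
    sub_mul_integral_nonneg (mul_self_nonneg _) fun _ _ => sq_nonneg _
  rw [h1] at h2
  have h3 : k * (s - c) = w s := div_mul_cancel₀ _ hl
  nlinarith

section SturmLiouville

variable {a b z z' w : ℝ → ℝ}

lemma integrable_jacobi (ha : ContinuousOn a (Icc 0 Real.pi)) (hb : ContinuousOn b (Icc 0 Real.pi))
    (hw : IsH1 w) : Integrable (fun θ => a θ * deriv w θ ^ 2 + b θ * w θ ^ 2) arcMeasure := by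
  have := hw.continuousOn
  exact (integrable_arc_mul ha hw.memLp_arc_deriv.integrable_sq).add
    (integrable_arc (by fun_prop))

/-- Jacobi's identity: completing the square with a nowhere vanishing solution `z` of the
Jacobi equation `(a z')' = b z`. -/
lemma jacobi_identity (ha : ContinuousOn a (Icc 0 Real.pi)) (hb : ContinuousOn b (Icc 0 Real.pi))
    (hz : HasDerivOn z z') (hz' : ContinuousOn z' (Icc 0 Real.pi))
    (hm : HasDerivOn (fun θ => a θ * z' θ) (fun θ => b θ * z θ)) (hw : IsH1 w) {e s : ℝ}
    (he : e ∈ Icc 0 Real.pi) (hs : s ∈ Icc 0 Real.pi) (hz0 : ∀ θ ∈ uIcc e s, z θ ≠ 0)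
    (hme : a e * z' e = 0) :
    IntervalIntegrable (fun θ => a θ * (deriv w θ - z' θ / z θ * w θ) ^ 2) volume e s ∧
    ∫ θ in e..s, a θ * (deriv w θ - z' θ / z θ * w θ) ^ 2
      = (∫ θ in e..s, (a θ * deriv w θ ^ 2 + b θ * w θ ^ 2)) - a s * z' s / z s * w s ^ 2 := by
  have hsub : uIcc e s ⊆ Icc 0 Real.pi := uIcc_subset_Icc he hs
  have hzc := hz.continuousOn.mono hsub
  have hz'c := hz'.mono hsub
  have hac := ha.mono hsub
  have hbc := hb.mono hsub
  have hK : AbsolutelyContinuousOnInterval (fun θ => a θ * z' θ / z θ) e s :=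
    absCont_of_hasDerivWithinAt (f' := fun θ => (b θ * z θ * z θ - a θ * z' θ * z' θ) / z θ ^ 2)
      (fun θ hθ => ((hm θ (hsub hθ)).mono hsub).fun_div ((hz θ (hsub hθ)).mono hsub) (hz0 θ hθ))
      (ContinuousOn.div (by fun_prop) (by fun_prop) fun θ hθ => pow_ne_zero 2 (hz0 θ hθ))
  have hwac := hw.mono_absCont he hs
  have hF := hK.fun_mul (hwac.fun_mul hwac)
  have hint := intervalIntegrable_of_arc (integrable_jacobi ha hb hw) he hs
  -- The identity `a (w' - (z'/z) w)² = a w'² + b w² - ((a z'/z) w²)'` follows from `(a z')' = b z`.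
  have hae : ∀ᵐ θ : ℝ, θ ∈ uIoc e s → a θ * (deriv w θ - z' θ / z θ * w θ) ^ 2
      = (a θ * deriv w θ ^ 2 + b θ * w θ ^ 2)
        - deriv (fun θ => a θ * z' θ / z θ * (w θ * w θ)) θ := by
    filter_upwards [ae_mem_Ioo_of_mem_uIoc he hs, hwac.ae_differentiableAt] with θ h1 h2 hθ
    have hθ' := uIoc_subset_uIcc hθ
    have hwd := (h2 hθ').hasDerivAt
    have hz1 := hz0 θ hθ'
    rw [(((hm.hasDerivAt (h1 hθ)).fun_div (hz.hasDerivAt (h1 hθ)) hz1).fun_mul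
      (hwd.fun_mul hwd)).deriv]
    field_simp
    ring
  constructor
  · refine (hint.sub hF.intervalIntegrable_deriv).congr_ae ?_
    rw [EventuallyEq, ae_restrict_iff' measurableSet_uIoc]
    filter_upwards [hae] with θ hθ hm using (hθ hm).symm
  · rw [intervalIntegral.integral_congr_ae hae,
      intervalIntegral.integral_sub hint hF.intervalIntegrable_deriv, hF.integral_deriv_eq_sub,
      hme]
    ring

/-- Equality in Jacobi's identity forces `w` to be a multiple of `z`. -/
lemma eq_mul_of_jacobi_integral_eq_zero
    (hapos : ∀ θ ∈ Icc 0 Real.pi, 0 < a θ) (hz : HasDerivOn z z')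
    (hz' : ContinuousOn z' (Icc 0 Real.pi)) (hw : IsH1 w) {e s : ℝ}
    (he : e ∈ Icc 0 Real.pi) (hs : s ∈ Icc 0 Real.pi) (hz0 : ∀ θ ∈ uIcc e s, z θ ≠ 0)
    (hint : IntervalIntegrable (fun θ => a θ * (deriv w θ - z' θ / z θ * w θ) ^ 2) volume e s)
    (h0 : ∫ θ in e..s, a θ * (deriv w θ - z' θ / z θ * w θ) ^ 2 = 0) :
    w s * z e = w e * z s := by
  have hsub : uIcc e s ⊆ Icc 0 Real.pi := uIcc_subset_Icc he hs
  have hzc := hz.continuousOn.mono hsub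
  have hz'c := hz'.mono hsub
  have hae : ∀ᵐ θ : ℝ, θ ∈ uIoc e s → a θ * (deriv w θ - z' θ / z θ * w θ) ^ 2 = 0 := by
    have hmeas : MeasurableSet (Ioc e s ∪ Ioc s e) := measurableSet_Ioc.union measurableSet_Ioc
    have hmem : ∀ θ, θ ∈ Ioc e s ∪ Ioc s e ↔ θ ∈ uIoc e s := fun θ => by
      rw [mem_uIoc]; rfl
    have := (intervalIntegral.integral_eq_zero_iff_of_nonneg_ae (μ := volume) (by
      rw [EventuallyLE, ae_restrict_iff' hmeas]
      refine Eventually.of_forall fun θ hθ => ?_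
      have := (hapos θ (hsub (uIoc_subset_uIcc ((hmem θ).1 hθ)))).le
      exact mul_nonneg this (sq_nonneg _)) hint).1 h0
    rw [EventuallyEq, ae_restrict_iff' hmeas] at this
    filter_upwards [this] with θ hθ hm using hθ ((hmem θ).2 hm)
  have hinv : AbsolutelyContinuousOnInterval (fun θ => (z θ)⁻¹) e s :=
    absCont_of_hasDerivWithinAt (f' := fun θ => -z' θ / z θ ^ 2)
      (fun θ hθ => ((hz θ (hsub hθ)).mono hsub).fun_inv (hz0 θ hθ))
      (ContinuousOn.div (by fun_prop) (by fun_prop) fun θ hθ => pow_ne_zero 2 (hz0 θ hθ))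
  have hwac := hw.mono_absCont he hs
  have h1 := (hwac.fun_mul hinv).integral_deriv_eq_sub
  -- The vanishing square says `w' = (z'/z) w`, so the absolutely continuous quotient `w / z` has
  -- zero derivative almost everywhere.
  have h2 : ∫ θ in e..s, deriv (fun θ => w θ * (z θ)⁻¹) θ = ∫ θ in e..s, (0 : ℝ) := by
    refine intervalIntegral.integral_congr_ae ?_
    filter_upwards [hae, ae_mem_Ioo_of_mem_uIoc he hs, hwac.ae_differentiableAt] with θ h3 h4 h5 hθ
    have hθ' := uIoc_subset_uIcc hθ
    have hz1 := hz0 θ hθ'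
    rw [((h5 hθ').hasDerivAt.fun_mul ((hz.hasDerivAt (h4 hθ)).fun_inv hz1)).deriv]
    have h6 : deriv w θ - z' θ / z θ * w θ = 0 :=
      pow_eq_zero_iff two_ne_zero |>.1 ((mul_eq_zero.1 (h3 hθ)).resolve_left
        (hapos θ (hsub hθ')).ne')
    have h7 : deriv w θ = z' θ / z θ * w θ := by linarith
    rw [h7]
    field_simp
    ring
  rw [h2] at h1
  simp only [intervalIntegral.integral_zero] at h1
  have hzs := hz0 s right_mem_uIcc
  have hze := hz0 e left_mem_uIcc
  have h3 : w s * (z s)⁻¹ = w e * (z e)⁻¹ := by linarith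
  field_simp at h3
  linarith

/-- The boundary term in Jacobi's identity vanishes at a common zero of `z` and `w`. -/
lemma tendsto_jacobi_boundary (ha : ContinuousOn a (Icc 0 Real.pi)) (hz : HasDerivOn z z')
    (hz' : ContinuousOn z' (Icc 0 Real.pi)) (hw : IsH1 w) {c : ℝ} (hc : c ∈ Icc 0 Real.pi)
    (hzc : z c = 0) (hz'c : z' c ≠ 0) (hwc : w c = 0) :
    Tendsto (fun s => a s * z' s / z s * w s ^ 2) (𝓝[Icc 0 Real.pi \ {c}] c) (𝓝 0) := by
  have hle : 𝓝[Icc 0 Real.pi \ {c}] c ≤ 𝓝[Icc 0 Real.pi] c := nhdsWithin_mono _ sdiff_subset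
  have h1 : Tendsto (fun s => a s * z' s) (𝓝[Icc 0 Real.pi \ {c}] c) (𝓝 (a c * z' c)) :=
    ((ha.mul hz') c hc).mono_left hle
  have h2 : Tendsto (fun s => z s / (s - c)) (𝓝[Icc 0 Real.pi \ {c}] c) (𝓝 (z' c)) := by
    refine (hasDerivWithinAt_iff_tendsto_slope.1 (hz c hc)).congr fun s => ?_
    rw [slope_def_field, hzc, sub_zero]
  have i2 : IntervalIntegrable (fun θ => deriv w θ ^ 2) volume 0 Real.pi :=
    intervalIntegrable_arc_iff.2 hw.memLp_arc_deriv.integrable_sq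
  have h3 : Tendsto (fun s => ∫ θ in c..s, deriv w θ ^ 2) (𝓝[Icc 0 Real.pi \ {c}] c) (𝓝 0) := by
    have := intervalIntegral.continuousOn_primitive_interval' i2 (a := c) (by rwa [uIcc_zero_pi])
    rw [uIcc_zero_pi] at this
    have h4 : Tendsto _ _ _ := this c hc
    beta_reduce at h4
    rw [intervalIntegral.integral_same] at h4
    exact h4.mono_left hle
  -- The Hölder estimate bounds this quotient by the integral of `w'²` between `c` and `s`.
  -- Meanwhile `z` vanishes only linearly at `c`, as `z'(c) ≠ 0`.
  have h4 : Tendsto (fun s => w s ^ 2 / (s - c)) (𝓝[Icc 0 Real.pi \ {c}] c) (𝓝 0) := by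
    refine squeeze_zero_norm' ?_ (by simpa using h3.norm)
    filter_upwards [self_mem_nhdsWithin] with s hs
    have hne : s - c ≠ 0 := sub_ne_zero.2 hs.2
    have h5 := hw.sq_le_of_eq_zero hc hs.1 hwc
    rw [norm_div, norm_pow, Real.norm_eq_abs, Real.norm_eq_abs, sq_abs,
      div_le_iff₀ (abs_pos.2 hne), mul_comm, ← abs_mul]
    exact h5.trans (le_abs_self _)
  have h5 := h1.mul (h4.div h2 hz'c)
  rw [zero_div, mul_zero] at h5
  refine h5.congr' ?_
  filter_upwards [self_mem_nhdsWithin] with s hs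
  have hne : s - c ≠ 0 := sub_ne_zero.2 hs.2
  simp only [Pi.div_apply]
  rw [div_div_div_cancel_right₀ hne]
  ring

/-- On an interval that ends at the zero `c` of the solution `z`, and whose other end point `e`
carries the natural boundary condition, the Jacobi form of a function vanishing at `c` is
nonnegative, and it vanishes only on multiples of `z`. -/
lemma half_jacobi (ha : ContinuousOn a (Icc 0 Real.pi))
    (hapos : ∀ θ ∈ Icc 0 Real.pi, 0 < a θ) (hb : ContinuousOn b (Icc 0 Real.pi))
    (hz : HasDerivOn z z') (hz' : ContinuousOn z' (Icc 0 Real.pi))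
    (hm : HasDerivOn (fun θ => a θ * z' θ) (fun θ => b θ * z θ)) (hw : IsH1 w) {e c : ℝ}
    (he : e ∈ Icc 0 Real.pi) (hc : c ∈ Icc 0 Real.pi) (hec : e ≠ c) (hme : a e * z' e = 0)
    (hz0 : ∀ θ ∈ uIcc e c, θ ≠ c → z θ ≠ 0) (hzc : z c = 0) (hz'c : z' c ≠ 0) (hwc : w c = 0) :
    0 ≤ (c - e) * ∫ θ in e..c, (a θ * deriv w θ ^ 2 + b θ * w θ ^ 2) ∧
    (∫ θ in e..c, (a θ * deriv w θ ^ 2 + b θ * w θ ^ 2) = 0 →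
      ∀ s ∈ uIcc e c, w s * z e = w e * z s) := by
  set k : ℝ → ℝ := fun θ => a θ * deriv w θ ^ 2 + b θ * w θ ^ 2 with hk
  set f : ℝ → ℝ := fun θ => a θ * (deriv w θ - z' θ / z θ * w θ) ^ 2 with hf
  set G : ℝ → ℝ := fun s => ∫ θ in e..s, f θ with hG
  have hsubI : uIcc e c ⊆ Icc 0 Real.pi := uIcc_subset_Icc he hc
  have hf0 : ∀ θ ∈ Icc 0 Real.pi, 0 ≤ f θ := fun θ hθ =>
    mul_nonneg (hapos θ hθ).le (sq_nonneg _)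
  have hkint : IntervalIntegrable k volume 0 Real.pi :=
    intervalIntegrable_arc_iff.2 (integrable_jacobi ha hb hw)
  have hzs : ∀ s ∈ uIoo e c, ∀ θ ∈ uIcc e s, z θ ≠ 0 := fun s hs θ hθ => by
    have hs' := uIoo_subset_uIcc_self hs
    refine hz0 θ (uIcc_subset_uIcc_left hs' hθ) fun h => ?_
    subst h
    rcases lt_or_gt_of_ne hec with h1 | h1
    · rw [uIoo_of_lt h1] at hs
      rw [uIcc_of_le hs.1.le] at hθ
      exact absurd hθ.2 (not_le.2 hs.2)
    · rw [uIoo_of_gt h1] at hs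
      rw [uIcc_of_ge hs.2.le] at hθ
      exact absurd hθ.1 (not_le.2 hs.1)
  have hid : ∀ s ∈ uIoo e c, IntervalIntegrable f volume e s ∧
      G s = (∫ θ in e..s, k θ) - a s * z' s / z s * w s ^ 2 := fun s hs =>
    jacobi_identity ha hb hz hz' hm hw he (hsubI (uIoo_subset_uIcc_self hs)) (hzs s hs) hme
  have hne : (𝓝[uIoo e c] c).NeBot := by
    rw [← mem_closure_iff_nhdsWithin_neBot, closure_uIoo hec]
    exact right_mem_uIcc
  have hleI : uIoo e c ⊆ Icc 0 Real.pi \ {c} := fun s hs => by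
    refine ⟨hsubI (uIoo_subset_uIcc_self hs), fun h => ?_⟩
    rw [mem_singleton_iff] at h
    subst h
    simp [uIoo] at hs
    exact lt_asymm hs.1 hs.2
  -- The square is integrated only up to `s` short of `c`, where `z` has no zero; the boundary term
  -- disappears as `s` tends to `c`.
  have hlim : Tendsto G (𝓝[uIoo e c] c) (𝓝 (∫ θ in e..c, k θ)) := by
    have h1 : Tendsto (fun s => ∫ θ in e..s, k θ) (𝓝[uIoo e c] c) (𝓝 (∫ θ in e..c, k θ)) := by
      have := intervalIntegral.continuousOn_primitive_interval' hkint (a := e)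
        (by rwa [uIcc_zero_pi])
      rw [uIcc_zero_pi] at this
      exact (this c hc).mono_left (nhdsWithin_mono _ (hleI.trans sdiff_subset))
    have h2 := (tendsto_jacobi_boundary ha hz hz' hw hc hzc hz'c hwc).mono_left
      (nhdsWithin_mono _ hleI)
    have h3 := h1.sub h2
    rw [sub_zero] at h3
    refine h3.congr' ?_
    filter_upwards [self_mem_nhdsWithin] with s hs using (hid s hs).2.symm
  have hside : ∀ s ∈ uIoo e c, 0 ≤ (c - e) * (s - e) := fun s hs => by
    rcases lt_or_gt_of_ne hec with h1 | h1
    · rw [uIoo_of_lt h1] at hs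
      exact mul_nonneg (sub_pos.2 h1).le (sub_pos.2 hs.1).le
    · rw [uIoo_of_gt h1] at hs
      exact mul_nonneg_of_nonpos_of_nonpos (sub_neg.2 h1).le (sub_neg.2 hs.2).le
  have hGpos : ∀ s ∈ uIoo e c, 0 ≤ (c - e) * G s := fun s hs =>
    sub_mul_integral_nonneg (hside s hs) fun θ hθ => hf0 θ
      (uIcc_subset_Icc he (hsubI (uIoo_subset_uIcc_self hs)) hθ)
  refine ⟨ge_of_tendsto (hlim.const_mul (c - e)) ?_, fun h0 s₀ hs₀ => ?_⟩
  · filter_upwards [self_mem_nhdsWithin] with s hs using hGpos s hs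
  · rcases eq_or_ne s₀ e with rfl | hse
    · ring
    rcases eq_or_ne s₀ c with rfl | hsc
    · rw [hwc, hzc]; ring
    have hs₀' : s₀ ∈ uIoo e c := by
      rcases lt_or_gt_of_ne hec with h1 | h1
      · rw [uIcc_of_le h1.le] at hs₀
        rw [uIoo_of_lt h1]
        exact ⟨lt_of_le_of_ne hs₀.1 hse.symm, lt_of_le_of_ne hs₀.2 hsc⟩
      · rw [uIcc_of_ge h1.le] at hs₀
        rw [uIoo_of_gt h1]
        exact ⟨lt_of_le_of_ne hs₀.1 hsc.symm, lt_of_le_of_ne hs₀.2 hse⟩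
    -- The oriented integral `(c - e) * G` is nonnegative and grows towards `c`. Since its limit is
    -- zero, it vanishes at every `s₀`; the condition on distances places `s₀` between `e` and `s`.
    have hmono : ∀ᶠ s in 𝓝[uIoo e c] c, (c - e) * G s₀ ≤ (c - e) * G s := by
      have hball : ∀ᶠ s in 𝓝[uIoo e c] c, |s - c| < |s₀ - c| :=
        nhdsWithin_le_nhds (Metric.ball_mem_nhds c (abs_pos.2 (sub_ne_zero.2 hsc)))
      filter_upwards [self_mem_nhdsWithin, hball] with s hs hlt
      have h1 : G s - G s₀ = ∫ θ in s₀..s, f θ :=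
        intervalIntegral.integral_interval_sub_left (hid s hs).1 (hid s₀ hs₀').1
      have h2 : 0 ≤ (c - e) * ∫ θ in s₀..s, f θ := by
        refine sub_mul_integral_nonneg ?_ fun θ hθ => hf0 θ (uIcc_subset_Icc
          (hsubI (uIoo_subset_uIcc_self hs₀')) (hsubI (uIoo_subset_uIcc_self hs)) hθ)
        rcases lt_or_gt_of_ne hec with h1 | h1
        · rw [uIoo_of_lt h1] at hs hs₀'
          rw [abs_of_neg (sub_neg.2 hs.2), abs_of_neg (sub_neg.2 hs₀'.2)] at hlt
          exact mul_nonneg (sub_pos.2 h1).le (by linarith)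
        · rw [uIoo_of_gt h1] at hs hs₀'
          rw [abs_of_pos (sub_pos.2 hs.1), abs_of_pos (sub_pos.2 hs₀'.1)] at hlt
          exact mul_nonneg_of_nonpos_of_nonpos (sub_neg.2 h1).le (by linarith)
      rw [← h1] at h2
      linarith
    have h1 : (c - e) * G s₀ ≤ (c - e) * 0 := by
      rw [← h0]
      exact ge_of_tendsto (hlim.const_mul (c - e)) hmono
    have h2 : G s₀ = 0 := by
      have h3 : (c - e) * G s₀ = 0 := le_antisymm (by simpa using h1) (hGpos s₀ hs₀')
      exact (mul_eq_zero.1 h3).resolve_left (sub_ne_zero.2 hec.symm)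
    exact eq_mul_of_jacobi_integral_eq_zero hapos hz hz' hw he (hsubI hs₀) (hzs s₀ hs₀')
      (hid s₀ hs₀').1 h2

end SturmLiouville

/-! ### Polarization of the Jacobi form and testing of solutions. -/

/-- The bilinear form that belongs to `jacobiForm`. -/
def jacobiBilin (a b u v : ℝ → ℝ) : ℝ :=
  ∫ θ in (0 : ℝ)..Real.pi, (a θ * deriv v θ * deriv u θ + b θ * v θ * u θ)

section Expansion

variable {a b u v : ℝ → ℝ}

lemma integrable_jacobiBilin (ha : ContinuousOn a (Icc 0 Real.pi))
    (hb : ContinuousOn b (Icc 0 Real.pi)) (hu : IsH1 u) (hv : IsH1 v) :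
    Integrable (fun θ => a θ * deriv v θ * deriv u θ + b θ * v θ * u θ) arcMeasure := by
  have h1 := hu.continuousOn
  have h2 := hv.continuousOn
  have h3 : Integrable (fun θ => deriv v θ * deriv u θ) arcMeasure :=
    hv.memLp_arc_deriv.integrable_mul hu.memLp_arc_deriv
  refine Integrable.add ?_ (integrable_arc (by fun_prop))
  simpa only [mul_assoc] using integrable_arc_mul ha h3

lemma jacobiForm_add_mul (ha : ContinuousOn a (Icc 0 Real.pi))
    (hb : ContinuousOn b (Icc 0 Real.pi)) (hu : IsH1 u) (hv : IsH1 v) (t : ℝ) :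
    jacobiForm a b (fun θ => u θ + t * v θ)
      = jacobiForm a b u + 2 * t * jacobiBilin a b u v + t ^ 2 * jacobiForm a b v := by
  have i1 := intervalIntegrable_arc_iff.2 (integrable_jacobi ha hb hu)
  have i2 := (intervalIntegrable_arc_iff.2 (integrable_jacobiBilin ha hb hu hv)).const_mul (2 * t)
  have i3 := (intervalIntegrable_arc_iff.2 (integrable_jacobi ha hb hv)).const_mul (t ^ 2)
  rw [jacobiForm, jacobiForm, jacobiBilin, jacobiForm, ← intervalIntegral.integral_const_mul,
    ← intervalIntegral.integral_const_mul, ← intervalIntegral.integral_add i1 i2,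
    ← intervalIntegral.integral_add (i1.add i2) i3]
  refine integral_arc_congr ?_
  filter_upwards [hu.ae_differentiableAt, hv.ae_differentiableAt] with θ h1 h2
  rw [(h1.hasDerivAt.fun_add (h2.hasDerivAt.const_mul t)).deriv]
  ring

lemma jacobiBilin_self : jacobiBilin a b u u = jacobiForm a b u := by
  rw [jacobiBilin, jacobiForm]
  congr 1; ext θ; ring

lemma jacobiBilin_congr {v' : ℝ → ℝ} (he : ∀ θ ∈ Icc 0 Real.pi, v θ = v' θ) :
    jacobiBilin a b u v = jacobiBilin a b u v' := by
  refine integral_arc_congr ?_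
  filter_upwards [ae_arc_mem_Ioo] with θ hθ
  have : v =ᶠ[𝓝 θ] v' := by
    filter_upwards [Icc_mem_nhds hθ.1 hθ.2] with φ hφ using he φ hφ
  rw [this.deriv_eq, this.eq_of_nhds]

/-- Testing a solution of the (inhomogeneous) Jacobi equation with natural boundary conditions. -/
lemma jacobiBilin_eq_of_solution {v' f : ℝ → ℝ} (hb : ContinuousOn b (Icc 0 Real.pi))
    (hf : ContinuousOn f (Icc 0 Real.pi)) (hv : HasDerivOn v v')
    (hm : HasDerivOn (fun θ => a θ * v' θ) (fun θ => b θ * v θ + f θ)) (h0 : a 0 * v' 0 = 0)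
    (hπ : a Real.pi * v' Real.pi = 0) (ha : ContinuousOn a (Icc 0 Real.pi))
    (hv' : ContinuousOn v' (Icc 0 Real.pi)) (hu : IsH1 u) :
    jacobiBilin a b u v = -∫ θ in (0 : ℝ)..Real.pi, f θ * u θ := by
  have h1 := hv.continuousOn
  have h2 := hu.continuousOn
  have h3 := hu.integral_by_parts hm (by fun_prop)
  rw [h0, hπ, zero_mul, zero_mul, sub_zero] at h3
  rw [eq_neg_iff_add_eq_zero, jacobiBilin, ← intervalIntegral.integral_add
    (intervalIntegrable_arc_iff.2 (integrable_jacobiBilin ha hb hu (hv.isH1 hv')))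
    (intervalIntegrable_arc_iff.2 (integrable_arc (by fun_prop)))]
  refine (integral_arc_congr ?_).trans h3
  filter_upwards [ae_arc_mem_Ioo] with θ hθ
  rw [hv.deriv_eq hθ]
  ring

end Expansion

/-! ### Kernel of the second variation. -/

lemma SmoothProfile.xiS_eq_cos_add {r p q s : ℝ → ℝ} (h : SmoothProfile r p q s) {θ : ℝ}
    (hθ : θ ∈ Icc 0 Real.pi) : xiS r θ = Real.cos θ + p θ / r θ * Real.sin θ := by
  rw [xiS]
  rcases eq_or_lt_of_le hθ.1 with h0 | h0
  · simp [← h0]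
  rcases eq_or_lt_of_le hθ.2 with hπ | hπ
  · simp [hπ]
  rw [h.deriv₁.deriv_eq ⟨h0, hπ⟩]

namespace IsCapillaryProfile

variable {g σ γ μ : ℝ} {r p q s : ℝ → ℝ} (h : IsCapillaryProfile g σ γ μ r p q s)
include h

lemma shiftField_isH1 : IsH1 (shiftField r p) := h.deriv_shiftField.isH1 h.cont_shiftFieldDeriv

/-- Holds without the volume constraint: horizontal translation changes neither energy nor volume,
hence leaves the Lagrangian invariant. -/
lemma jacobiBilin_shiftField {u : ℝ → ℝ} (hu : IsH1 u) :
    jacobiBilin (jacobiLead σ r p) (jacobiPotential g μ r) u (shiftField r p) = 0 := by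
  have hm : HasDerivOn (fun θ => jacobiLead σ r p θ * shiftFieldDeriv r p q θ)
      (fun θ => jacobiPotential g μ r θ * shiftField r p θ + 0) := by
    simpa using h.deriv_lead_mul_shiftFieldDeriv
  rw [jacobiBilin_eq_of_solution (h.cont_jacobiPotential g μ) continuousOn_const
    h.deriv_shiftField hm ?_ ?_ (h.cont_jacobiLead σ) h.cont_shiftFieldDeriv hu]
  · simp
  · simp [h.lead_mul_shiftFieldDeriv (left_mem_Icc.2 Real.pi_pos.le)]
  · simp [h.lead_mul_shiftFieldDeriv (right_mem_Icc.2 Real.pi_pos.le)]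

/-- The pressure field represents the constraint: it is orthogonal to every volume-preserving `u`,
and on itself the form is minus its volume integral. -/
lemma jacobiBilin_pressureField (hg : 0 < g) (hσ : 0 < σ) {c : ℝ} (hc : c ∈ Icc 0 Real.pi)
    {u : ℝ → ℝ} (hu : IsH1 u) :
    jacobiBilin (jacobiLead σ r p) (jacobiPotential g μ r) u (pressureField g μ r p c)
      = -∫ θ in (0 : ℝ)..Real.pi, r θ ^ 2 * u θ := by
  refine jacobiBilin_eq_of_solution (h.cont_jacobiPotential g μ) (h.cont₀.pow 2)
    (h.deriv_pressureField hg hσ hc) (h.deriv_lead_mul_pressureFieldDeriv hg hσ hc) ?_ ?_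
    (h.cont_jacobiLead σ) (h.cont_pressureFieldDeriv hg hσ hc) hu
  · simp [h.lead_mul_pressureFieldDeriv hg hσ (left_mem_Icc.2 Real.pi_pos.le)]
  · simp [h.lead_mul_pressureFieldDeriv hg hσ (right_mem_Icc.2 Real.pi_pos.le)]

lemma integral_curveYDeriv {α β : ℝ} (hα : α ∈ Icc 0 Real.pi) (hβ : β ∈ Icc 0 Real.pi)
    (hle : α ≤ β) : ∫ θ in α..β, curveYDeriv r p θ = curveY r β - curveY r α := by
  have hsub : Icc α β ⊆ Icc 0 Real.pi := Icc_subset_Icc hα.1 hβ.2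
  refine intervalIntegral.integral_eq_sub_of_hasDerivAt_of_le hle (h.cont_curveY.mono hsub)
    (fun θ hθ => h.deriv_curveY.hasDerivAt ⟨hα.1.trans_lt hθ.1, hθ.2.trans_le hβ.2⟩) ?_
  exact (h.cont_curveYDeriv.mono (by rw [uIcc_of_le hle]; exact hsub)).intervalIntegrable

/-- The Jacobi form is nonnegative under the linearized volume constraint, and its null vectors are
the multiples of the horizontal Jacobi field. -/
theorem jacobiForm_nonneg_and_null (hg : 0 < g) (hσ : 0 < σ) {u : ℝ → ℝ} (hu : IsH1 u)
    (hvol : ∫ θ in (0 : ℝ)..Real.pi, r θ ^ 2 * u θ = 0) :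
    0 ≤ jacobiForm (jacobiLead σ r p) (jacobiPotential g μ r) u ∧
    (jacobiForm (jacobiLead σ r p) (jacobiPotential g μ r) u = 0 →
      ∃ C, ∀ θ ∈ Icc 0 Real.pi, u θ = C * shiftField r p θ) := by
  obtain ⟨c, hc, hyc⟩ := h.exists_apex
  have hcI := Ioo_subset_Icc_self hc
  have hπI : Real.pi ∈ Icc 0 Real.pi := right_mem_Icc.2 Real.pi_pos.le
  have h0I : (0 : ℝ) ∈ Icc 0 Real.pi := left_mem_Icc.2 Real.pi_pos.le
  have ha := h.cont_jacobiLead σ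
  have hb := h.cont_jacobiPotential g μ
  have hηc := h.pressureField_apex_pos hg hσ hc hyc
  have hN := h.integral_pressureField_pos hg hσ hc hyc
  have hηH : IsH1 (pressureField g μ r p c) :=
    (h.deriv_pressureField hg hσ hcI).isH1 (h.cont_pressureFieldDeriv hg hσ hcI)
  set a := jacobiLead σ r p
  set b := jacobiPotential g μ r
  set η := pressureField g μ r p c
  set z := shiftField r p
  set N := ∫ θ in (0 : ℝ)..Real.pi, r θ ^ 2 * η θ
  -- Chosen so that `w = u + t η` vanishes at the apex; the cross term of `Q(w)` is zero by the
  -- volume constraint.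
  set t := -(u c / η c) with ht
  set w : ℝ → ℝ := fun θ => u θ + t * η θ with hw
  have hwH : IsH1 w := hu.add (hηH.const_mul t)
  have hwc : w c = 0 := by simp only [hw, ht]; field_simp; ring
  have hQw : jacobiForm a b w = jacobiForm a b u - t ^ 2 * N := by
    rw [jacobiForm_add_mul ha hb hu hηH, ← jacobiBilin_self (u := η),
      h.jacobiBilin_pressureField hg hσ hcI hu, h.jacobiBilin_pressureField hg hσ hcI hηH, hvol]
    ring
  have hzc : z c = 0 := by simp only [z, shiftField, hyc, zero_div]
  have hz'c := (h.shiftFieldDeriv_neg hg hσ hc).ne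
  have hz0 : ∀ θ ∈ Icc 0 Real.pi, θ ≠ c → z θ ≠ 0 := fun θ hθ hne hz =>
    hne ((h.shiftField_strictAntiOn hg hσ).injOn hθ hcI (hz.trans hzc.symm))
  have hhalf : ∀ e ∈ Icc 0 Real.pi, e ≠ c → a e * shiftFieldDeriv r p q e = 0 → _ :=
    fun e he hne hme => half_jacobi ha (fun θ hθ => h.lead_pos hσ hθ) hb h.deriv_shiftField
      h.cont_shiftFieldDeriv h.deriv_lead_mul_shiftFieldDeriv hwH he hcI hne hme
      (fun θ hθ => hz0 θ (uIcc_subset_Icc he hcI hθ)) hzc hz'c hwc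
  obtain ⟨l1, l2⟩ := hhalf 0 h0I hc.1.ne (by
    simp [a, h.lead_mul_shiftFieldDeriv h0I])
  obtain ⟨r1, r2⟩ := hhalf Real.pi hπI hc.2.ne' (by
    simp [a, h.lead_mul_shiftFieldDeriv hπI])
  have hint := integrable_jacobi ha hb hwH
  -- The right half is integrated from `π` towards `c`, matching `half_jacobi`, which starts at the
  -- natural end point; hence the minus sign.
  have hsplit : jacobiForm a b w = (∫ θ in (0 : ℝ)..c, (a θ * deriv w θ ^ 2 + b θ * w θ ^ 2))
      - ∫ θ in Real.pi..c, (a θ * deriv w θ ^ 2 + b θ * w θ ^ 2) := by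
    rw [jacobiForm, intervalIntegral.integral_symm c Real.pi, sub_neg_eq_add]
    exact (intervalIntegral.integral_add_adjacent_intervals (intervalIntegrable_of_arc hint h0I hcI)
      (intervalIntegrable_of_arc hint hcI hπI)).symm
  set A := ∫ θ in (0 : ℝ)..c, (a θ * deriv w θ ^ 2 + b θ * w θ ^ 2)
  set B := ∫ θ in Real.pi..c, (a θ * deriv w θ ^ 2 + b θ * w θ ^ 2)
  have hA : 0 ≤ A := by
    rw [sub_zero] at l1; exact nonneg_of_mul_nonneg_right l1 hc.1
  have hB : B ≤ 0 := by
    by_contra! hlt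
    nlinarith [mul_pos (sub_pos.2 hc.2) hlt]
  have htN : 0 ≤ t ^ 2 * N := mul_nonneg (sq_nonneg t) hN.le
  refine ⟨by linarith, fun hzero => ?_⟩
  have hA0 : A = 0 := by linarith
  have hB0 : B = 0 := by linarith
  have ht0 : t = 0 := by
    have : t ^ 2 * N = 0 := by linarith
    exact pow_eq_zero_iff two_ne_zero |>.1 ((mul_eq_zero.1 this).resolve_right hN.ne')
  have hwu : w = u := by ext θ; simp [hw, ht0]
  rw [hwu, uIcc_of_le hcI.1] at l2
  rw [hwu, uIcc_of_ge hcI.2] at r2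
  have hz00 := hz0 0 h0I hc.1.ne
  have hzπ := hz0 Real.pi hπI hc.2.ne'
  have hl : ∀ θ ∈ Icc 0 c, u θ = u 0 / z 0 * z θ := fun θ hθ => by
    rw [div_mul_eq_mul_div, eq_div_iff hz00]; exact l2 hA0 θ hθ
  have hr : ∀ θ ∈ Icc c Real.pi, u θ = u Real.pi / z Real.pi * z θ := fun θ hθ => by
    rw [div_mul_eq_mul_div, eq_div_iff hzπ]; exact r2 hB0 θ hθ
  set C₁ := u 0 / z 0
  set C₂ := u Real.pi / z Real.pi
  have hrz : ∀ θ ∈ Icc 0 Real.pi, r θ ^ 2 * z θ = curveYDeriv r p θ := fun θ hθ => by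
    have := (h.pos θ hθ).ne'
    simp only [z, shiftField]
    field_simp
  have hru : Integrable (fun θ => r θ ^ 2 * u θ) arcMeasure := by
    have h1 := h.cont₀
    have h2 := hu.continuousOn
    exact integrable_arc (by fun_prop)
  have e1 : ∫ θ in (0 : ℝ)..c, r θ ^ 2 * u θ = C₁ * curveY r c := by
    have h1 : ∫ θ in (0 : ℝ)..c, r θ ^ 2 * u θ = ∫ θ in (0 : ℝ)..c, C₁ * curveYDeriv r p θ := by
      refine intervalIntegral.integral_congr fun θ hθ => ?_
      rw [uIcc_of_le hcI.1] at hθ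
      rw [← hrz θ ⟨hθ.1, hθ.2.trans hcI.2⟩, hl θ hθ]
      ring
    rw [h1, intervalIntegral.integral_const_mul, h.integral_curveYDeriv h0I hcI hcI.1,
      curveY_zero, sub_zero]
  have e2 : ∫ θ in c..Real.pi, r θ ^ 2 * u θ = -(C₂ * curveY r c) := by
    have h1 : ∫ θ in c..Real.pi, r θ ^ 2 * u θ
        = ∫ θ in c..Real.pi, C₂ * curveYDeriv r p θ := by
      refine intervalIntegral.integral_congr fun θ hθ => ?_
      rw [uIcc_of_le hcI.2] at hθ
      rw [← hrz θ ⟨hcI.1.trans hθ.1, hθ.2⟩, hr θ hθ]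
      ring
    rw [h1, intervalIntegral.integral_const_mul, h.integral_curveYDeriv hcI hπI hcI.2,
      curveY_pi]
    ring
  -- Vanishing at `c` alone allows different multiples on the two sides. The halves contribute `C₁
  -- y(c)` and `-C₂ y(c)` to the volume, with `y(c) > 0`.
  have hCC : C₁ = C₂ := by
    rw [← intervalIntegral.integral_add_adjacent_intervals (intervalIntegrable_of_arc hru h0I hcI)
      (intervalIntegrable_of_arc hru hcI hπI), e1, e2] at hvol
    have h1 := (h.curveY_pos hc).ne'
    have h2 : (C₁ - C₂) * curveY r c = 0 := by linarith
    exact sub_eq_zero.1 ((mul_eq_zero.1 h2).resolve_right h1)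
  refine ⟨C₁, fun θ hθ => ?_⟩
  rcases le_total θ c with hle | hle
  · exact hl θ ⟨hθ.1, hle⟩
  · rw [hCC]; exact hr θ ⟨hle, hθ.2⟩

lemma xiS_eq {θ : ℝ} (hθ : θ ∈ Icc 0 Real.pi) : xiS r θ = r θ * shiftField r p θ := by
  have hr := (h.pos θ hθ).ne'
  rw [h.xiS_eq_cos_add hθ, shiftField, curveYDeriv]
  field_simp
  ring

/-- The constraint integrand `ξ_s r` is `y'`, and `y` vanishes at both ends. -/
lemma xiS_isAdmissible : IsAdmissible r (xiS r) := by
  refine ⟨((h.deriv₁.isH1 h.cont₁).mul h.shiftField_isH1).congr fun θ hθ => h.xiS_eq hθ, ?_⟩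
  rw [integral_arc_congr (g := curveYDeriv r p)]
  · rw [h.integral_curveYDeriv (left_mem_Icc.2 Real.pi_pos.le) (right_mem_Icc.2 Real.pi_pos.le)
      Real.pi_pos.le]
    simp
  · filter_upwards [ae_arc_mem_Ioo] with θ hθ
    have hI := Ioo_subset_Icc_self hθ
    have := (h.pos θ hI).ne'
    rw [h.xiS_eq hI, shiftField]
    field_simp

lemma integral_sq_mul_div {ξ : ℝ → ℝ} (hξ : IsAdmissible r ξ) :
    ∫ θ in (0 : ℝ)..Real.pi, r θ ^ 2 * (ξ θ * (r θ)⁻¹) = 0 := by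
  refine (integral_arc_congr ?_).trans hξ.orthogonal
  filter_upwards [ae_arc_mem_Ioo] with θ hθ
  have := (h.pos θ (Ioo_subset_Icc_self hθ)).ne'
  field_simp

lemma div_eq_mul_shiftField {ξ : ℝ → ℝ} {C : ℝ}
    (he : ∀ θ ∈ Icc 0 Real.pi, ξ θ = C * xiS r θ) {θ : ℝ} (hθ : θ ∈ Icc 0 Real.pi) :
    ξ θ * (r θ)⁻¹ = C * shiftField r p θ := by
  have := (h.pos θ hθ).ne'
  rw [he θ hθ, h.xiS_eq hθ]
  field_simp

/-- Multiples of `ξ_s` lie in the kernel of the second variation. -/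
lemma jacobiBilin_mul_xiS {ξ u : ℝ → ℝ} {C : ℝ} (he : ∀ θ ∈ Icc 0 Real.pi, ξ θ = C * xiS r θ)
    (hu : IsH1 u) : jacobiBilin (jacobiLead σ r p) (jacobiPotential g μ r) u
      (fun θ => ξ θ * (r θ)⁻¹) = 0 := by
  rw [jacobiBilin_congr (fun θ hθ => h.div_eq_mul_shiftField he hθ)]
  have h1 : jacobiBilin (jacobiLead σ r p) (jacobiPotential g μ r) u
      (fun θ => C * shiftField r p θ)
      = C * jacobiBilin (jacobiLead σ r p) (jacobiPotential g μ r) u (shiftField r p) := by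
    rw [jacobiBilin, jacobiBilin, ← intervalIntegral.integral_const_mul]
    congr 1; ext θ
    rw [deriv_const_mul_field]
    ring
  rw [h1, h.jacobiBilin_shiftField hu, mul_zero]

/-- The null vectors of the second variation are the multiples of `ξ_s`. -/
theorem secondVariation_eq_zero_iff (hg : 0 < g) (hσ : 0 < σ) {ξ : ℝ → ℝ}
    (hξ : IsAdmissible r ξ) : secondVariation g σ γ r ξ = 0 ↔
      ∃ C : ℝ, ∀ θ ∈ Icc 0 Real.pi, ξ θ = C * xiS r θ := by
  rw [h.secondVariation_eq hξ]
  constructor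
  · intro h0
    obtain ⟨C, hC⟩ := (h.jacobiForm_nonneg_and_null hg hσ (h.isH1_div hξ.isH1)
      (h.integral_sq_mul_div hξ)).2 h0
    refine ⟨C, fun θ hθ => ?_⟩
    have hr := (h.pos θ hθ).ne'
    have h1 := hC θ hθ
    rw [← div_eq_mul_inv, div_eq_iff hr] at h1
    rw [h1, h.xiS_eq hθ]
    ring
  · rintro ⟨C, hC⟩
    rw [← jacobiBilin_self]
    exact h.jacobiBilin_mul_xiS hC (h.isH1_div hξ.isH1)

lemma secondVariationBilin_eq {ξ η : ℝ → ℝ} (hξ : IsAdmissible r ξ) (hη : IsAdmissible r η) :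
    secondVariationBilin g σ γ r ξ η
      = jacobiBilin (jacobiLead σ r p) (jacobiPotential g μ r)
          (fun θ => η θ * (r θ)⁻¹) (fun θ => ξ θ * (r θ)⁻¹) := by
  have hadd : IsAdmissible r (fun θ => ξ θ + η θ) := by
    refine ⟨hξ.isH1.add hη.isH1, ?_⟩
    have h0 := h.cont₀
    have h1 := hξ.isH1.continuousOn
    have h2 := hη.isH1.continuousOn
    have : ∫ θ in (0 : ℝ)..Real.pi, (ξ θ + η θ) * r θ
        = (∫ θ in (0 : ℝ)..Real.pi, ξ θ * r θ) + ∫ θ in (0 : ℝ)..Real.pi, η θ * r θ := by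
      rw [← intervalIntegral.integral_add]
      · congr 1; ext θ; ring
      all_goals refine intervalIntegrable_arc_iff.2 (integrable_arc ?_); fun_prop
    rw [this, hξ.orthogonal, hη.orthogonal, add_zero]
  have e : (fun θ => (ξ θ + η θ) * (r θ)⁻¹)
      = fun θ => η θ * (r θ)⁻¹ + 1 * (ξ θ * (r θ)⁻¹) := by ext θ; ring
  rw [secondVariationBilin, h.secondVariation_eq hadd, h.secondVariation_eq hξ,
    h.secondVariation_eq hη, e, jacobiForm_add_mul (h.cont_jacobiLead σ)
    (h.cont_jacobiPotential g μ) (h.isH1_div hη.isH1) (h.isH1_div hξ.isH1)]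
  ring

/-- The kernel of the bilinear form consists of the multiples of `ξ_s`. -/
theorem secondVariationBilin_eq_zero_iff (hg : 0 < g) (hσ : 0 < σ) {ξ : ℝ → ℝ}
    (hξ : IsAdmissible r ξ) :
    (∀ η : ℝ → ℝ, IsAdmissible r η → secondVariationBilin g σ γ r ξ η = 0) ↔
      ∃ C : ℝ, ∀ θ ∈ Icc 0 Real.pi, ξ θ = C * xiS r θ := by
  constructor
  · intro h0
    rw [← h.secondVariation_eq_zero_iff hg hσ hξ, h.secondVariation_eq hξ, ← jacobiBilin_self,
      ← h.secondVariationBilin_eq hξ hξ]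
    exact h0 ξ hξ
  · rintro ⟨C, hC⟩ η hη
    rw [h.secondVariationBilin_eq hξ hη]
    exact h.jacobiBilin_mul_xiS hC (h.isH1_div hη.isH1)

/-- Every multiple of `ξ_s` is the restriction of an admissible perturbation. -/
lemma const_mul_xiS_isAdmissible (C : ℝ) : IsAdmissible r (fun θ => C * xiS r θ) := by
  have := h.xiS_isAdmissible
  refine ⟨this.isH1.const_mul C, ?_⟩
  simp only [mul_assoc]
  rw [intervalIntegral.integral_const_mul, this.orthogonal, mul_zero]

/-- A subspace of `D` cut out by being a multiple of `ξ_s` restricts to the span of `ξ_s`. -/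
lemma image_domRestrict_eq_span {P : (ℝ → ℝ) → Prop}
    (hP : ∀ ξ, IsAdmissible r ξ → (P ξ ↔ ∃ C : ℝ, ∀ θ ∈ Icc 0 Real.pi, ξ θ = C * xiS r θ)) :
    (Icc 0 Real.pi).domRestrict '' {ξ : ℝ → ℝ | IsAdmissible r ξ ∧ P ξ}
      = (Submodule.span ℝ {(Icc 0 Real.pi).domRestrict (xiS r)} : Set (Icc 0 Real.pi → ℝ)) := by
  ext f
  rw [SetLike.mem_coe, Submodule.mem_span_singleton]
  constructor
  · rintro ⟨ξ, ⟨hξ, hPξ⟩, rfl⟩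
    obtain ⟨C, hC⟩ := (hP ξ hξ).1 hPξ
    refine ⟨C, ?_⟩
    ext θ
    exact (hC θ θ.2).symm
  · rintro ⟨C, rfl⟩
    have hadm := h.const_mul_xiS_isAdmissible C
    exact ⟨fun θ => C * xiS r θ, ⟨hadm, (hP _ hadm).2 ⟨C, fun _ _ => rfl⟩⟩, rfl⟩

end IsCapillaryProfile

/-! ### Horizontal shifts of the free surface. -/

lemma eventually_abs_lt {δ : ℝ} (hδ : 0 < δ) : ∀ᶠ c in 𝓝 (0 : ℝ), |c| < δ := by
  filter_upwards [Metric.ball_mem_nhds (0 : ℝ) hδ] with c hc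
  rwa [mem_ball_zero_iff] at hc

/-- A point at angle `φ`, shifted slightly in the horizontal direction, has a nearby angle `θ`. -/
lemma angle_close_of_shift {ρ N c m θ φ : ℝ} (hθ : θ ∈ Icc 0 Real.pi) (hφ : φ ∈ Icc 0 Real.pi)
    (hm : 0 < m) (hρ : m ≤ ρ) (hN : 0 < N) (hc : |c| ≤ m / 4)
    (hx : ρ * Real.cos φ + c = N * Real.cos θ) (hy : ρ * Real.sin φ = N * Real.sin θ) :
    ρ * Real.sin (φ - θ) = c * Real.sin θ ∧ ρ * Real.cos (φ - θ) = N - c * Real.cos θ ∧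
      |φ - θ| ≤ Real.pi / 8 := by
  have h1 : ρ * Real.sin (φ - θ) = c * Real.sin θ := by
    rw [Real.sin_sub]; linear_combination Real.cos θ * hy - Real.sin θ * hx
  have h2 : ρ * Real.cos (φ - θ) = N - c * Real.cos θ := by
    rw [Real.cos_sub]
    linear_combination Real.sin θ * hy + Real.cos θ * hx + N * Real.sin_sq_add_cos_sq θ
  refine ⟨h1, h2, ?_⟩
  have hρ0 : 0 < ρ := hm.trans_le hρ
  have hsin : |Real.sin (φ - θ)| ≤ 1 / 4 := by
    have h3 : ρ * |Real.sin (φ - θ)| ≤ m / 4 := by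
      rw [← abs_of_pos hρ0, ← abs_mul, h1, abs_mul]
      calc |c| * |Real.sin θ| ≤ |c| * 1 := by gcongr; exact Real.abs_sin_le_one θ
        _ ≤ m / 4 := by linarith
    by_contra! hlt
    nlinarith
  have hcos : -(1 / 4) < Real.cos (φ - θ) := by
    have h3 : |c * Real.cos θ| ≤ m / 4 := by
      rw [abs_mul]
      calc |c| * |Real.cos θ| ≤ |c| * 1 := by gcongr; exact Real.abs_cos_le_one θ
        _ ≤ m / 4 := by linarith
    have h4 := (abs_le.1 h3).2
    by_contra! hlt
    nlinarith
  -- As `|sin| ≤ 1/4` forces `cos² ≥ 15/16`, the lower bound `-1/4` excludes the negative branch.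
  have hcos0 : 0 < Real.cos (φ - θ) := by
    have h3 := Real.sin_sq_add_cos_sq (φ - θ)
    have h4 : Real.sin (φ - θ) ^ 2 ≤ (1 / 4) ^ 2 := by
      rw [← sq_abs]; gcongr
    by_contra! hlt
    nlinarith
  have habs : |φ - θ| ≤ Real.pi := by
    rw [abs_le]; constructor <;> linarith [hθ.1, hθ.2, hφ.1, hφ.2]
  have hhalf : |φ - θ| ≤ Real.pi / 2 := by
    by_contra! hlt
    have := Real.cos_nonpos_of_pi_div_two_le_of_le hlt.le (by linarith [Real.pi_pos])
    rw [Real.cos_abs] at this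
    linarith
  -- Jordan's inequality turns `|sin| ≤ 1/4` into the angle bound `π/8`.
  have h5 := Real.mul_le_sin (abs_nonneg (φ - θ)) hhalf
  have h6 : Real.sin |φ - θ| ≤ 1 / 4 := by
    refine le_trans ?_ hsin
    rcases abs_cases (φ - θ) with ⟨h, _⟩ | ⟨h, _⟩
    · rw [h]; exact le_abs_self _
    · rw [h, Real.sin_neg]; exact neg_le_abs _
  have h7 : 2 / Real.pi * |φ - θ| ≤ 1 / 4 := h5.trans h6
  rw [div_mul_eq_mul_div, div_le_iff₀ Real.pi_pos] at h7
  linarith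

namespace SmoothProfile

variable {r p q s : ℝ → ℝ} (h : SmoothProfile r p q s)
include h

/-- For small shifts, every ray in the upper half plane meets the shifted curve at most once. -/
lemma exists_shift_injective : ∃ δ > 0, ∀ c, |c| < δ → ∀ φ₁ ∈ Icc 0 Real.pi,
    ∀ φ₂ ∈ Icc 0 Real.pi, ∀ θ ∈ Icc 0 Real.pi, ∀ N₁ > 0, ∀ N₂ > 0,
    curveX r φ₁ + c = N₁ * Real.cos θ → curveY r φ₁ = N₁ * Real.sin θ →
    curveX r φ₂ + c = N₂ * Real.cos θ → curveY r φ₂ = N₂ * Real.sin θ → φ₁ = φ₂ := by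
  obtain ⟨m, hm, hmr⟩ := exists_pos_lower_bound h.cont₀ h.pos
  obtain ⟨M, hM⟩ := isCompact_Icc.exists_bound_of_continuousOn h.cont_curveYDeriv
  have hM0 : 0 ≤ M := (norm_nonneg _).trans (hM 0 (left_mem_Icc.2 Real.pi_pos.le))
  have hlip : ∀ φ₁ ∈ Icc 0 Real.pi, ∀ φ₂ ∈ Icc 0 Real.pi,
      |curveY r φ₂ - curveY r φ₁| ≤ M * |φ₂ - φ₁| := fun φ₁ h1 φ₂ h2 =>
    (convex_Icc _ _).norm_image_sub_le_of_norm_hasDerivWithin_le h.deriv_curveY hM h1 h2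
  -- The first bound keeps angles close to the ray. The second makes `|c|` times the Lipschitz
  -- constant of `y` smaller than the Jordan lower bound for `r φ₁ * r φ₂ * |sin (φ₂ - φ₁)|`.
  refine ⟨min (m / 4) (m ^ 2 * (2 / Real.pi) / (M + 1)), lt_min (by positivity)
    (by have := Real.pi_pos; positivity), ?_⟩
  intro c hc φ₁ h1 φ₂ h2 θ hθ N₁ hN₁ N₂ hN₂ hx₁ hy₁ hx₂ hy₂
  have hc1 : |c| ≤ m / 4 := hc.le.trans (min_le_left _ _)
  have hc2 : |c| * (M + 1) < m ^ 2 * (2 / Real.pi) :=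
    (lt_div_iff₀ (by positivity)).1 (hc.trans_le (min_le_right _ _))
  obtain ⟨-, -, ha₁⟩ := angle_close_of_shift hθ h1 hm (hmr _ h1) hN₁ hc1 hx₁ hy₁
  obtain ⟨-, -, ha₂⟩ := angle_close_of_shift hθ h2 hm (hmr _ h2) hN₂ hc1 hx₂ hy₂
  have hd : |φ₂ - φ₁| ≤ Real.pi / 2 := by
    rw [show φ₂ - φ₁ = (φ₂ - θ) - (φ₁ - θ) by ring]
    exact (abs_sub _ _).trans (by linarith [Real.pi_pos])
  -- Two shifted points on one ray have zero cross product; expanding it separates the unshifted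
  -- cross product from a term of order `c`.
  have hcross : r φ₁ * r φ₂ * Real.sin (φ₂ - φ₁) = -(c * (curveY r φ₂ - curveY r φ₁)) := by
    have e : (curveX r φ₁ + c) * curveY r φ₂ - (curveX r φ₂ + c) * curveY r φ₁ = 0 := by
      rw [hx₁, hx₂, hy₁, hy₂]; ring
    rw [Real.sin_sub]
    simp only [curveX, curveY] at e ⊢
    linear_combination e
  have hsin : 2 / Real.pi * |φ₂ - φ₁| ≤ |Real.sin (φ₂ - φ₁)| := by
    refine (Real.mul_le_sin (abs_nonneg _) hd).trans ?_
    rcases abs_cases (φ₂ - φ₁) with ⟨h, _⟩ | ⟨h, _⟩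
    · rw [h]; exact le_abs_self _
    · rw [h, Real.sin_neg]; exact neg_le_abs _
  have habs : r φ₁ * r φ₂ * |Real.sin (φ₂ - φ₁)| = |c| * |curveY r φ₂ - curveY r φ₁| := by
    rw [← abs_mul, ← abs_neg (c * _), ← hcross, abs_mul,
      abs_of_pos (mul_pos (h.pos _ h1) (h.pos _ h2))]
  have hrr : m ^ 2 ≤ r φ₁ * r φ₂ := by
    rw [sq]; exact mul_le_mul (hmr _ h1) (hmr _ h2) hm.le (h.pos _ h1).le
  have hle : m ^ 2 * (2 / Real.pi * |φ₂ - φ₁|) ≤ |c| * (M * |φ₂ - φ₁|) :=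
    calc m ^ 2 * (2 / Real.pi * |φ₂ - φ₁|) ≤ r φ₁ * r φ₂ * |Real.sin (φ₂ - φ₁)| := by
          have := Real.pi_pos
          have := (sq_nonneg m).trans hrr
          gcongr
      _ = |c| * |curveY r φ₂ - curveY r φ₁| := habs
      _ ≤ |c| * (M * |φ₂ - φ₁|) := by
          gcongr
          exact hlip _ h1 _ h2
  by_contra hne
  have hpos : 0 < |φ₂ - φ₁| := abs_pos.2 (sub_ne_zero.2 (Ne.symm hne))
  nlinarith [abs_nonneg c]

/-- For small shifts, every ray in the upper half plane meets the shifted curve. -/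
lemma exists_shift_surjective : ∃ δ > 0, ∀ c, |c| < δ →
    (∀ φ ∈ Icc 0 Real.pi, ∃ θ ∈ Icc 0 Real.pi, ∃ N > 0,
      curveX r φ + c = N * Real.cos θ ∧ curveY r φ = N * Real.sin θ) ∧
    (∀ θ ∈ Icc 0 Real.pi, ∃ φ ∈ Icc 0 Real.pi, ∃ N > 0,
      curveX r φ + c = N * Real.cos θ ∧ curveY r φ = N * Real.sin θ) := by
  have h0I : (0 : ℝ) ∈ Icc 0 Real.pi := left_mem_Icc.2 Real.pi_pos.le
  have hπI : Real.pi ∈ Icc 0 Real.pi := right_mem_Icc.2 Real.pi_pos.le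
  have hr0 := h.pos 0 h0I
  have hrπ := h.pos Real.pi hπI
  -- Keeps the origin strictly between the shifted contact points, so the shifted curve avoids it
  -- and its polar angle still runs from `0` to `π`.
  refine ⟨min (r 0) (r Real.pi), lt_min hr0 hrπ, fun c hc => ?_⟩
  have hc0 := hc.trans_le (min_le_left _ _)
  have hcπ := hc.trans_le (min_le_right _ _)
  have hx0 : 0 < curveX r 0 + c := by
    simp only [curveX, Real.cos_zero, mul_one]; linarith [neg_abs_le c]
  have hxπ : curveX r Real.pi + c < 0 := by
    simp only [curveX, Real.cos_pi]; linarith [le_abs_self c]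
  have hsq : ∀ φ ∈ Icc 0 Real.pi, 0 < (curveX r φ + c) ^ 2 + curveY r φ ^ 2 := fun φ hφ => by
    rcases eq_or_lt_of_le hφ.1 with e0 | e0
    · rw [← e0]; positivity
    rcases eq_or_lt_of_le hφ.2 with e1 | e1
    · rw [e1]; have := sq_pos_of_neg hxπ; positivity
    have := h.curveY_pos ⟨e0, e1⟩
    positivity
  set n : ℝ → ℝ := fun φ => Real.sqrt ((curveX r φ + c) ^ 2 + curveY r φ ^ 2) with hn
  have hnpos : ∀ φ ∈ Icc 0 Real.pi, 0 < n φ := fun φ hφ => Real.sqrt_pos.2 (hsq φ hφ)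
  have hnsq : ∀ φ ∈ Icc 0 Real.pi, n φ ^ 2 = (curveX r φ + c) ^ 2 + curveY r φ ^ 2 :=
    fun φ hφ => Real.sq_sqrt (hsq φ hφ).le
  set A : ℝ → ℝ := fun φ => Real.arccos ((curveX r φ + c) / n φ) with hA
  have hpolar : ∀ φ ∈ Icc 0 Real.pi, curveX r φ + c = n φ * Real.cos (A φ) ∧
      curveY r φ = n φ * Real.sin (A φ) := fun φ hφ => by
    have hp := hnpos φ hφ
    have hxn : (curveX r φ + c) ^ 2 ≤ n φ ^ 2 := by
      rw [hnsq φ hφ]; linarith [sq_nonneg (curveY r φ)]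
    have hle := abs_le_of_sq_le_sq' hxn hp.le
    have h1 : -1 ≤ (curveX r φ + c) / n φ := by
      rw [le_div_iff₀ hp]; linarith
    have h2 : (curveX r φ + c) / n φ ≤ 1 := by
      rw [div_le_iff₀ hp]; linarith
    constructor
    · rw [hA, Real.cos_arccos h1 h2]; field_simp
    · rw [hA, Real.sin_arccos, show 1 - ((curveX r φ + c) / n φ) ^ 2 = (curveY r φ / n φ) ^ 2 by
        field_simp; linarith [hnsq φ hφ],
        Real.sqrt_sq (div_nonneg (h.curveY_nonneg hφ) hp.le)]
      field_simp
  refine ⟨fun φ hφ => ⟨A φ, ⟨Real.arccos_nonneg _, Real.arccos_le_pi _⟩, n φ, hnpos φ hφ,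
    hpolar φ hφ⟩, fun θ hθ => ?_⟩
  have hAc : ContinuousOn A (Icc 0 Real.pi) := by
    have h1 := h.cont_curveX
    have h2 := h.cont_curveY
    have h3 : ContinuousOn n (Icc 0 Real.pi) := by
      simp only [hn]; fun_prop
    exact Real.continuous_arccos.comp_continuousOn
      (ContinuousOn.div (by fun_prop) h3 fun φ hφ => (hnpos φ hφ).ne')
  have hA0 : A 0 = 0 := by
    have : n 0 = curveX r 0 + c := by simp [hn, Real.sqrt_sq hx0.le]
    simp only [hA]
    rw [this, div_self hx0.ne', Real.arccos_one]
  have hAπ : A Real.pi = Real.pi := by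
    have : n Real.pi = -(curveX r Real.pi + c) := by
      simp only [hn, curveY_pi]
      rw [← neg_sq (curveX r Real.pi + c), zero_pow two_ne_zero, add_zero,
        Real.sqrt_sq (by linarith)]
    simp only [hA]
    rw [this, div_neg, div_self hxπ.ne, Real.arccos_neg_one]
  obtain ⟨φ, hφ, rfl⟩ := intermediate_value_Icc Real.pi_pos.le hAc
    (show θ ∈ Icc (A 0) (A Real.pi) by rwa [hA0, hAπ])
  exact ⟨φ, hφ, n φ, hnpos φ hφ, hpolar φ hφ⟩

/-- For small shifts the shifted curve has a positive polar profile. -/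
theorem exists_isHorizontalShift :
    ∃ R : ℝ → ℝ → ℝ, ∀ᶠ c in 𝓝 (0 : ℝ), IsHorizontalShift r c (R c) := by
  obtain ⟨δ₁, hδ₁, hinj⟩ := h.exists_shift_injective
  obtain ⟨δ₂, hδ₂, hsurj⟩ := h.exists_shift_surjective
  have key : ∀ c, ∃ ρ : ℝ → ℝ, |c| < min δ₁ δ₂ → IsHorizontalShift r c ρ := fun c => by
    by_cases hc : |c| < min δ₁ δ₂
    · obtain ⟨hdir, hray⟩ := hsurj c (hc.trans_le (min_le_right _ _))
      have hex : ∀ θ, ∃ ρ, θ ∈ Icc 0 Real.pi → 0 < ρ ∧ ∃ φ ∈ Icc 0 Real.pi,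
          curveX r φ + c = ρ * Real.cos θ ∧ curveY r φ = ρ * Real.sin θ := fun θ => by
        by_cases hθ : θ ∈ Icc 0 Real.pi
        · obtain ⟨φ, hφ, N, hN, h1, h2⟩ := hray θ hθ
          exact ⟨N, fun _ => ⟨hN, φ, hφ, h1, h2⟩⟩
        · exact ⟨0, fun hθ' => absurd hθ' hθ⟩
      choose ρ hρ using hex
      refine ⟨ρ, fun _ => ⟨fun θ hθ => (hρ θ hθ).1, ?_⟩⟩
      ext P
      constructor
      · rintro ⟨θ, hθ, rfl⟩
        obtain ⟨-, φ, hφ, h1, h2⟩ := hρ θ hθ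
        exact ⟨_, ⟨φ, hφ, rfl⟩, Prod.ext h1 h2⟩
      -- The radius chosen on the ray may come from another parameter `φ'`; injectivity identifies
      -- the two.
      · rintro ⟨_, ⟨φ, hφ, rfl⟩, rfl⟩
        obtain ⟨θ, hθ, N, hN, h1, h2⟩ := hdir φ hφ
        obtain ⟨hρ0, φ', hφ', h1', h2'⟩ := hρ θ hθ
        have := hinj c (hc.trans_le (min_le_left _ _)) φ hφ φ' hφ' θ hθ N hN _ hρ0 h1 h2 h1' h2'
        subst this
        exact ⟨θ, hθ, Prod.ext h1'.symm h2'.symm⟩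
    · exact ⟨0, fun hc' => absurd hc' hc⟩
  choose R hR using key
  refine ⟨R, ?_⟩
  filter_upwards [eventually_abs_lt (lt_min hδ₁ hδ₂)] with c hc using hR c hc

/-- The derivative of the shifted profile in the shift parameter is `ξ_s`. -/
theorem hasDerivAt_horizontalShift {R : ℝ → ℝ → ℝ}
    (hR : ∀ᶠ c in 𝓝 (0 : ℝ), IsHorizontalShift r c (R c)) {θ : ℝ} (hθ : θ ∈ Icc 0 Real.pi) :
    HasDerivAt (fun c => R c θ) (xiS r θ) 0 := by
  obtain ⟨m, hm, hmr⟩ := exists_pos_lower_bound h.cont₀ h.pos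
  -- The unshifted angle solves a fixed-point relation, and the new radius is explicit in it. The
  -- explicit factor `c` makes an implicit function theorem unnecessary.
  have hex : ∀ᶠ c in 𝓝 (0 : ℝ), ∃ φ, φ ∈ Icc 0 Real.pi ∧
      φ = θ + Real.arcsin (c * (Real.sin θ / r φ)) ∧
      R c θ = r φ * Real.cos (φ - θ) + c * Real.cos θ := by
    filter_upwards [hR, eventually_abs_lt (show 0 < m / 4 by positivity)] with c hc hcm
    have hmem : (R c θ * Real.cos θ, R c θ * Real.sin θ) ∈ freeSurface (R c) := ⟨θ, hθ, rfl⟩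
    rw [hc.2] at hmem
    obtain ⟨_, ⟨φ, hφ, rfl⟩, he⟩ := hmem
    obtain ⟨h1, h2, h3⟩ := angle_close_of_shift hθ hφ hm (hmr φ hφ) (hc.1 θ hθ) hcm.le
      (congrArg Prod.fst he) (congrArg Prod.snd he)
    refine ⟨φ, hφ, ?_, by linarith⟩
    have hr := (h.pos φ hφ).ne'
    have h4 : c * (Real.sin θ / r φ) = Real.sin (φ - θ) := by
      rw [← mul_div_assoc, ← h1]; field_simp
    have h5 := abs_le.1 h3
    rw [h4, Real.arcsin_sin (by linarith [Real.pi_pos]) (by linarith [Real.pi_pos])]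
    ring
  obtain ⟨φ, hφ⟩ := hex.choice
  have hφ0 : φ 0 = θ := by
    have := hφ.self_of_nhds.2.1
    simpa using this
  have hφI : ∀ᶠ c in 𝓝 (0 : ℝ), φ c ∈ Icc 0 Real.pi := hφ.mono fun _ hc => hc.1
  have hφc : Tendsto φ (𝓝 0) (𝓝 θ) := by
    have h1 : Tendsto (fun c => c * (Real.sin θ / r (φ c))) (𝓝 0) (𝓝 0) := by
      refine squeeze_zero_norm' (a := fun c : ℝ => |c| * (1 / m)) ?_ ?_
      · filter_upwards [hφI] with c hc
        have hr := h.pos _ hc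
        rw [norm_mul, norm_div, Real.norm_eq_abs, Real.norm_eq_abs, Real.norm_eq_abs,
          abs_of_pos hr]
        gcongr
        · exact Real.abs_sin_le_one θ
        · exact hmr _ hc
      · have : Continuous fun c : ℝ => |c| * (1 / m) := by fun_prop
        simpa using this.tendsto 0
    have h2 := ((Real.continuous_arcsin.tendsto 0).comp h1).const_add θ
    rw [Real.arcsin_zero, add_zero] at h2
    exact h2.congr' (hφ.mono fun c hc => hc.2.1.symm)
  have hrφ : Tendsto (fun c => r (φ c)) (𝓝 0) (𝓝 (r θ)) :=
    (h.cont₀ θ hθ).tendsto.comp (tendsto_nhdsWithin_iff.2 ⟨hφc, hφI⟩)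
  have hrθ := (h.pos θ hθ).ne'
  -- A function of the form `c * f c` is differentiable at `0` as soon as `f` has a limit there, so
  -- continuity of `φ` suffices.
  have hu : HasDerivAt (fun c => c * (Real.sin θ / r (φ c))) (Real.sin θ / r θ) 0 := by
    rw [hasDerivAt_iff_tendsto_slope]
    refine ((tendsto_const_nhds.div hrφ hrθ).mono_left nhdsWithin_le_nhds).congr' ?_
    filter_upwards [self_mem_nhdsWithin] with c hc
    have hc' : c ≠ 0 := hc
    rw [slope_def_field, zero_mul, sub_zero, sub_zero, mul_div_cancel_left₀ _ hc']
    rfl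
  have hdφ : HasDerivAt φ (Real.sin θ / r θ) 0 := by
    have h1 : HasDerivAt Real.arcsin 1 ((0 : ℝ) * (Real.sin θ / r (φ 0))) := by
      simpa using Real.hasDerivAt_arcsin (x := 0) (by norm_num) (by norm_num)
    have h2 := (h1.comp (0 : ℝ) hu).const_add θ
    rw [one_mul] at h2
    exact h2.congr_of_eventuallyEq (hφ.mono fun c hc => hc.2.1)
  have hdr : HasDerivAt (fun c => r (φ c)) (p θ * (Real.sin θ / r θ)) 0 := by
    have h1 : HasDerivWithinAt r (p θ) (Icc 0 Real.pi) (φ 0) := by rw [hφ0]; exact h.deriv₁ θ hθ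
    -- Since `φ c` stays in `[0,π]`, the one-sided derivative of `r` is enough when `θ` is an end
    -- point.
    exact (h1.comp (s' := Icc 0 Real.pi) 0 (hdφ.hasDerivWithinAt (s := {c | φ c ∈ Icc 0 Real.pi}))
      fun c hc => hc).hasDerivAt hφI
  have hdcos : HasDerivAt (fun c => Real.cos (φ c - θ)) 0 0 := by
    have := (hdφ.sub_const θ).cos
    simpa [hφ0] using this
  have hfin := (hdr.fun_mul hdcos).fun_add ((hasDerivAt_id (0 : ℝ)).mul_const (Real.cos θ))
  refine (hfin.congr_of_eventuallyEq (hφ.mono fun c hc => hc.2.2)).congr_deriv ?_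
  rw [h.xiS_eq_cos_add hθ, hφ0]
  simp
  ring

end SmoothProfile

end

end SessileDrop

theorem theorem1p2 (g σ γ : ℝ) (hg : 0 < g) (hσ : 0 < σ) (hγ : |γ| / σ < 1)
    (ρ₀ : ℝ → ℝ) (hρ₀ : SessileDrop.IsEquilibrium g σ γ ρ₀) :
    -- `ξ_s` is the horizontal shifting function: the profile of the shifted drop exists for small
    -- shifts `c`, and its derivative in `c` at `c = 0` is `ξ_s`
    ((∃ R : ℝ → ℝ → ℝ, ∀ᶠ c in 𝓝 (0 : ℝ), SessileDrop.IsHorizontalShift ρ₀ c (R c)) ∧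
      ∀ R : ℝ → ℝ → ℝ, (∀ᶠ c in 𝓝 (0 : ℝ), SessileDrop.IsHorizontalShift ρ₀ c (R c)) →
        ∀ θ ∈ Icc 0 Real.pi, HasDerivAt (fun c => R c θ) (SessileDrop.xiS ρ₀ θ) 0) ∧
    -- the second variation exists on all admissible perturbations and is the explicit form `F₀`
    (∀ ξ : ℝ → ℝ, SessileDrop.IsAdmissible ρ₀ ξ →
      (∀ᶠ t in 𝓝 (0 : ℝ), DifferentiableAt ℝ (SessileDrop.energyAlong g σ γ ρ₀ ξ) t) ∧
      HasDerivAt (deriv (SessileDrop.energyAlong g σ γ ρ₀ ξ))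
        (SessileDrop.secondVariationFormula g σ ρ₀ ξ) 0) ∧
    -- `E''(ρ₀)(ξ, ξ) = 0` if and only if `ξ = C ξ_s`
    SessileDrop.IsAdmissible ρ₀ (SessileDrop.xiS ρ₀) ∧
    (∀ ξ : ℝ → ℝ, SessileDrop.IsAdmissible ρ₀ ξ →
      (SessileDrop.secondVariation g σ γ ρ₀ ξ = 0 ↔
        ∃ C : ℝ, ∀ θ ∈ Icc 0 Real.pi, ξ θ = C * SessileDrop.xiS ρ₀ θ)) ∧
    -- `ker E''(ρ₀) = span {ξ_s}` as functions on `[0,π]`: for the null set of the quadratic form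
    -- and for the kernel of the bilinear form
    (Icc 0 Real.pi).domRestrict ''
        {ξ : ℝ → ℝ | SessileDrop.IsAdmissible ρ₀ ξ ∧ SessileDrop.secondVariation g σ γ ρ₀ ξ = 0}
      = (Submodule.span ℝ {(Icc 0 Real.pi).domRestrict (SessileDrop.xiS ρ₀)} :
          Set (Icc 0 Real.pi → ℝ)) ∧
    (Icc 0 Real.pi).domRestrict ''
        {ξ : ℝ → ℝ | SessileDrop.IsAdmissible ρ₀ ξ ∧ ∀ η : ℝ → ℝ, SessileDrop.IsAdmissible ρ₀ η →
          SessileDrop.secondVariationBilin g σ γ ρ₀ ξ η = 0}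
      = (Submodule.span ℝ {(Icc 0 Real.pi).domRestrict (SessileDrop.xiS ρ₀)} :
          Set (Icc 0 Real.pi → ℝ)) := by
  obtain ⟨p, q, s, hs⟩ := hρ₀.exists_smoothProfile
  obtain ⟨μ, h⟩ := hρ₀.exists_isCapillaryProfile hs
  exact ⟨⟨hs.exists_isHorizontalShift, fun R hR θ hθ => hs.hasDerivAt_horizontalShift hR hθ⟩,
    fun ξ hξ => h.hasDerivAt_deriv_energyAlong hξ, h.xiS_isAdmissible,
    fun ξ hξ => h.secondVariation_eq_zero_iff hg hσ hξ,
    h.image_domRestrict_eq_span fun ξ hξ => h.secondVariation_eq_zero_iff hg hσ hξ,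
    h.image_domRestrict_eq_span fun ξ hξ => h.secondVariationBilin_eq_zero_iff hg hσ hξ⟩
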